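/- **Setting.** Let $(\Omega,\mathcal F,P)$ be a complete probability space with a filtration $(\mathcal F_t)_{t\ge0}$ such that $\mathcal F_0$ contains all $P$-null sets, and let $\beta,W$ be independent real $(\mathcal F_t)$-Brownian motions (jointly, i.e. $(\beta,W)$ is a two-dimensional $(\mathcal F_t)$-Brownian motion). Let $a>0$, $\sigma\in[0,\sqrt a]$, $B=\begin{pmatrix}0&1\\0&0\end{pmatrix}$, $\mathbf e_2=\binom01$, $\mathcal F^W_t=\sigma(W_s,\,s\le t)$, and write $z=(x,v)$, $\zeta=(\xi,\eta)$ for points of $\mathbb R^2$. Stochastic integrals are Itô integrals, taken in versions that are adapted and continuous on all of $\Omega$ (such versions exist). **Proposition.** 1. For every $\zeta\in\mathbb R^2$ the linear Langevin SDE $$dZ_t=BZ_t\,dt+\mathbf e_2\,d\big(\sqrt{a-\sigma^2}\,\beta_t-\sigma W_t\big),\qquad Z_0=\zeta,$$ has a solution, unique up to indistinguishability, given by $$Z^\zeta_t=e^{tB}\Big(\zeta+\int_0^te^{-sB}\mathbf e_2\,d\big(\sqrt{a-\sigma^2}\,\beta_s-\sigma W_s\big)\Big).$$ 2. For every $t\ge0$,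 $Z^\zeta_t$ is square integrable and, conditioned to $\mathcal F^W_t$, has normal distribution with mean and covariance matrix given, $P$-a.s., by $$m_t(\zeta):=E[Z^\zeta_t\mid\mathcal F^W_t]=e^{tB}\Big(\zeta-\sigma\int_0^te^{-sB}\mathbf e_2\,dW_s\Big)=\begin{pmatrix}\xi+t\eta-\sigma\int_0^t(t-s)\,dW_s\\ \eta-\sigma W_t\end{pmatrix},$$ $$\mathcal C_t:=\mathrm{cov}(Z^\zeta_t\mid\mathcal F^W_t)=(a-\sigma^2)Q_t,\qquad Q_t:=\int_0^t(e^{sB}\mathbf e_2)(e^{sB}\mathbf e_2)^*ds=\begin{pmatrix}t^3/3&t^2/2\\t^2/2&t\end{pmatrix}.$$ 3. If $\sigma=\sqrt a$, the distribution of $Z^\zeta_t$ conditioned to $\mathcal F^W_t$ is the Dirac delta at $m_t(\zeta)$. If $\sigma<\sqrt a$ and $t>0$, then $Z^\zeta_t$ has, conditioned to $\mathcal F^W_t$, the density $$\Gamma(t,z;0,\zeta)=\frac1{2\pi\sqrt{\det\mathcal C_t}}\exp\Big(-\tfrac12\langle\mathcal C_t^{-1}(z-m_t(\zeta)),z-m_t(\zeta)\rangle\Big)=\Gamma_0(t,z-m_t(\zeta)),$$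 $$\Gamma_0(t,x,v)=\frac{\sqrt3}{\pi t^2(a-\sigma^2)}\exp\Big(-\frac2{a-\sigma^2}\Big(\frac{v^2}t-\frac{3vx}{t^2}+\frac{3x^2}{t^3}\Big)\Big).$$ 4. If $\sigma<\sqrt a$, then for every $T>0$ the function $\Gamma(t,z;0,\zeta)$, $0<t\le T$, is the stochastic fundamental solution, with pole at $(0,\zeta)$, of the SPDE $d_{\mathbf Y}u_t=\frac a2\partial_{vv}u_t\,dt+\sigma\,\partial_vu_t\,dW_t$, $\mathbf Y=\partial_t+v\partial_x$, in the following sense: * For each $\zeta$, $\Gamma(\cdot,\cdot;0,\zeta)$ is predictable on $[t_0,T]\times\Omega$ for every $z$ and every $t_0\in(0,T]$, is twice continuously differentiable in $v$, and is jointly continuous in $(t,z)\in(0,T]\times\mathbb R^2$ together with $\partial_v\Gamma,\partial_{vv}\Gamma$. Moreover, with probability one, for all $0<t_0\le t\le T$ and $z\in\mathbb R^2$ (for suitable versions of the stochastic integrals), $$\Gamma(t,e^{(t-t_0)B}z;0,\zeta)=\Gamma(t_0,z;0,\zeta)+\int_{t_0}^t\tfrac a2(\partial_{vv}\Gamma)(s,e^{(s-t_0)B}z;0,\zeta)\,ds+\int_{t_0}^t\sigma(\partial_v\Gamma)(s,e^{(s-t_0)B}z;0,\zeta)\,dW_s.$$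 * For every bounded continuous $\varphi$ on $\mathbb R^2$ and every $z_0\in\mathbb R^2$, $\displaystyle\lim_{(t,z)\to(0,z_0),\ t>0}\int_{\mathbb R^2}\Gamma(t,z;0,\zeta)\varphi(\zeta)\,d\zeta=\varphi(z_0)$, $P$-a.s. -/

import Mathlib

open MeasureTheory ProbabilityTheory Filter Topology Set
open scoped NNReal ENNReal Matrix

noncomputable section

namespace Langevin

/-! ### The plane, the kinetic matrix and its flow -/

/-- The phase space `ℝ²`; the points are written `z = (x, v)`, with `x = z 0` and `v = z 1`. -/
abbrev Plane : Type := EuclideanSpace ℝ (Fin 2)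

/-- The matrix `B = (0 1; 0 0)`. -/
def kinMat : Matrix (Fin 2) (Fin 2) ℝ := !![0, 1; 0, 0]

/-- The vector `e₂ = (0, 1)`. -/
def e2 : Plane := !₂[0, 1]

/-- The product of a matrix and a vector of the plane. -/
def act (M : Matrix (Fin 2) (Fin 2) ℝ) (z : Plane) : Plane :=
  Matrix.toEuclideanCLM (𝕜 := ℝ) M z

/-- The flow `γ_t(z) = e^{tB} z`. -/
def flow (t : ℝ) (z : Plane) : Plane := act (NormedSpace.exp (t • kinMat)) z

/-- `Q_t = ∫₀ᵗ (e^{sB} e₂)(e^{sB} e₂)^* ds`, integrated entry by entry. -/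
def Qmat (t : ℝ) : Matrix (Fin 2) (Fin 2) ℝ :=
  Matrix.of fun i j => ∫ s in (0 : ℝ)..t, flow s e2 i * flow s e2 j

/-- The covariance matrix `C_t = (a - σ²) Q_t`. -/
def Cmat (a σ t : ℝ) : Matrix (Fin 2) (Fin 2) ℝ := (a - σ ^ 2) • Qmat t

/-- The density at `y` of the centred Gaussian law on the plane with covariance matrix `C`. -/
def gaussDensity (C : Matrix (Fin 2) (Fin 2) ℝ) (y : Plane) : ℝ :=
  1 / (2 * Real.pi * √C.det) * Real.exp (-(1 / 2) * inner ℝ (act C⁻¹ y) y)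

/-- The explicit kernel `Γ₀(t, x, v)`. -/
def Gam0 (a σ t : ℝ) (y : Plane) : ℝ :=
  √3 / (Real.pi * t ^ 2 * (a - σ ^ 2)) *
    Real.exp (-(2 / (a - σ ^ 2)) *
      (y 1 ^ 2 / t - 3 * y 1 * y 0 / t ^ 2 + 3 * y 0 ^ 2 / t ^ 3))

/-! ### Brownian motions, simple integrands and the Itô integral -/

variable {Ω : Type*} {mΩ : MeasurableSpace Ω}

/-- `B` and `W` are independent real Brownian motions with respect to the filtration `𝓕`, that is,
`(B, W)` is a two-dimensional `𝓕`-Brownian motion. -/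
structure IsBrownianPair (𝓕 : Filtration ℝ≥0 mΩ) (P : Measure Ω) (B W : ℝ≥0 → Ω → ℝ) : Prop where
  brownian_left : IsBrownianReal B P
  brownian_right : IsBrownianReal W P
  indep : IndepFun (fun ω t => B t ω) (fun ω t => W t ω) P
  adapted_left : ∀ t, Measurable[𝓕 t] (B t)
  adapted_right : ∀ t, Measurable[𝓕 t] (W t)
  indep_increments : ∀ s t, s ≤ t →
    Indep (MeasurableSpace.comap (fun ω => (B t ω - B s ω, W t ω - W s ω)) inferInstance) (𝓕 s) P

/-- The `σ`-algebra `σ(W_s, s ≤ t)`. -/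
abbrev observed (W : ℝ≥0 → Ω → ℝ) (t : ℝ≥0) : MeasurableSpace Ω :=
  ⨆ s ∈ Set.Iic t, MeasurableSpace.comap (W s) inferInstance

/-- A simple integrand `∑_{i < n} ξ_i 1_{(t_i, t_{i+1}]}`, with `ξ_i` bounded and
`𝓕_{t_i}`-measurable. -/
structure SimpleIntegrand (𝓕 : Filtration ℝ≥0 mΩ) where
  n : ℕ
  time : ℕ → ℝ≥0
  mono : Monotone time
  coef : ℕ → Ω → ℝ
  meas : ∀ i, Measurable[𝓕 (time i)] (coef i)
  bdd : ∃ C : ℝ, ∀ i ω, |coef i ω| ≤ C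

/-- The value at time `s`. -/
def SimpleIntegrand.eval {𝓕 : Filtration ℝ≥0 mΩ} (S : SimpleIntegrand 𝓕) (s : ℝ≥0) (ω : Ω) : ℝ :=
  ∑ i ∈ Finset.range S.n, (Set.Ioc (S.time i) (S.time (i + 1))).indicator (fun _ => S.coef i ω) s

/-- The elementary integral `∫_{t₀}^{t} S dX` for `t₀ ≤ t`. -/
def SimpleIntegrand.integral {𝓕 : Filtration ℝ≥0 mΩ} (S : SimpleIntegrand 𝓕)
    (X : ℝ≥0 → Ω → ℝ) (t₀ t : ℝ≥0) (ω : Ω) : ℝ :=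
  ∑ i ∈ Finset.range S.n, S.coef i ω *
    (X (max t₀ (min (S.time (i + 1)) t)) ω - X (max t₀ (min (S.time i) t)) ω)

/-- `J` is (a continuous adapted version of) the Itô integral `J_t = ∫_{t₀}^{t} H_s dX_s`,
`t₀ ≤ t ≤ T`, of an integrand `H` in `L²([t₀, T] × Ω)`: simple integrands converge to `H` in
`L²(ds ⊗ P)` and their elementary integrals up to time `t` converge to `J_t` in `L²(P)`. The
integrator `X` is an `𝓕`-Brownian motion up to a constant factor. By the Itô isometry
`J` does not depend on the approximating sequence, up to indistinguishability. -/
structure IsItoIntegral (𝓕 : Filtration ℝ≥0 mΩ) (P : Measure Ω) (X : ℝ≥0 → Ω → ℝ)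
    (H : ℝ≥0 → Ω → ℝ) (t₀ T : ℝ≥0) (J : ℝ≥0 → Ω → ℝ) : Prop where
  adapted : ∀ t ∈ Set.Icc t₀ T, Measurable[𝓕 t] (J t)
  cont : ∀ ω, ContinuousOn (fun t => J t ω) (Set.Icc t₀ T)
  meas : AEStronglyMeasurable (fun p : ℝ × Ω => H p.1.toNNReal p.2)
    ((volume.restrict (Set.Ioc (t₀ : ℝ) T)).prod P)
  approx : ∃ S : ℕ → SimpleIntegrand 𝓕,
    Tendsto (fun n => eLpNorm (fun p : ℝ × Ω =>
        (S n).eval p.1.toNNReal p.2 - H p.1.toNNReal p.2) 2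
        ((volume.restrict (Set.Ioc (t₀ : ℝ) T)).prod P)) atTop (𝓝 0) ∧
    ∀ t ∈ Set.Icc t₀ T,
      Tendsto (fun n => eLpNorm (fun ω => (S n).integral X t₀ t ω - J t ω) 2 P) atTop (𝓝 0)

/-- `I` is (a continuous adapted version of) the plane-valued process
`I_t = ∫₀ᵗ e^{-sB} e₂ dX_s`, `t ≥ 0`. -/
def IsFlowIntegral (𝓕 : Filtration ℝ≥0 mΩ) (P : Measure Ω) (X : ℝ≥0 → Ω → ℝ)
    (I : ℝ≥0 → Ω → Plane) : Prop :=
  ∀ T : ℝ≥0, ∀ i : Fin 2,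
    IsItoIntegral 𝓕 P X (fun s _ => flow (-(s : ℝ)) e2 i) 0 T (fun t ω => I t ω i)

/-! ### The Langevin equation -/

/-- The driving noise `√(a - σ²) B - σ W`. -/
def noise (a σ : ℝ) (B W : ℝ≥0 → Ω → ℝ) (t : ℝ≥0) (ω : Ω) : ℝ :=
  √(a - σ ^ 2) * B t ω - σ * W t ω

/-- `Z` is a solution, with initial condition `ζ`, of
`dZ_t = B Z_t dt + e₂ d(√(a - σ²) B_t - σ W_t)`: a continuous adapted process such that almost
surely the integrated equation holds at all times. -/
structure IsLangevinSolution (𝓕 : Filtration ℝ≥0 mΩ) (P : Measure Ω) (B W : ℝ≥0 → Ω → ℝ)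
    (a σ : ℝ) (ζ : Plane) (Z : ℝ≥0 → Ω → Plane) : Prop where
  adapted : ∀ t, Measurable[𝓕 t] (Z t)
  cont : ∀ᵐ ω ∂P, Continuous fun t => Z t ω
  eqn : ∀ᵐ ω ∂P, ∀ t : ℝ≥0,
    Z t ω = ζ + (∫ s in (0 : ℝ)..t, act kinMat (Z s.toNNReal ω))
      + (noise a σ B W t ω - noise a σ B W 0 ω) • e2

/-! ### Conditional laws and covariances -/

/-- The random measure `ν` is the (regular) conditional law of `Y` given the `σ`-algebra `𝓖`. -/
def IsCondLaw (P : Measure Ω) (𝓖 : MeasurableSpace Ω) (Y : Ω → Plane)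
    (ν : Ω → Measure Plane) : Prop :=
  (∀ᵐ ω ∂P, IsProbabilityMeasure (ν ω)) ∧
  ∀ A : Set Plane, MeasurableSet A →
    P[(Y ⁻¹' A).indicator (fun _ => (1 : ℝ)) | 𝓖] =ᵐ[P] fun ω => (ν ω).real A

/-- The entries of the conditional covariance matrix `cov(Y | 𝓖)`. -/
def condCov (P : Measure Ω) (𝓖 : MeasurableSpace Ω) (Y : Ω → Plane) (i j : Fin 2) : Ω → ℝ :=
  P[fun ω => (Y ω i - (P[fun ω' => Y ω' i | 𝓖]) ω) * (Y ω j - (P[fun ω' => Y ω' j | 𝓖]) ω) | 𝓖]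

/-- `m_t(ζ) = e^{tB}(ζ - σ I_t)`, where `I_t` stands for `∫₀ᵗ e^{-sB} e₂ dW_s`. -/
def condMean (σ : ℝ) (I : ℝ≥0 → Ω → Plane) (ζ : Plane) (t : ℝ≥0) (ω : Ω) : Plane :=
  flow t (ζ - σ • I t ω)

/-- The random kernel `Γ(t, z; 0, ζ)`: the Gaussian density with mean `m_t(ζ)` and covariance
`C_t`. -/
def Gam (a σ : ℝ) (I : ℝ≥0 → Ω → Plane) (t : ℝ≥0) (z ζ : Plane) (ω : Ω) : ℝ :=
  gaussDensity (Cmat a σ t) (z - condMean σ I ζ t ω)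

/-! ### Stochastic fundamental solutions -/

/-- The partial derivative `∂_v f`. -/
def dv (f : Plane → ℝ) (z : Plane) : ℝ := deriv (fun v : ℝ => f !₂[z 0, v]) (z 1)

/-- The predictable `σ`-algebra on `[t₀, T] × Ω`, generated by the sets `{t₀} × A` with
`A ∈ 𝓕_{t₀}` and `(r, T] × A` with `t₀ ≤ r` and `A ∈ 𝓕_r`. -/
abbrev predictableOn (𝓕 : Filtration ℝ≥0 mΩ) (t₀ T : ℝ≥0) :
    MeasurableSpace (Set.Icc t₀ T × Ω) :=
  MeasurableSpace.generateFrom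
    ({D | ∃ A, MeasurableSet[𝓕 t₀] A ∧ D = {p | (p.1 : ℝ≥0) = t₀ ∧ p.2 ∈ A}} ∪
     {D | ∃ r A, t₀ ≤ r ∧ MeasurableSet[𝓕 r] A ∧ D = {p | r < (p.1 : ℝ≥0) ∧ p.2 ∈ A}})

/-- `Γ = Γ(t, z; τ, ζ)(ω)`, with `τ` fixed and `τ < t ≤ T`, is a stochastic fundamental solution,
with poles at `(τ, ζ)`, of the equation
`du_t(z) + v ∂_x u_t(z) dt = (a / 2) ∂_vv u_t(z) dt + σ ∂_v u_t(z) dW_t`,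
understood in the Itô sense along the integral curves `t ↦ e^{(t - t₀)B} z` of `v ∂_x`. The
processes `J t₀ z ζ` are versions of the stochastic integrals in the equation, chosen so that
with probability one the equation holds simultaneously for all `t₀ ≤ t` and all `z`. -/
structure IsStochFundSol (𝓕 : Filtration ℝ≥0 mΩ) (P : Measure Ω) (W : ℝ≥0 → Ω → ℝ)
    (a σ : ℝ) (τ T : ℝ≥0) (Γ : ℝ≥0 → Plane → Plane → Ω → ℝ) : Prop where
  predictable : ∀ ζ z t₀, τ < t₀ → t₀ ≤ T →
    Measurable[predictableOn 𝓕 t₀ T] fun p : Set.Icc t₀ T × Ω => Γ p.1 z ζ p.2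
  contDiff : ∀ ζ ω, ∀ t ∈ Set.Ioc τ T, ∀ x : ℝ, ContDiff ℝ 2 fun v : ℝ => Γ t !₂[x, v] ζ ω
  cont : ∀ ζ ω, ContinuousOn (fun p : ℝ≥0 × Plane => Γ p.1 p.2 ζ ω) (Set.Ioc τ T ×ˢ Set.univ)
  cont_dv : ∀ ζ ω, ContinuousOn (fun p : ℝ≥0 × Plane => dv (fun z => Γ p.1 z ζ ω) p.2)
    (Set.Ioc τ T ×ˢ Set.univ)
  cont_dvv : ∀ ζ ω, ContinuousOn (fun p : ℝ≥0 × Plane => dv (dv fun z => Γ p.1 z ζ ω) p.2)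
    (Set.Ioc τ T ×ˢ Set.univ)
  eqn : ∀ ζ, ∃ J : ℝ≥0 → Plane → ℝ≥0 → Ω → ℝ,
    (∀ t₀ z, τ < t₀ → t₀ ≤ T →
      IsItoIntegral 𝓕 P W
        (fun s ω => σ * dv (fun y => Γ s y ζ ω) (flow ((s : ℝ) - t₀) z)) t₀ T (J t₀ z)) ∧
    ∀ᵐ ω ∂P, ∀ t₀ t z, τ < t₀ → t₀ ≤ t → t ≤ T →
      Γ t (flow ((t : ℝ) - t₀) z) ζ ω = Γ t₀ z ζ ω
        + (∫ s in (t₀ : ℝ)..t,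
            1 / 2 * a * dv (dv fun y => Γ s.toNNReal y ζ ω) (flow (s - t₀) z))
        + J t₀ z t ω
  initial : ∀ φ : BoundedContinuousFunction Plane ℝ, ∀ z₀ : Plane, ∀ᵐ ω ∂P,
    Tendsto (fun p : ℝ≥0 × Plane => ∫ ζ, Γ p.1 p.2 ζ ω * φ ζ) (𝓝[>] τ ×ˢ 𝓝 z₀) (𝓝 (φ z₀))

end Langevin

end

/-!
# The stochastic fundamental solution of the Langevin SPDE

The matrix `B` is nilpotent, so the flow is explicit, `e^{tB} (x, v) = (x + t v, v)`, and the
integrands of the stochastic integrals in the linear equation are affine functions of time.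

*Itô integrals.* The Itô isometry for simple integrands (`SimpleIntegrand.eLpNorm_integral_sub`)
shows that the stochastic integral is unique up to indistinguishability (`IsItoIntegral.ae_eq`). It
also gives the criterion `isItoIntegral_of_tendstoInMeasure`: a continuous adapted process to which
the sums over equidistant grids converge in measure is the Itô integral of the given continuous
bounded integrand. For affine integrands, summation by parts identifies the integral with a
pathwise one, `IsItoIntegral.ae_eq_affineIntegral`.

*The Langevin equation.* By integration by parts the stochastic integral `∫ e^{-sB} e₂ dX_s` is a
function of the path of `X` (`IsFlowIntegral.ae_eq`), and the equation is a deterministic linear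
equation for every single path (`langevin_path_iff`). Variation of constants yields existence,
uniqueness and the formula for the solution.

*Conditional laws.* The solution is the sum of `m_t(ζ)`, which is a function of the path of `W` up
to time `t`, and of a Gaussian vector which is a function of the path of `β`
(`IsLangevinSolution.exists_decomposition`). The latter is independent of `W`, centred, and has
covariance matrix `(a - σ²) Q_t` (`IsFlowIntegral.hasLaw`). Freezing the observed part
(`isCondLaw_add_of_indep`) gives the conditional mean, covariance and law. For the density, the
Gaussian law with covariance `(a - σ²) Q_t` is written as a linear image of the standard Gaussian
law of the plane, in `map_gaussMap_eq_multivariateGaussian` and `map_gaussMap_eq_withDensity`.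

*The fundamental solution.* Along the integral curve through `(t₀, z)` the kernel at time `s` is
`Γ₀(s, e^{sB} Y_s)` with `Y_s = e^{-t₀ B} z - ζ + σ ∫₀ˢ e^{-rB} e₂ dW_r`. Without noise,
`s ↦ Γ₀(s, e^{sB} y)` solves a Kolmogorov equation (`hasDerivAt_Gam0_flow`), in which the second
derivative carries the factor `(a - σ²) / 2`. The noise moves the argument `e^{sB} Y_s` in the
direction of `v`, by `σ` times the increment of `W` up to terms of higher order. A second order
Taylor expansion over a grid therefore has three parts: the sum that approximates the stochastic
integral, a sum of second derivatives against squared increments, which supplies the missing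
`σ² / 2` because the quadratic variation of `W` is `t` (`tendstoInMeasure_sum_sq`), and errors that
are small, pathwise because of `exists_forall_remainder_le` and in measure because of
`tendstoInMeasure_sum_cube`. So the process prescribed by the equation is the Itô integral in
question, `IsFlowIntegral.isItoIntegral_spdeIntegral`; it is defined for all `t₀`, `t` and `z` at
once, hence the exceptional null set depends on none of them. The initial condition is a statement
about single paths and follows by dominated convergence (`tendsto_integral_Gam`), and continuous
adapted processes are predictable (`measurable_predictableOn_of_continuousOn`).
-/

noncomputable section

namespace Langevin

variable {Ω : Type*} {mΩ : MeasurableSpace Ω}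

/-! ### The flow and the covariance matrix in coordinates -/

lemma act_fst (M : Matrix (Fin 2) (Fin 2) ℝ) (z : Plane) :
    act M z 0 = M 0 0 * z 0 + M 0 1 * z 1 := by
  simp [act, Matrix.ofLp_toEuclideanCLM, Matrix.mulVec, dotProduct, Fin.sum_univ_two]

lemma act_snd (M : Matrix (Fin 2) (Fin 2) ℝ) (z : Plane) :
    act M z 1 = M 1 0 * z 0 + M 1 1 * z 1 := by
  simp [act, Matrix.ofLp_toEuclideanCLM, Matrix.mulVec, dotProduct, Fin.sum_univ_two]

lemma plane_ext {y z : Plane} (h₀ : y 0 = z 0) (h₁ : y 1 = z 1) : y = z := by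
  ext i; fin_cases i
  · exact h₀
  · exact h₁

/-- The kinetic matrix squares to zero, so its exponential series stops after the linear term. -/
lemma exp_smul_kinMat (t : ℝ) : NormedSpace.exp (t • kinMat) = !![1, t; 0, 1] := by
  have h2 : (t • kinMat) ^ 2 = 0 := by
    ext i j; fin_cases i <;> fin_cases j <;> simp [kinMat, pow_two]
  rw [NormedSpace.exp_eq_tsum ℝ]
  have : (∑' n : ℕ, ((n.factorial : ℝ)⁻¹) • (t • kinMat) ^ n)
      = ∑ n ∈ Finset.range 2, ((n.factorial : ℝ)⁻¹) • (t • kinMat) ^ n := by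
    apply tsum_eq_sum
    intro n hn
    have hn : 2 ≤ n := by simp at hn; omega
    obtain ⟨k, rfl⟩ := Nat.exists_eq_add_of_le hn
    rw [pow_add, h2, zero_mul, smul_zero]
  simp only [this]
  ext i j
  fin_cases i <;> fin_cases j <;> simp [Finset.sum_range_succ, kinMat]

@[simp] lemma flow_fst (t : ℝ) (z : Plane) : flow t z 0 = z 0 + t * z 1 := by
  rw [flow, act_fst, exp_smul_kinMat]; simp

@[simp] lemma flow_snd (t : ℝ) (z : Plane) : flow t z 1 = z 1 := by
  rw [flow, act_snd, exp_smul_kinMat]; simp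

@[simp] lemma e2_fst : e2 0 = 0 := by simp [e2]
@[simp] lemma e2_snd : e2 1 = 1 := by simp [e2]

lemma Qmat_eq (t : ℝ) : Qmat t = !![t ^ 3 / 3, t ^ 2 / 2; t ^ 2 / 2, t] := by
  ext i j
  fin_cases i <;> fin_cases j <;> simp [Qmat]
  · have : (∫ x in (0 : ℝ)..t, x * x) = ∫ x in (0 : ℝ)..t, x ^ 2 := by
      congr 1; ext x; ring
    rw [this, integral_pow]; norm_num

lemma Cmat_eq (a σ t : ℝ) : Cmat a σ t =
    !![(a - σ ^ 2) * (t ^ 3 / 3), (a - σ ^ 2) * (t ^ 2 / 2);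
      (a - σ ^ 2) * (t ^ 2 / 2), (a - σ ^ 2) * t] := by
  rw [Cmat, Qmat_eq]
  ext i j
  fin_cases i <;> fin_cases j <;> simp

lemma Cmat_posSemidef {a σ t : ℝ} (h : 0 ≤ a - σ ^ 2) (ht : 0 ≤ t) :
    (Cmat a σ t).PosSemidef := by
  rw [Cmat_eq]
  refine Matrix.PosSemidef.of_dotProduct_mulVec_nonneg ?_ fun x => ?_
  · ext i j; fin_cases i <;> fin_cases j <;> simp
  · have : star x ⬝ᵥ (!![(a - σ ^ 2) * (t ^ 3 / 3), (a - σ ^ 2) * (t ^ 2 / 2);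
      (a - σ ^ 2) * (t ^ 2 / 2), (a - σ ^ 2) * t]).mulVec x
        = (a - σ ^ 2) * (t * ((x 1 + t * x 0 / 2) ^ 2 + t ^ 2 * x 0 ^ 2 / 12)) := by
      simp [Matrix.mulVec, dotProduct, Fin.sum_univ_two]; ring
    rw [this]; positivity

lemma inner_plane (y z : Plane) : inner ℝ y z = y 0 * z 0 + y 1 * z 1 := by
  simp [PiLp.inner_apply, Fin.sum_univ_two, mul_comm]

lemma gaussDensity_eq_Gam0 {a σ t : ℝ} (h : 0 < a - σ ^ 2) (ht : 0 < t) (y : Plane) :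
    gaussDensity (Cmat a σ t) y = Gam0 a σ t y := by
  set c := a - σ ^ 2 with hc
  have hdet : (Cmat a σ t).det = (c * t ^ 2 / (2 * √3)) ^ 2 := by
    rw [Cmat_eq, Matrix.det_fin_two_of, ← hc, div_pow, mul_pow, mul_pow 2,
      Real.sq_sqrt (by norm_num : (0 : ℝ) ≤ 3)]
    ring
  have hsqrt : √(Cmat a σ t).det = c * t ^ 2 / (2 * √3) := by
    rw [hdet, Real.sqrt_sq (by positivity)]
  have hinv : (Cmat a σ t)⁻¹ =
      !![12 / (c * t ^ 3), -(6 / (c * t ^ 2)); -(6 / (c * t ^ 2)), 4 / (c * t)] := by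
    apply Matrix.inv_eq_right_inv
    rw [Cmat_eq, ← hc]
    ext i j
    fin_cases i <;> fin_cases j <;> simp [Matrix.mul_apply, Fin.sum_univ_two] <;> field_simp <;>
      ring
  rw [gaussDensity, Gam0, hsqrt, hinv, inner_plane, act_fst, act_snd, ← hc]
  congr 1
  · have h3 : √3 ≠ 0 := by positivity
    field_simp
  · congr 1
    simp
    field_simp
    ring

lemma sub_sq_nonneg_of_le_sqrt {a σ : ℝ} (ha : 0 < a) (hσ₀ : 0 ≤ σ) (hσ : σ ≤ √a) :
    0 ≤ a - σ ^ 2 := by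
  have := pow_le_pow_left₀ hσ₀ hσ 2
  rw [Real.sq_sqrt ha.le] at this
  linarith

lemma sub_sq_pos_of_lt_sqrt {a σ : ℝ} (ha : 0 < a) (hσ₀ : 0 ≤ σ) (hσ : σ < √a) :
    0 < a - σ ^ 2 := by
  have := pow_lt_pow_left₀ hσ hσ₀ two_ne_zero
  rw [Real.sq_sqrt ha.le] at this
  linarith

lemma Gam_eq_Gam0 {Ω : Type*} {a σ : ℝ} (h : 0 < a - σ ^ 2) (I : ℝ≥0 → Ω → Plane) {t : ℝ≥0}
    (ht : 0 < t) (z ζ : Plane) (ω : Ω) :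
    Gam a σ I t z ζ ω = Gam0 a σ t (z - condMean σ I ζ t ω) :=
  gaussDensity_eq_Gam0 h (by exact_mod_cast ht) _

/-! ### Brownian motions up to a constant factor -/

/-- `X` is an `𝓕`-Brownian motion with variance rate `c`, that is, `√c` times a standard one up to
its initial value, which is not prescribed. -/
structure IsScaledBM (𝓕 : Filtration ℝ≥0 mΩ) (P : Measure Ω) (X : ℝ≥0 → Ω → ℝ) (c : ℝ≥0) :
    Prop where
  adapted : ∀ t, Measurable[𝓕 t] (X t)
  law : ∀ s t, s ≤ t → HasLaw (fun ω => X t ω - X s ω) (gaussianReal 0 (c * (t - s))) P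
  indep : ∀ s t, s ≤ t →
    Indep (MeasurableSpace.comap (fun ω => X t ω - X s ω) inferInstance) (𝓕 s) P
  cont : ∀ᵐ ω ∂P, Continuous fun t => X t ω

lemma hasLaw_sub_of_isBrownianReal {P : Measure Ω} {B : ℝ≥0 → Ω → ℝ}
    (h : IsBrownianReal B P) {s t : ℝ≥0} (hst : s ≤ t) :
    HasLaw (fun ω => B t ω - B s ω) (gaussianReal 0 (t - s)) P := by
  have := h.hasLaw_sub t s
  have h2 : nndist t.1 s.1 = t - s := by
    rw [← NNReal.coe_inj, coe_nndist, Real.dist_eq, NNReal.coe_sub hst, abs_of_nonneg]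
    · rfl
    · exact sub_nonneg.2 hst
  rw [h2] at this
  exact this

lemma IsBrownianPair.isScaledBM_right {𝓕 : Filtration ℝ≥0 mΩ} {P : Measure Ω}
    {B W : ℝ≥0 → Ω → ℝ} (h : IsBrownianPair 𝓕 P B W) : IsScaledBM 𝓕 P W 1 where
  adapted := h.adapted_right
  law s t hst := by simpa using hasLaw_sub_of_isBrownianReal h.brownian_right hst
  indep s t hst := by
    refine indep_of_indep_of_le_left (h.indep_increments s t hst) ?_
    rw [show (fun ω => W t ω - W s ω) = Prod.snd ∘ fun ω => (B t ω - B s ω, W t ω - W s ω) from rfl,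
      ← MeasurableSpace.comap_comp]
    exact MeasurableSpace.comap_mono measurable_snd.comap_le
  cont := h.brownian_right.cont

lemma IsBrownianPair.isScaledBM_left {𝓕 : Filtration ℝ≥0 mΩ} {P : Measure Ω}
    {B W : ℝ≥0 → Ω → ℝ} (h : IsBrownianPair 𝓕 P B W) : IsScaledBM 𝓕 P B 1 where
  adapted := h.adapted_left
  law s t hst := by simpa using hasLaw_sub_of_isBrownianReal h.brownian_left hst
  indep s t hst := by
    refine indep_of_indep_of_le_left (h.indep_increments s t hst) ?_
    rw [show (fun ω => B t ω - B s ω) = Prod.fst ∘ fun ω => (B t ω - B s ω, W t ω - W s ω) from rfl,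
      ← MeasurableSpace.comap_comp]
    exact MeasurableSpace.comap_mono measurable_fst.comap_le
  cont := h.brownian_left.cont

lemma IsBrownianPair.isScaledBM_noise {𝓕 : Filtration ℝ≥0 mΩ} {P : Measure Ω}
    {B W : ℝ≥0 → Ω → ℝ} (h : IsBrownianPair 𝓕 P B W) (a σ : ℝ) :
    ∃ c, IsScaledBM 𝓕 P (noise a σ B W) c := by
  refine ⟨.mk (√(a - σ ^ 2) ^ 2) (sq_nonneg _) + .mk ((-σ) ^ 2) (sq_nonneg _), ?_, ?_, ?_, ?_⟩
  · intro t
    exact ((h.adapted_left t).const_mul _).sub ((h.adapted_right t).const_mul _)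
  · intro s t hst
    have h1 := gaussianReal_const_mul (hasLaw_sub_of_isBrownianReal h.brownian_left hst)
      (√(a - σ ^ 2))
    have h2 := gaussianReal_const_mul (hasLaw_sub_of_isBrownianReal h.brownian_right hst)
      (-σ)
    have hi : IndepFun (fun ω => √(a - σ ^ 2) * (B t ω - B s ω))
        (fun ω => -σ * (W t ω - W s ω)) P :=
      h.indep.comp (φ := fun b : ℝ≥0 → ℝ => √(a - σ ^ 2) * (b t - b s))
        (ψ := fun b : ℝ≥0 → ℝ => -σ * (b t - b s)) (by fun_prop) (by fun_prop)
    have := gaussianReal_add_gaussianReal_of_indepFun hi h1.map_eq h2.map_eq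
    have h3 : (fun ω => noise a σ B W t ω - noise a σ B W s ω) =
        (fun ω => √(a - σ ^ 2) * (B t ω - B s ω)) + fun ω => -σ * (W t ω - W s ω) := by
      ext ω; simp [noise]; ring
    rw [h3]
    refine ⟨h1.aemeasurable.add h2.aemeasurable, ?_⟩
    rw [this, add_mul]
    simp
  · intro s t hst
    refine indep_of_indep_of_le_left (h.indep_increments s t hst) ?_
    have h3 : (fun ω => noise a σ B W t ω - noise a σ B W s ω) =
        (fun p : ℝ × ℝ => √(a - σ ^ 2) * p.1 - σ * p.2) ∘
          fun ω => (B t ω - B s ω, W t ω - W s ω) := by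
      ext ω; simp [noise]; ring
    rw [h3, ← MeasurableSpace.comap_comp]
    exact MeasurableSpace.comap_mono
      (Measurable.comap_le (f := fun p : ℝ × ℝ => √(a - σ ^ 2) * p.1 - σ * p.2) (by fun_prop))
  · filter_upwards [h.brownian_left.cont, h.brownian_right.cont] with ω h1 h2
    unfold noise
    fun_prop

namespace IsScaledBM

variable {𝓕 : Filtration ℝ≥0 mΩ} {P : Measure Ω} {X : ℝ≥0 → Ω → ℝ} {c : ℝ≥0}

lemma measurable (hX : IsScaledBM 𝓕 P X c) (t : ℝ≥0) : Measurable (X t) :=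
  (hX.adapted t).mono (𝓕.le t) le_rfl

lemma memLp_sub (hX : IsScaledBM 𝓕 P X c) {s t : ℝ≥0} (hst : s ≤ t) {p : ℝ≥0∞} (hp : p ≠ ∞) :
    MemLp (fun ω => X t ω - X s ω) p P := by
  have h := hX.law s t hst
  have : MemLp (id ∘ fun ω => X t ω - X s ω) p P := by
    refine MemLp.comp_of_map ?_ h.aemeasurable
    rw [h.map_eq]
    exact memLp_id_gaussianReal' p hp
  exact this

/-- A random variable known at time `s` is uncorrelated with every function of the increment
after `s`. -/
lemma integral_mul_comp_sub (hX : IsScaledBM 𝓕 P X c) {s t : ℝ≥0} (hst : s ≤ t) {Y : Ω → ℝ}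
    (hY : Measurable[𝓕 s] Y) {h : ℝ → ℝ} (hh : Measurable h) :
    ∫ ω, Y ω * h (X t ω - X s ω) ∂P = (∫ ω, Y ω ∂P) * ∫ ω, h (X t ω - X s ω) ∂P := by
  have hi : IndepFun Y (fun ω => h (X t ω - X s ω)) P := by
    rw [IndepFun_iff_Indep]
    refine (indep_of_indep_of_le_left (indep_of_indep_of_le_right (hX.indep s t hst)
      hY.comap_le) ?_).symm
    rw [show (fun ω => h (X t ω - X s ω)) = h ∘ fun ω => X t ω - X s ω from rfl,
      ← MeasurableSpace.comap_comp]
    exact MeasurableSpace.comap_mono hh.comap_le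
  have hYm : Measurable Y := hY.mono (𝓕.le s) le_rfl
  exact hi.integral_fun_mul_eq_mul_integral hYm.aestronglyMeasurable
    (hh.comp ((hX.measurable t).sub (hX.measurable s))).aestronglyMeasurable

lemma integral_sub_eq_zero (hX : IsScaledBM 𝓕 P X c) {s t : ℝ≥0} (hst : s ≤ t) :
    ∫ ω, (X t ω - X s ω) ∂P = 0 := by
  rw [(hX.law s t hst).integral_eq]
  exact integral_id_gaussianReal

lemma integral_sub_sq (hX : IsScaledBM 𝓕 P X c) {s t : ℝ≥0} (hst : s ≤ t) :
    ∫ ω, (X t ω - X s ω) ^ 2 ∂P = c * (t - s) := by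
  have h1 := (hX.law s t hst).variance_eq
  rw [variance_id_gaussianReal, variance_of_integral_eq_zero
    (hX.law s t hst).aemeasurable (hX.integral_sub_eq_zero hst)] at h1
  rw [h1]
  push_cast [NNReal.coe_sub hst]
  rfl

/-- Absolute moments of the increments are those of a standard Gaussian, scaled. -/
lemma integral_comp_sub (hX : IsScaledBM 𝓕 P X c) {s t : ℝ≥0} (hst : s ≤ t) {h : ℝ → ℝ}
    (hh : Measurable h) :
    ∫ ω, h (X t ω - X s ω) ∂P =
      ∫ x, h (√(c * (t - s)) * x) ∂(gaussianReal 0 1) := by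
  have h1 : gaussianReal 0 (c * (t - s)) =
      (gaussianReal 0 1).map (fun x => √(c * (t - s)) * x) := by
    rw [gaussianReal_map_const_mul]
    congr 1
    · simp
    · rw [← NNReal.coe_inj]
      have : (0 : ℝ) ≤ t - s := sub_nonneg.2 (NNReal.coe_le_coe.2 hst)
      simp [mul_pow, Real.sq_sqrt this, NNReal.coe_sub hst]
  have h2 := (hX.law s t hst).integral_comp (f := h) hh.aestronglyMeasurable
  rw [Function.comp_def] at h2
  rw [h2, h1, integral_map (by fun_prop) hh.aestronglyMeasurable]

end IsScaledBM

/-! ### The Itô isometry for simple integrands -/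

lemma eLpNorm_two_eq_sqrt {α : Type*} {m : MeasurableSpace α} {μ : Measure α} {f : α → ℝ}
    (hf : MemLp f 2 μ) : eLpNorm f 2 μ = ENNReal.ofReal √(∫ x, f x ^ 2 ∂μ) := by
  rw [hf.eLpNorm_eq_integral_rpow_norm two_ne_zero ENNReal.ofNat_ne_top, Real.sqrt_eq_rpow]
  simp

lemma integral_sub_sq_eq {α : Type*} {m : MeasurableSpace α} {μ : Measure α} {f g : α → ℝ}
    (hf : MemLp f 2 μ) (hg : MemLp g 2 μ) :
    ∫ x, (f x - g x) ^ 2 ∂μ =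
      ∫ x, f x * f x ∂μ - 2 * ∫ x, f x * g x ∂μ + ∫ x, g x * g x ∂μ := by
  have h1 : Integrable (fun x => f x * f x) μ := hf.integrable_mul hf
  have h2 : Integrable (fun x => f x * g x) μ := hf.integrable_mul hg
  have h3 : Integrable (fun x => g x * g x) μ := hg.integrable_mul hg
  have h4 : Integrable (fun x => f x * f x - 2 * (f x * g x)) μ := h1.sub (h2.const_mul 2)
  rw [← integral_const_mul, ← integral_sub h1 (h2.const_mul 2), ← integral_add h4 h3]
  congr 1; ext x; ring

namespace IsScaledBM

variable {𝓕 : Filtration ℝ≥0 mΩ} {P : Measure Ω} [IsProbabilityMeasure P] {X : ℝ≥0 → Ω → ℝ}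
  {c : ℝ≥0}

omit [IsProbabilityMeasure P] in
lemma integrable_mul_sub_mul_sub (hX : IsScaledBM 𝓕 P X c) {a b a' b' : ℝ≥0} (hab : a ≤ b)
    (hab' : a' ≤ b') {η : Ω → ℝ} (hη : Measurable η) {C : ℝ} (hC : ∀ ω, |η ω| ≤ C) :
    Integrable (fun ω => η ω * ((X b ω - X a ω) * (X b' ω - X a' ω))) P := by
  have h := (hX.memLp_sub hab ENNReal.ofNat_ne_top (p := 2)).integrable_mul
    (hX.memLp_sub hab' ENNReal.ofNat_ne_top (p := 2))
  exact h.bdd_mul hη.aestronglyMeasurable (c := C) (ae_of_all _ hC)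

omit [IsProbabilityMeasure P] in
lemma integral_mul_sub_mul_sub_left (hX : IsScaledBM 𝓕 P X c) {s u v : ℝ≥0} (hsu : s ≤ u)
    (hsv : s ≤ v) {η : Ω → ℝ} (hη : Measurable[𝓕 s] η) {C : ℝ} (hC : ∀ ω, |η ω| ≤ C) :
    ∫ ω, η ω * ((X u ω - X s ω) * (X v ω - X s ω)) ∂P =
      (∫ ω, η ω ∂P) * (c * (min (u : ℝ) v - s)) := by
  wlog huv : u ≤ v generalizing u v
  · have := this hsv hsu (le_of_not_ge huv)
    rw [min_comm, ← this]
    congr 1; ext ω; ring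
  have hηm : Measurable η := hη.mono (𝓕.le s) le_rfl
  have h1 : ∫ ω, η ω * ((X u ω - X s ω) * (X u ω - X s ω)) ∂P =
      (∫ ω, η ω ∂P) * (c * (u - s : ℝ)) := by
    rw [← hX.integral_sub_sq hsu, ← hX.integral_mul_comp_sub hsu hη (h := fun x => x ^ 2)
      (by fun_prop)]
    congr 1; ext ω; ring
  have h2 : ∫ ω, η ω * ((X u ω - X s ω) * (X v ω - X u ω)) ∂P = 0 := by
    have h3 := hX.integral_mul_comp_sub huv (Y := fun ω => η ω * (X u ω - X s ω))
      ((hη.mono (𝓕.mono hsu) le_rfl).mul ((hX.adapted u).sub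
        ((hX.adapted s).mono (𝓕.mono hsu) le_rfl))) (h := fun x => x) measurable_id
    rw [hX.integral_sub_eq_zero huv, mul_zero] at h3
    rw [← h3]
    congr 1; ext ω; ring
  have h4 := integral_add (hX.integrable_mul_sub_mul_sub hsu hsu hηm hC)
      (hX.integrable_mul_sub_mul_sub hsu huv hηm hC)
  rw [h2, h1, add_zero] at h4
  rw [min_eq_left (NNReal.coe_le_coe.2 huv), ← h4]
  congr 1; ext ω; ring

omit [IsProbabilityMeasure P] in
/-- The Itô isometry for a pair of elementary terms, with possibly overlapping intervals. -/
lemma integral_mul_elementary (hX : IsScaledBM 𝓕 P X c) {a b a' b' : ℝ≥0} (hab : a ≤ b)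
    (hab' : a' ≤ b') {ξ ξ' : Ω → ℝ} (hξm : Measurable ξ) (hξm' : Measurable ξ')
    (hξ : a = b ∨ Measurable[𝓕 a] ξ) (hξ' : a' = b' ∨ Measurable[𝓕 a'] ξ')
    {C C' : ℝ} (hC : ∀ ω, |ξ ω| ≤ C) (hC' : ∀ ω, |ξ' ω| ≤ C') :
    ∫ ω, (ξ ω * (X b ω - X a ω)) * (ξ' ω * (X b' ω - X a' ω)) ∂P =
      (∫ ω, ξ ω * ξ' ω ∂P) * (c * max 0 (min (b : ℝ) b' - max (a : ℝ) a')) := by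
  rcases hξ with rfl | hξ
  · rw [max_eq_left]
    · simp
    · have h1 := min_le_left (a : ℝ) b'
      have h2 := le_max_left (a : ℝ) a'
      linarith
  rcases hξ' with rfl | hξ'
  · rw [max_eq_left]
    · simp
    · have h1 := min_le_right (b : ℝ) a'
      have h2 := le_max_right (a : ℝ) a'
      linarith
  wlog haa : a ≤ a' generalizing a b a' b' ξ ξ' C C'
  · have := this hab' hab hξm' hξm hC' hC hξ' hξ (le_of_not_ge haa)
    rw [min_comm, max_comm (a : ℝ)]
    simp only [mul_comm (ξ _) (ξ' _), ← this]
    congr 1; ext ω; ring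
  have hξa : Measurable[𝓕 a'] ξ := hξ.mono (𝓕.mono haa) le_rfl
  have hCC : ∀ ω, |ξ ω * ξ' ω| ≤ C * C' := fun ω => by
    rw [abs_mul]
    exact mul_le_mul (hC ω) (hC' ω) (abs_nonneg _) ((abs_nonneg _).trans (hC ω))
  have key : ∀ u, a ≤ u → u ≤ a' →
      ∫ ω, (ξ ω * ξ' ω) * ((X u ω - X a ω) * (X b' ω - X a' ω)) ∂P = 0 := by
    intro u hau hua
    have h3 := hX.integral_mul_comp_sub hab' (Y := fun ω => ξ ω * ξ' ω * (X u ω - X a ω))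
      ((hξa.mul hξ').mul (((hX.adapted u).mono (𝓕.mono hua) le_rfl).sub
        ((hX.adapted a).mono (𝓕.mono haa) le_rfl))) (h := fun x => x) measurable_id
    rw [hX.integral_sub_eq_zero hab', mul_zero] at h3
    rw [← h3]
    congr 1; ext ω; ring
  have e1 : ∀ ω, (ξ ω * (X b ω - X a ω)) * (ξ' ω * (X b' ω - X a' ω)) =
      (ξ ω * ξ' ω) * ((X b ω - X a ω) * (X b' ω - X a' ω)) := fun ω => by ring
  simp only [e1]
  rcases le_total b a' with hba | hba
  · rw [key b hab hba, max_eq_left, mul_zero, mul_zero]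
    have h1 := min_le_left (b : ℝ) b'
    have h2 := le_max_right (a : ℝ) a'
    have h3 : (b : ℝ) ≤ a' := hba
    linarith
  · have e2 : ∀ ω, (ξ ω * ξ' ω) * ((X b ω - X a ω) * (X b' ω - X a' ω)) =
        (ξ ω * ξ' ω) * ((X a' ω - X a ω) * (X b' ω - X a' ω)) +
        (ξ ω * ξ' ω) * ((X b ω - X a' ω) * (X b' ω - X a' ω)) := fun ω => by ring
    simp only [e2]
    have i1 := hX.integrable_mul_sub_mul_sub haa hab' (hξm.mul hξm') hCC
    have i2 := hX.integrable_mul_sub_mul_sub hba hab' (hξm.mul hξm') hCC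
    have h5 := hX.integral_mul_sub_mul_sub_left hba hab' (hξa.mul hξ') hCC
    simp only [Pi.mul_apply] at i1 i2 h5
    rw [integral_add i1 i2, key a' haa le_rfl, zero_add,
      h5, max_eq_right (NNReal.coe_le_coe.2 haa), max_eq_right]
    have : (a' : ℝ) ≤ min (b : ℝ) b' := le_min hba hab'
    linarith

end IsScaledBM

namespace SimpleIntegrand

variable {𝓕 : Filtration ℝ≥0 mΩ}

lemma measurable_coef (S : SimpleIntegrand 𝓕) (i : ℕ) : Measurable (S.coef i) :=
  (S.meas i).mono (𝓕.le _) le_rfl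

lemma eval_toNNReal (S : SimpleIntegrand 𝓕) (s : ℝ) (ω : Ω) :
    S.eval s.toNNReal ω = ∑ i ∈ Finset.range S.n,
      (Set.Ioc (S.time i : ℝ) (S.time (i + 1))).indicator (fun _ => (1 : ℝ)) s * S.coef i ω := by
  unfold eval
  refine Finset.sum_congr rfl fun i _ => ?_
  have : s.toNNReal ∈ Set.Ioc (S.time i) (S.time (i + 1)) ↔
      s ∈ Set.Ioc (S.time i : ℝ) (S.time (i + 1)) := by
    simp [Set.mem_Ioc, Real.lt_toNNReal_iff_coe_lt, Real.toNNReal_le_iff_le_coe]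
  by_cases h : s ∈ Set.Ioc (S.time i : ℝ) (S.time (i + 1))
  · rw [Set.indicator_of_mem (this.2 h), Set.indicator_of_mem h, one_mul]
  · rw [Set.indicator_of_notMem (fun h' => h (this.1 h')), Set.indicator_of_notMem h, zero_mul]

lemma measurable_eval (S : SimpleIntegrand 𝓕) :
    Measurable fun p : ℝ × Ω => S.eval p.1.toNNReal p.2 := by
  simp only [eval_toNNReal]
  refine Finset.measurable_sum _ fun i _ => ?_
  exact ((measurable_const.indicator measurableSet_Ioc).comp measurable_fst).mul
    ((S.measurable_coef i).comp measurable_snd)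

lemma exists_abs_eval_le (S : SimpleIntegrand 𝓕) : ∃ C, ∀ s ω, |S.eval s ω| ≤ C := by
  obtain ⟨C, hC⟩ := S.bdd
  refine ⟨∑ i ∈ Finset.range S.n, |C|, fun s ω => ?_⟩
  refine (Finset.abs_sum_le_sum_abs _ _).trans (Finset.sum_le_sum fun i _ => ?_)
  by_cases h : s ∈ Set.Ioc (S.time i) (S.time (i + 1))
  · rw [Set.indicator_of_mem h]; exact (hC i ω).trans (le_abs_self C)
  · rw [Set.indicator_of_notMem h]; simp

lemma memLp_eval (S : SimpleIntegrand 𝓕) (μ : Measure (ℝ × Ω)) [IsFiniteMeasure μ] (p : ℝ≥0∞) :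
    MemLp (fun p : ℝ × Ω => S.eval p.1.toNNReal p.2) p μ := by
  obtain ⟨C, hC⟩ := S.exists_abs_eval_le
  exact MemLp.of_bound S.measurable_eval.aestronglyMeasurable C (ae_of_all _ fun p => hC _ _)

variable {P : Measure Ω} [IsProbabilityMeasure P] {X : ℝ≥0 → Ω → ℝ} {c : ℝ≥0}

lemma clamp_mono (S : SimpleIntegrand 𝓕) (t₀ t : ℝ≥0) (i : ℕ) :
    max t₀ (min (S.time i) t) ≤ max t₀ (min (S.time (i + 1)) t) :=
  max_le_max le_rfl (min_le_min (S.mono (Nat.le_succ i)) le_rfl)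

omit [IsProbabilityMeasure P] in
lemma memLp_term (S : SimpleIntegrand 𝓕) (hX : IsScaledBM 𝓕 P X c) (t₀ t : ℝ≥0) (i : ℕ) :
    MemLp (fun ω => S.coef i ω *
      (X (max t₀ (min (S.time (i + 1)) t)) ω - X (max t₀ (min (S.time i) t)) ω)) 2 P := by
  obtain ⟨C, hC⟩ := S.bdd
  have h1 : MemLp (S.coef i) ∞ P :=
    memLp_top_of_bound (S.measurable_coef i).aestronglyMeasurable C (ae_of_all _ (hC i))
  exact (hX.memLp_sub (S.clamp_mono t₀ t i) ENNReal.ofNat_ne_top (p := 2)).mul h1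

omit [IsProbabilityMeasure P] in
lemma memLp_integral (S : SimpleIntegrand 𝓕) (hX : IsScaledBM 𝓕 P X c) (t₀ t : ℝ≥0) :
    MemLp (S.integral X t₀ t) 2 P :=
  memLp_finsetSum _ fun i _ => S.memLp_term hX t₀ t i

/-- Either the truncated interval is empty, or the coefficient is known at its left end. -/
lemma adapted_term (S : SimpleIntegrand 𝓕) (t₀ t : ℝ≥0) (i : ℕ) :
    max t₀ (min (S.time i) t) = max t₀ (min (S.time (i + 1)) t) ∨
      Measurable[𝓕 (max t₀ (min (S.time i) t))] (S.coef i) := by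
  rcases le_total (S.time i) t with h | h
  · right
    refine (S.meas i).mono (𝓕.mono ?_) le_rfl
    rw [min_eq_left h]
    exact le_max_right _ _
  · left
    rw [min_eq_right h, min_eq_right (h.trans (S.mono (Nat.le_succ i)))]

/-- The length of the intersection of two intervals, both truncated to `[t₀, t]`. -/
lemma max_zero_clamp_sub_clamp {t₀ t a b a' b' : ℝ} (ht : t₀ ≤ t) :
    max 0 (min (max t₀ (min b t)) (max t₀ (min b' t)) -
      max (max t₀ (min a t)) (max t₀ (min a' t))) =
    max (min t (min b b') - max t₀ (max a a')) 0 := by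
  have hm : Monotone fun x => max t₀ (min x t) := fun x y h =>
    max_le_max le_rfl (min_le_min h le_rfl)
  have h1 := (hm.map_min (a := b) (b := b')).symm
  have h2 := (hm.map_max (a := a) (b := a')).symm
  rw [h1, h2]
  generalize min b b' = β
  generalize max a a' = α
  simp only [max_def, min_def]
  split_ifs <;> linarith

/-- The Itô isometry in polarized form, for simple integrands without a common partition. -/
lemma integral_mul_integral (S S' : SimpleIntegrand 𝓕) (hX : IsScaledBM 𝓕 P X c) {t₀ t : ℝ≥0}
    (ht : t₀ ≤ t) :
    ∫ ω, S.integral X t₀ t ω * S'.integral X t₀ t ω ∂P =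
      c * ∫ p, S.eval p.1.toNNReal p.2 * S'.eval p.1.toNNReal p.2
        ∂((volume.restrict (Set.Ioc (t₀ : ℝ) t)).prod P) := by
  obtain ⟨C, hC⟩ := S.bdd
  obtain ⟨C', hC'⟩ := S'.bdd
  have ht' : (t₀ : ℝ) ≤ t := ht
  have hint : ∀ i j, Integrable (fun ω => S.coef i ω *
      (X (max t₀ (min (S.time (i + 1)) t)) ω - X (max t₀ (min (S.time i) t)) ω) *
      (S'.coef j ω *
      (X (max t₀ (min (S'.time (j + 1)) t)) ω - X (max t₀ (min (S'.time j) t)) ω))) P :=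
    fun i j => (S.memLp_term hX t₀ t i).integrable_mul (S'.memLp_term hX t₀ t j)
  unfold integral
  have e : ∀ p : ℝ × Ω, S.eval p.1.toNNReal p.2 * S'.eval p.1.toNNReal p.2 =
      ∑ i ∈ Finset.range S.n, ∑ j ∈ Finset.range S'.n,
        (Set.Ioc (S.time i : ℝ) (S.time (i + 1)) ∩
          Set.Ioc (S'.time j : ℝ) (S'.time (j + 1))).indicator 1 p.1 *
          (S.coef i p.2 * S'.coef j p.2) := by
    intro p
    simp only [eval_toNNReal, Finset.sum_mul_sum]
    refine Finset.sum_congr rfl fun i _ => Finset.sum_congr rfl fun j _ => ?_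
    rw [Set.inter_indicator_one, Pi.mul_apply]
    simp only [← Pi.one_def]
    ring
  have hint' : ∀ i j, Integrable (fun p : ℝ × Ω => (Set.Ioc (S.time i : ℝ) (S.time (i + 1)) ∩
          Set.Ioc (S'.time j : ℝ) (S'.time (j + 1))).indicator 1 p.1 *
          (S.coef i p.2 * S'.coef j p.2)) ((volume.restrict (Set.Ioc (t₀ : ℝ) t)).prod P) := by
    intro i j
    refine Integrable.mul_prod (f := (Set.Ioc (S.time i : ℝ) (S.time (i + 1)) ∩
          Set.Ioc (S'.time j : ℝ) (S'.time (j + 1))).indicator (1 : ℝ → ℝ))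
          (g := fun ω => S.coef i ω * S'.coef j ω) ?_ ?_
    · exact (integrable_const (1 : ℝ)).indicator (measurableSet_Ioc.inter measurableSet_Ioc)
    · refine Integrable.of_bound ((S.measurable_coef i).mul
        (S'.measurable_coef j)).aestronglyMeasurable (C * C') (ae_of_all _ fun ω => ?_)
      rw [Real.norm_eq_abs, abs_mul]
      exact mul_le_mul (hC i ω) (hC' j ω) (abs_nonneg _) ((abs_nonneg _).trans (hC i ω))
  simp only [e, Finset.sum_mul_sum]
  rw [integral_finsetSum _ fun i _ => integrable_finsetSum _ fun j _ => hint i j,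
    integral_finsetSum _ fun i _ => integrable_finsetSum _ fun j _ => hint' i j, Finset.mul_sum]
  refine Finset.sum_congr rfl fun i _ => ?_
  rw [integral_finsetSum _ fun j _ => hint i j, integral_finsetSum _ fun j _ => hint' i j,
    Finset.mul_sum]
  refine Finset.sum_congr rfl fun j _ => ?_
  rw [hX.integral_mul_elementary (S.clamp_mono t₀ t i) (S'.clamp_mono t₀ t j)
    (S.measurable_coef i) (S'.measurable_coef j) (S.adapted_term t₀ t i)
    (S'.adapted_term t₀ t j) (hC i) (hC' j)]
  have h2 := integral_prod_mul (μ := volume.restrict (Set.Ioc (t₀ : ℝ) t)) (ν := P)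
    ((Set.Ioc (S.time i : ℝ) (S.time (i + 1)) ∩
          Set.Ioc (S'.time j : ℝ) (S'.time (j + 1))).indicator (1 : ℝ → ℝ))
    (fun ω => S.coef i ω * S'.coef j ω)
  rw [h2, integral_indicator_one (measurableSet_Ioc.inter measurableSet_Ioc), Set.Ioc_inter_Ioc,
    measureReal_restrict_apply measurableSet_Ioc, Set.Ioc_inter_Ioc, Real.volume_real_Ioc]
  push_cast
  rw [max_zero_clamp_sub_clamp ht', min_comm (min _ _) (t : ℝ), max_comm (max _ _) (t₀ : ℝ)]
  ring

/-- The Itô isometry for the difference of two simple integrands. -/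
lemma eLpNorm_integral_sub (S S' : SimpleIntegrand 𝓕) (hX : IsScaledBM 𝓕 P X c) {t₀ t : ℝ≥0}
    (ht : t₀ ≤ t) :
    eLpNorm (fun ω => S.integral X t₀ t ω - S'.integral X t₀ t ω) 2 P =
      ENNReal.ofReal √c * eLpNorm (fun p : ℝ × Ω => S.eval p.1.toNNReal p.2 -
        S'.eval p.1.toNNReal p.2) 2 ((volume.restrict (Set.Ioc (t₀ : ℝ) t)).prod P) := by
  set μ := (volume.restrict (Set.Ioc (t₀ : ℝ) t)).prod P
  have h1 := S.memLp_integral hX t₀ t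
  have h2 := S'.memLp_integral hX t₀ t
  have h3 := S.memLp_eval μ 2
  have h4 := S'.memLp_eval μ 2
  have e1 := eLpNorm_two_eq_sqrt (h1.sub h2)
  have e2 := eLpNorm_two_eq_sqrt (h3.sub h4)
  simp only [Pi.sub_def] at e1 e2
  rw [e1, e2,
    ← ENNReal.ofReal_mul (by positivity), ← Real.sqrt_mul (by positivity)]
  congr 2
  rw [integral_sub_sq_eq h1 h2, integral_sub_sq_eq h3 h4, S.integral_mul_integral S hX ht,
    S.integral_mul_integral S' hX ht, S'.integral_mul_integral S' hX ht]
  ring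

end SimpleIntegrand

/-! ### Uniqueness of Itô integrals -/

lemma eLpNorm_fun_sub_le_add_add {α : Type*} {m : MeasurableSpace α} {μ : Measure α} {p : ℝ≥0∞}
    {f g h k : α → ℝ} (hf : AEStronglyMeasurable f μ) (hg : AEStronglyMeasurable g μ)
    (hh : AEStronglyMeasurable h μ) (hk : AEStronglyMeasurable k μ) (hp : 1 ≤ p) :
    eLpNorm (fun x => f x - k x) p μ ≤ eLpNorm (fun x => f x - g x) p μ +
      eLpNorm (fun x => g x - h x) p μ + eLpNorm (fun x => h x - k x) p μ := by
  have e : (fun x => f x - k x) =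
      (fun x => f x - g x) + (fun x => g x - h x) + (fun x => h x - k x) := by
    ext x; simp
  rw [e]
  exact (eLpNorm_add_le ((hf.sub hg).add (hg.sub hh)) (hh.sub hk) hp).trans
    (add_le_add (eLpNorm_add_le (hf.sub hg) (hg.sub hh) hp) le_rfl)

namespace IsItoIntegral

variable {𝓕 : Filtration ℝ≥0 mΩ} {P : Measure Ω} [IsProbabilityMeasure P] {X : ℝ≥0 → Ω → ℝ}
  {c : ℝ≥0} {H H' : ℝ≥0 → Ω → ℝ} {t₀ T : ℝ≥0} {J J' : ℝ≥0 → Ω → ℝ}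

omit [IsProbabilityMeasure P] in
lemma measurable (h : IsItoIntegral 𝓕 P X H t₀ T J) {t : ℝ≥0} (ht : t ∈ Set.Icc t₀ T) :
    Measurable (J t) :=
  (h.adapted t ht).mono (𝓕.le t) le_rfl

/-- The Itô isometry, as an inequality for the difference of two stochastic integrals. -/
lemma eLpNorm_sub_le (hX : IsScaledBM 𝓕 P X c) (h : IsItoIntegral 𝓕 P X H t₀ T J)
    (h' : IsItoIntegral 𝓕 P X H' t₀ T J') {t : ℝ≥0} (ht : t ∈ Set.Icc t₀ T) :
    eLpNorm (fun ω => J t ω - J' t ω) 2 P ≤ ENNReal.ofReal √c *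
      eLpNorm (fun p : ℝ × Ω => H p.1.toNNReal p.2 - H' p.1.toNNReal p.2) 2
        ((volume.restrict (Set.Ioc (t₀ : ℝ) T)).prod P) := by
  obtain ⟨S, hS, hSJ⟩ := h.approx
  obtain ⟨S', hS', hSJ'⟩ := h'.approx
  set μ := (volume.restrict (Set.Ioc (t₀ : ℝ) T)).prod P with hμ
  set μt := (volume.restrict (Set.Ioc (t₀ : ℝ) t)).prod P with hμt
  have hle : μt ≤ μ := Measure.prod_mono
    (Measure.restrict_mono (Set.Ioc_subset_Ioc_right (NNReal.coe_le_coe.2 ht.2)) le_rfl) le_rfl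
  have hJm := (h.measurable ht).aestronglyMeasurable (μ := P)
  have hJm' := (h'.measurable ht).aestronglyMeasurable (μ := P)
  have hSm : ∀ (R : SimpleIntegrand 𝓕), AEStronglyMeasurable (R.integral X t₀ t) P := fun R =>
    (R.memLp_integral hX t₀ t).1
  have hEm : ∀ (R : SimpleIntegrand 𝓕),
      AEStronglyMeasurable (fun p : ℝ × Ω => R.eval p.1.toNNReal p.2) μ := fun R =>
    R.measurable_eval.aestronglyMeasurable
  have bound : ∀ n, eLpNorm (fun ω => J t ω - J' t ω) 2 P ≤
      eLpNorm (fun ω => (S n).integral X t₀ t ω - J t ω) 2 P +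
      ENNReal.ofReal √c * (eLpNorm (fun p : ℝ × Ω =>
        (S n).eval p.1.toNNReal p.2 - H p.1.toNNReal p.2) 2 μ +
        eLpNorm (fun p : ℝ × Ω => H p.1.toNNReal p.2 - H' p.1.toNNReal p.2) 2 μ +
        eLpNorm (fun p : ℝ × Ω => (S' n).eval p.1.toNNReal p.2 - H' p.1.toNNReal p.2) 2 μ) +
      eLpNorm (fun ω => (S' n).integral X t₀ t ω - J' t ω) 2 P := by
    intro n
    refine (eLpNorm_fun_sub_le_add_add hJm (hSm (S n)) (hSm (S' n)) hJm' one_le_two).trans ?_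
    refine add_le_add (add_le_add (eLpNorm_sub_comm (J t) ((S n).integral X t₀ t) 2 P).le ?_) le_rfl
    rw [(S n).eLpNorm_integral_sub (S' n) hX ht.1]
    refine mul_le_mul_right ((eLpNorm_mono_measure _ hle).trans ?_) _
    refine (eLpNorm_fun_sub_le_add_add (hEm (S n)) h.meas h'.meas (hEm (S' n)) one_le_two).trans ?_
    exact add_le_add le_rfl (eLpNorm_sub_comm (fun p : ℝ × Ω => H' p.1.toNNReal p.2)
          (fun p : ℝ × Ω => (S' n).eval p.1.toNNReal p.2) 2 μ).le
  refine ge_of_tendsto' (x := atTop) ?_ bound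
  have hc : ENNReal.ofReal √c ≠ ∞ := ENNReal.ofReal_ne_top
  have h3 := ((hSJ t ht).add (ENNReal.Tendsto.const_mul ((hS.add (tendsto_const_nhds
    (x := eLpNorm (fun p : ℝ × Ω => H p.1.toNNReal p.2 - H' p.1.toNNReal p.2) 2 μ))).add hS')
    (.inr hc))).add (hSJ' t ht)
  simpa using h3

end IsItoIntegral

/-- Two processes with continuous paths that are modifications of each other are
indistinguishable. -/
lemma ae_forall_eq_of_forall_ae_eq {P : Measure Ω} {t₀ T : ℝ≥0} {J J' : ℝ≥0 → Ω → ℝ}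
    (hJ : ∀ᵐ ω ∂P, ContinuousOn (fun t => J t ω) (Set.Icc t₀ T))
    (hJ' : ∀ᵐ ω ∂P, ContinuousOn (fun t => J' t ω) (Set.Icc t₀ T))
    (h : ∀ t ∈ Set.Icc t₀ T, J t =ᵐ[P] J' t) :
    ∀ᵐ ω ∂P, ∀ t ∈ Set.Icc t₀ T, J t ω = J' t ω := by
  obtain ⟨s, hs, hd⟩ := TopologicalSpace.exists_countable_dense (Set.Icc t₀ T)
  have h1 : ∀ᵐ ω ∂P, ∀ t ∈ s, J t ω = J' t ω := (ae_ball_iff hs).2 fun t _ => h t t.2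
  filter_upwards [h1, hJ, hJ'] with ω h1 h2 h3 t ht
  have := (continuousOn_iff_continuous_domRestrict.1 h2).ext_on hd
    (continuousOn_iff_continuous_domRestrict.1 h3) h1
  exact congrFun this ⟨t, ht⟩

/-- The isometry determines the integral at each time almost surely, and the continuity of the paths
yields all times at once. -/
lemma IsItoIntegral.ae_eq {𝓕 : Filtration ℝ≥0 mΩ} {P : Measure Ω} [IsProbabilityMeasure P]
    {X : ℝ≥0 → Ω → ℝ} {c : ℝ≥0} {H : ℝ≥0 → Ω → ℝ} {t₀ T : ℝ≥0} {J J' : ℝ≥0 → Ω → ℝ}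
    (hX : IsScaledBM 𝓕 P X c) (h : IsItoIntegral 𝓕 P X H t₀ T J)
    (h' : IsItoIntegral 𝓕 P X H t₀ T J') :
    ∀ᵐ ω ∂P, ∀ t ∈ Set.Icc t₀ T, J t ω = J' t ω := by
  refine ae_forall_eq_of_forall_ae_eq (ae_of_all _ h.cont) (ae_of_all _ h'.cont) fun t ht => ?_
  have h1 := h.eLpNorm_sub_le hX h' ht
  simp only [sub_self, eLpNorm_zero', mul_zero, nonpos_iff_eq_zero] at h1
  have h2 := (eLpNorm_eq_zero_iff ((h.measurable ht).sub (h'.measurable ht)).aestronglyMeasurable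
    two_ne_zero).1 h1
  filter_upwards [h2] with ω hω
  exact sub_eq_zero.1 hω

/-! ### Itô integrals as limits of sums over equidistant grids -/

/-- The `i`-th point of the grid that cuts `[t₀, T]` into `n + 1` intervals of equal length. -/
def grid (t₀ T : ℝ≥0) (n i : ℕ) : ℝ≥0 := t₀ + (T - t₀) * (i / (n + 1))

lemma grid_mono (t₀ T : ℝ≥0) (n : ℕ) : Monotone (grid t₀ T n) := fun i j h => by
  unfold grid
  gcongr

lemma le_grid (t₀ T : ℝ≥0) (n i : ℕ) : t₀ ≤ grid t₀ T n i := le_self_add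

@[simp] lemma grid_zero (t₀ T : ℝ≥0) (n : ℕ) : grid t₀ T n 0 = t₀ := by simp [grid]

lemma grid_last {t₀ T : ℝ≥0} (h : t₀ ≤ T) (n : ℕ) : grid t₀ T n (n + 1) = T := by
  simp [grid, add_tsub_cancel_of_le h]

lemma grid_le {t₀ T : ℝ≥0} (h : t₀ ≤ T) {n i : ℕ} (hi : i ≤ n + 1) : grid t₀ T n i ≤ T :=
  (grid_mono t₀ T n hi).trans (grid_last h n).le

lemma coe_grid {t₀ T : ℝ≥0} (h : t₀ ≤ T) (n i : ℕ) :
    (grid t₀ T n i : ℝ) = t₀ + (T - t₀) * (i / (n + 1)) := by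
  simp [grid, NNReal.coe_sub h]

lemma coe_grid_succ_sub {t₀ T : ℝ≥0} (h : t₀ ≤ T) (n i : ℕ) :
    (grid t₀ T n (i + 1) : ℝ) - grid t₀ T n i = (T - t₀) / (n + 1) := by
  rw [coe_grid h, coe_grid h]
  push_cast
  field_simp
  ring

lemma exists_grid_lt_le {t₀ T : ℝ≥0} (h : t₀ ≤ T) (n : ℕ) {s : ℝ≥0} (hs : s ∈ Set.Ioc t₀ T) :
    ∃ i ∈ Finset.range (n + 1), s ∈ Set.Ioc (grid t₀ T n i) (grid t₀ T n (i + 1)) := by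
  classical
  have hex : ∃ k, s ≤ grid t₀ T n k := ⟨n + 1, by rw [grid_last h]; exact hs.2⟩
  have hpos : Nat.find hex ≠ 0 := by
    intro h0
    have := Nat.find_spec hex
    rw [h0, grid_zero] at this
    exact absurd hs.1 (not_lt.2 this)
  obtain ⟨i, hi⟩ := Nat.exists_eq_succ_of_ne_zero hpos
  refine ⟨i, ?_, ?_, ?_⟩
  · have := Nat.find_min' hex (m := n + 1) (by rw [grid_last h]; exact hs.2)
    rw [Finset.mem_range]; omega
  · have := Nat.find_min hex (m := i) (by omega)
    exact not_le.1 this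
  · have := Nat.find_spec hex
    rwa [hi] at this

/-- The simple integrand that freezes the adapted bounded process `H` at the grid points. -/
def gridIntegrand {𝓕 : Filtration ℝ≥0 mΩ} {H : ℝ≥0 → Ω → ℝ} {t₀ T : ℝ≥0} (h : t₀ ≤ T)
    (hH : ∀ t ∈ Set.Icc t₀ T, Measurable[𝓕 t] (H t)) {C : ℝ}
    (hC : ∀ t ∈ Set.Icc t₀ T, ∀ ω, |H t ω| ≤ C) (n : ℕ) : SimpleIntegrand 𝓕 where
  n := n + 1
  time := grid t₀ T n
  mono := grid_mono t₀ T n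
  coef i := H (min (grid t₀ T n i) T)
  meas _ := (hH _ ⟨le_min (le_grid _ _ _ _) h, min_le_right _ _⟩).mono
    (𝓕.mono (min_le_left _ _)) le_rfl
  bdd := ⟨C, fun _ ω => hC _ ⟨le_min (le_grid _ _ _ _) h, min_le_right _ _⟩ ω⟩

section Grid

variable {𝓕 : Filtration ℝ≥0 mΩ} {H : ℝ≥0 → Ω → ℝ} {t₀ T : ℝ≥0} (h : t₀ ≤ T)
  (hH : ∀ t ∈ Set.Icc t₀ T, Measurable[𝓕 t] (H t)) {C : ℝ}
  (hC : ∀ t ∈ Set.Icc t₀ T, ∀ ω, |H t ω| ≤ C)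

lemma gridIntegrand_eval (n : ℕ) {i : ℕ} (hi : i ∈ Finset.range (n + 1)) {s : ℝ≥0}
    (hs : s ∈ Set.Ioc (grid t₀ T n i) (grid t₀ T n (i + 1))) (ω : Ω) :
    (gridIntegrand h hH hC n).eval s ω = H (grid t₀ T n i) ω := by
  rw [SimpleIntegrand.eval]
  simp only [gridIntegrand]
  rw [Finset.sum_eq_single_of_mem i hi]
  · rw [Set.indicator_of_mem hs, min_eq_left (grid_le h (Finset.mem_range.1 hi).le)]
  · intro j _ hji
    refine Set.indicator_of_notMem (fun hj => ?_) _
    rcases lt_or_gt_of_ne hji with hlt | hlt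
    · exact absurd (hs.1.trans_le hj.2) (not_lt.2 (grid_mono _ _ _ (Nat.succ_le_of_lt hlt)))
    · exact absurd (hj.1.trans_le hs.2) (not_lt.2 (grid_mono _ _ _ (Nat.succ_le_of_lt hlt)))

lemma tendsto_mesh (t₀ T : ℝ≥0) : Tendsto (fun n : ℕ => ((T : ℝ) - t₀) / (n + 1)) atTop (𝓝 0) := by
  have := (tendsto_const_div_atTop_nhds_zero_nat ((T : ℝ) - t₀)).comp (tendsto_add_atTop_nat 1)
  refine this.congr fun n => ?_
  simp

/-- The left ends of the grid intervals that contain `s` converge to `s`. -/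
lemma tendsto_gridIntegrand_eval {ω : Ω} (hc : ContinuousOn (fun t => H t ω) (Set.Icc t₀ T))
    {s : ℝ≥0} (hs : s ∈ Set.Ioc t₀ T) :
    Tendsto (fun n => (gridIntegrand h hH hC n).eval s ω) atTop (𝓝 (H s ω)) := by
  choose i hi his using fun n => exists_grid_lt_le h n hs
  have e : (fun n => (gridIntegrand h hH hC n).eval s ω) = fun n => H (grid t₀ T n (i n)) ω := by
    ext n; exact gridIntegrand_eval h hH hC n (hi n) (his n) ω
  rw [e]
  have hs' : s ∈ Set.Icc t₀ T := ⟨hs.1.le, hs.2⟩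
  refine (hc s hs').tendsto.comp (tendsto_nhdsWithin_iff.2 ⟨?_, Eventually.of_forall fun n =>
    ⟨le_grid _ _ _ _, grid_le h (Finset.mem_range.1 (hi n)).le⟩⟩)
  rw [tendsto_iff_dist_tendsto_zero]
  refine squeeze_zero (fun _ => dist_nonneg) (fun n => ?_) (tendsto_mesh t₀ T)
  rw [NNReal.dist_eq, abs_sub_comm, abs_of_nonneg (sub_nonneg.2 (NNReal.coe_le_coe.2 (his n).1.le)),
    ← coe_grid_succ_sub h n (i n)]
  have : (s : ℝ) ≤ grid t₀ T n (i n + 1) := (his n).2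
  linarith

end Grid

/-- Bounded convergence in `L²`. -/
lemma tendsto_eLpNorm_two_of_bounded {α : Type*} {m : MeasurableSpace α} {μ : Measure α}
    [IsFiniteMeasure μ] {f : ℕ → α → ℝ} (hf : ∀ n, AEStronglyMeasurable (f n) μ) {C : ℝ}
    (hC : ∀ n, ∀ᵐ x ∂μ, |f n x| ≤ C) (hlim : ∀ᵐ x ∂μ, Tendsto (fun n => f n x) atTop (𝓝 0)) :
    Tendsto (fun n => eLpNorm (f n) 2 μ) atTop (𝓝 0) := by
  have hmem : ∀ n, MemLp (f n) 2 μ := fun n => MemLp.of_bound (hf n) C (hC n)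
  simp only [fun n => eLpNorm_two_eq_sqrt (hmem n)]
  have h1 : Tendsto (fun n => ∫ x, f n x ^ 2 ∂μ) atTop (𝓝 (∫ _, (0 : ℝ) ∂μ)) := by
    refine tendsto_integral_of_dominated_convergence (fun _ => C ^ 2)
      (fun n => (hf n).pow 2) (integrable_const _) (fun n => ?_) ?_
    · filter_upwards [hC n] with x hx
      rw [Real.norm_eq_abs, abs_pow]
      exact pow_le_pow_left₀ (abs_nonneg _) hx 2
    · filter_upwards [hlim] with x hx
      simpa using hx.pow 2
  simp only [integral_zero] at h1
  have h2 := (ENNReal.continuous_ofReal.tendsto _).comp ((Real.continuous_sqrt.tendsto _).comp h1)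
  simpa [Function.comp_def] using h2

/-- A process `J` is the Itô integral of the bounded continuous adapted process `H` as soon as the
sums over equidistant grids converge to it in probability: by the isometry, these sums form a
Cauchy sequence in `L²`. -/
lemma isItoIntegral_of_tendstoInMeasure {𝓕 : Filtration ℝ≥0 mΩ} {P : Measure Ω}
    [IsProbabilityMeasure P] {X : ℝ≥0 → Ω → ℝ} {c : ℝ≥0} (hX : IsScaledBM 𝓕 P X c)
    {H J : ℝ≥0 → Ω → ℝ} {t₀ T : ℝ≥0} (h : t₀ ≤ T)
    (hH : ∀ t ∈ Set.Icc t₀ T, Measurable[𝓕 t] (H t)) {C : ℝ}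
    (hC : ∀ t ∈ Set.Icc t₀ T, ∀ ω, |H t ω| ≤ C)
    (hHc : ∀ ω, ContinuousOn (fun t => H t ω) (Set.Icc t₀ T))
    (hJ : ∀ t ∈ Set.Icc t₀ T, Measurable[𝓕 t] (J t))
    (hJc : ∀ ω, ContinuousOn (fun t => J t ω) (Set.Icc t₀ T))
    (hlim : ∀ t ∈ Set.Icc t₀ T,
      TendstoInMeasure P (fun n => (gridIntegrand h hH hC n).integral X t₀ t) atTop (J t)) :
    IsItoIntegral 𝓕 P X H t₀ T J := by
  set μ := (volume.restrict (Set.Ioc (t₀ : ℝ) T)).prod P with hμ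
  set S := gridIntegrand h hH hC with hS
  have hae : ∀ᵐ p ∂μ, p.1 ∈ Set.Ioc (t₀ : ℝ) T := by
    have : ∀ᵐ s ∂(volume.restrict (Set.Ioc (t₀ : ℝ) T)), s ∈ Set.Ioc (t₀ : ℝ) T :=
      ae_restrict_mem measurableSet_Ioc
    exact Measure.quasiMeasurePreserving_fst.ae this
  have hmem : ∀ s : ℝ, s ∈ Set.Ioc (t₀ : ℝ) T → s.toNNReal ∈ Set.Ioc t₀ T := fun s hs =>
    ⟨Real.lt_toNNReal_iff_coe_lt.2 hs.1, Real.toNNReal_le_iff_le_coe.2 hs.2⟩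
  have hpt : ∀ᵐ p ∂μ, Tendsto (fun n => (S n).eval p.1.toNNReal p.2) atTop
      (𝓝 (H p.1.toNNReal p.2)) := by
    filter_upwards [hae] with p hp
    exact tendsto_gridIntegrand_eval h hH hC (hHc p.2) (hmem _ hp)
  have hEm : ∀ n, AEStronglyMeasurable (fun p : ℝ × Ω => (S n).eval p.1.toNNReal p.2) μ :=
    fun n => (S n).measurable_eval.aestronglyMeasurable
  have hHm : AEStronglyMeasurable (fun p : ℝ × Ω => H p.1.toNNReal p.2) μ :=
    aestronglyMeasurable_of_tendsto_ae atTop hEm hpt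
  have hSH : Tendsto (fun n => eLpNorm (fun p : ℝ × Ω =>
      (S n).eval p.1.toNNReal p.2 - H p.1.toNNReal p.2) 2 μ) atTop (𝓝 0) := by
    refine tendsto_eLpNorm_two_of_bounded (fun n => (hEm n).sub hHm) (C := C + C) (fun n => ?_) ?_
    · filter_upwards [hae] with p hp
      obtain ⟨i, hi, his⟩ := exists_grid_lt_le h n (hmem _ hp)
      rw [hS, gridIntegrand_eval h hH hC n hi his]
      refine (abs_sub _ _).trans (add_le_add (hC _ ⟨le_grid _ _ _ _,
        grid_le h (Finset.mem_range.1 hi).le⟩ _) (hC _ ⟨(hmem _ hp).1.le, (hmem _ hp).2⟩ _))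
    · filter_upwards [hpt] with p hp
      simpa using hp.sub_const (H p.1.toNNReal p.2)
  refine ⟨hJ, hJc, hHm, S, hSH, fun t ht => ?_⟩
  obtain ⟨ns, hns, hlim'⟩ := (hlim t ht).exists_seq_tendsto_ae
  have hle : (volume.restrict (Set.Ioc (t₀ : ℝ) t)).prod P ≤ μ := Measure.prod_mono
    (Measure.restrict_mono (Set.Ioc_subset_Ioc_right (NNReal.coe_le_coe.2 ht.2)) le_rfl) le_rfl
  have bound : ∀ n, eLpNorm (fun ω => (S n).integral X t₀ t ω - J t ω) 2 P ≤
      ENNReal.ofReal √c * eLpNorm (fun p : ℝ × Ω =>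
      (S n).eval p.1.toNNReal p.2 - H p.1.toNNReal p.2) 2 μ := by
    intro n
    have h1 := Lp.eLpNorm_lim_le_liminf_eLpNorm (p := 2) (μ := P)
      (f := fun m ω => (S n).integral X t₀ t ω - (S (ns m)).integral X t₀ t ω)
      (fun m => ((S n).memLp_integral hX t₀ t).1.sub ((S (ns m)).memLp_integral hX t₀ t).1)
      (fun ω => (S n).integral X t₀ t ω - J t ω) (by
        filter_upwards [hlim'] with ω hω
        exact tendsto_const_nhds.sub hω)
    refine h1.trans ?_
    have h2 : Tendsto (fun m => ENNReal.ofReal √c * (eLpNorm (fun p : ℝ × Ω =>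
        (S n).eval p.1.toNNReal p.2 - H p.1.toNNReal p.2) 2 μ + eLpNorm (fun p : ℝ × Ω =>
        (S (ns m)).eval p.1.toNNReal p.2 - H p.1.toNNReal p.2) 2 μ)) atTop
        (𝓝 (ENNReal.ofReal √c * (eLpNorm (fun p : ℝ × Ω =>
        (S n).eval p.1.toNNReal p.2 - H p.1.toNNReal p.2) 2 μ + 0))) :=
      ENNReal.Tendsto.const_mul (tendsto_const_nhds.add (hSH.comp hns.tendsto_atTop))
        (.inr ENNReal.ofReal_ne_top)
    rw [add_zero] at h2
    rw [← h2.liminf_eq]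
    refine liminf_le_liminf (Eventually.of_forall fun m => ?_)
    rw [(S n).eLpNorm_integral_sub (S (ns m)) hX ht.1]
    refine mul_le_mul_right ((eLpNorm_mono_measure _ hle).trans ?_) _
    have e2 : (fun p : ℝ × Ω => (S n).eval p.1.toNNReal p.2 - (S (ns m)).eval p.1.toNNReal p.2) =
        (fun p => (S n).eval p.1.toNNReal p.2 - H p.1.toNNReal p.2) -
        (fun p => (S (ns m)).eval p.1.toNNReal p.2 - H p.1.toNNReal p.2) := by
      ext ω; simp
    rw [e2]
    exact eLpNorm_sub_le ((hEm _).sub hHm) ((hEm _).sub hHm) one_le_two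
  refine tendsto_of_tendsto_of_tendsto_of_le_of_le tendsto_const_nhds ?_ (fun _ => zero_le) bound
  simpa using ENNReal.Tendsto.const_mul (a := ENNReal.ofReal √c) hSH (.inr ENNReal.ofReal_ne_top)

/-- The grid that cuts `[t₀, T]` into `n + 1` intervals of equal length, stopped at `t`. -/
def stoppedGrid (t₀ T t : ℝ≥0) (n i : ℕ) : ℝ≥0 := max t₀ (min (grid t₀ T n i) t)

section StoppedGrid

variable {t₀ T t : ℝ≥0}

lemma stoppedGrid_mono (n : ℕ) : Monotone (stoppedGrid t₀ T t n) := fun _ _ h =>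
  max_le_max le_rfl (min_le_min (grid_mono _ _ _ h) le_rfl)

lemma le_stoppedGrid (n i : ℕ) : t₀ ≤ stoppedGrid t₀ T t n i := le_max_left _ _

lemma stoppedGrid_le (ht : t ∈ Set.Icc t₀ T) (n i : ℕ) : stoppedGrid t₀ T t n i ≤ t :=
  max_le ht.1 (min_le_right _ _)

lemma stoppedGrid_eq_min (ht : t ∈ Set.Icc t₀ T) (n i : ℕ) :
    stoppedGrid t₀ T t n i = min (grid t₀ T n i) t :=
  max_eq_right (le_min (le_grid _ _ _ _) ht.1)

lemma stoppedGrid_zero (ht : t ∈ Set.Icc t₀ T) (n : ℕ) : stoppedGrid t₀ T t n 0 = t₀ := by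
  rw [stoppedGrid_eq_min ht, grid_zero, min_eq_left ht.1]

lemma stoppedGrid_last (ht : t ∈ Set.Icc t₀ T) (n : ℕ) : stoppedGrid t₀ T t n (n + 1) = t := by
  rw [stoppedGrid_eq_min ht, grid_last (ht.1.trans ht.2), min_eq_right ht.2]

lemma stoppedGrid_succ_sub_le (ht : t ∈ Set.Icc t₀ T) (n i : ℕ) :
    (stoppedGrid t₀ T t n (i + 1) : ℝ) - stoppedGrid t₀ T t n i ≤ (T - t₀) / (n + 1) := by
  rw [← coe_grid_succ_sub (ht.1.trans ht.2) n i, stoppedGrid_eq_min ht, stoppedGrid_eq_min ht]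
  have h : (grid t₀ T n i : ℝ) ≤ grid t₀ T n (i + 1) := grid_mono _ _ _ (Nat.le_succ i)
  push_cast
  simp only [min_def]
  split_ifs <;> linarith

lemma sum_stoppedGrid_sub (ht : t ∈ Set.Icc t₀ T) (n : ℕ) (x : ℝ≥0 → ℝ) :
    ∑ i ∈ Finset.range (n + 1), (x (stoppedGrid t₀ T t n (i + 1)) - x (stoppedGrid t₀ T t n i)) =
      x t - x t₀ := by
  rw [Finset.sum_range_sub (fun i => x (stoppedGrid t₀ T t n i)), stoppedGrid_last ht,
    stoppedGrid_zero ht]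

/-- Errors that are uniformly small relative to the length of the interval do not add up. -/
lemma tendsto_sum_stoppedGrid_zero (ht : t ∈ Set.Icc t₀ T) {E : ℝ≥0 → ℝ≥0 → ℝ}
    (hE : ∀ ε > 0, ∃ δ > 0, ∀ s r : ℝ≥0, t₀ ≤ s → s ≤ r → r ≤ t → (r : ℝ) - s < δ →
      |E s r| ≤ ε * (r - s)) :
    Tendsto (fun n => ∑ i ∈ Finset.range (n + 1),
      E (stoppedGrid t₀ T t n i) (stoppedGrid t₀ T t n (i + 1))) atTop (𝓝 0) := by
  rw [Metric.tendsto_atTop]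
  intro ε hε
  have htt : (0 : ℝ) ≤ t - t₀ := sub_nonneg.2 (NNReal.coe_le_coe.2 ht.1)
  obtain ⟨δ, hδ, hE⟩ := hE (ε / (t - t₀ + 1)) (by positivity)
  obtain ⟨N, hN⟩ := (Metric.tendsto_atTop.1 (tendsto_mesh t₀ T)) δ hδ
  refine ⟨N, fun n hn => ?_⟩
  have h1 := hN n hn
  rw [Real.dist_eq, sub_zero] at h1
  rw [Real.dist_eq, sub_zero]
  have h2 := sum_stoppedGrid_sub ht n (fun s => (s : ℝ))
  calc _ ≤ ∑ i ∈ Finset.range (n + 1),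
        |E (stoppedGrid t₀ T t n i) (stoppedGrid t₀ T t n (i + 1))| :=
        Finset.abs_sum_le_sum_abs _ _
    _ ≤ ∑ i ∈ Finset.range (n + 1), ε / (t - t₀ + 1) *
        ((stoppedGrid t₀ T t n (i + 1) : ℝ) - stoppedGrid t₀ T t n i) :=
        Finset.sum_le_sum fun i _ => hE _ _ (le_stoppedGrid _ _)
          (stoppedGrid_mono _ (Nat.le_succ i)) (stoppedGrid_le ht _ _)
          ((stoppedGrid_succ_sub_le ht n i).trans_lt ((le_abs_self _).trans_lt h1))
    _ = ε / (t - t₀ + 1) * (t - t₀) := by rw [← Finset.mul_sum, h2]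
    _ < ε := by
        rw [div_mul_eq_mul_div, div_lt_iff₀ (by positivity)]
        nlinarith

lemma gridIntegrand_integral {𝓕 : Filtration ℝ≥0 mΩ} {H : ℝ≥0 → Ω → ℝ} (h : t₀ ≤ T)
    (hH : ∀ t ∈ Set.Icc t₀ T, Measurable[𝓕 t] (H t)) {C : ℝ}
    (hC : ∀ t ∈ Set.Icc t₀ T, ∀ ω, |H t ω| ≤ C) (X : ℝ≥0 → Ω → ℝ) (ht : t ∈ Set.Icc t₀ T) (n : ℕ)
    (ω : Ω) :
    (gridIntegrand h hH hC n).integral X t₀ t ω = ∑ i ∈ Finset.range (n + 1),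
      H (stoppedGrid t₀ T t n i) ω *
        (X (stoppedGrid t₀ T t n (i + 1)) ω - X (stoppedGrid t₀ T t n i) ω) := by
  refine Finset.sum_congr rfl fun i _ => ?_
  change H (min (grid t₀ T n i) T) ω * (X (stoppedGrid t₀ T t n (i + 1)) ω -
    X (stoppedGrid t₀ T t n i) ω) = _
  rcases le_total (grid t₀ T n i) t with hi | hi
  · rw [stoppedGrid_eq_min ht n i, min_eq_left hi, min_eq_left (hi.trans ht.2)]
  · rw [stoppedGrid_eq_min ht n i, stoppedGrid_eq_min ht n (i + 1), min_eq_right hi,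
      min_eq_right (hi.trans (grid_mono _ _ _ (Nat.le_succ i)))]
    simp

end StoppedGrid

/-! ### Measurability of time integrals -/

/-- The time integral of a process with continuous paths is measurable with respect to every
`σ`-algebra that makes the process measurable up to the final time, as a limit of integrals of
step functions. Paths that are not continuous are ignored. -/
lemma exists_measurable_eq_integral {Ω : Type*} (m : MeasurableSpace Ω) {X : ℝ≥0 → Ω → ℝ}
    {t₀ t : ℝ≥0}
    (h : t₀ ≤ t) (hX : ∀ s ≤ t, Measurable[m] (X s)) :
    ∃ Y : Ω → ℝ, Measurable[m] Y ∧ ∀ ω, Continuous (fun s => X s ω) →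
      Y ω = ∫ s in (t₀ : ℝ)..t, X s.toNNReal ω := by
  have h' : (t₀ : ℝ) ≤ t := h
  -- the step functions evaluate `X` at the largest multiple of `1 / (n + 1)` below `s`, which does
  -- not exceed `t`; the limit superior is measurable whether or not the integrals converge
  let q : ℕ → ℝ → ℝ≥0 := fun n s => min ((⌊((n : ℝ) + 1) * s⌋₊ : ℝ≥0) / (n + 1)) t
  have hq : ∀ s ∈ Set.Ioc (t₀ : ℝ) t, Tendsto (fun n => q n s) atTop (𝓝 s.toNNReal) := by
    intro s hs
    have hs0 : 0 ≤ s := t₀.2.trans hs.1.le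
    rw [tendsto_iff_dist_tendsto_zero]
    refine squeeze_zero (fun _ => dist_nonneg) (fun n => ?_)
      tendsto_one_div_add_atTop_nhds_zero_nat
    have hn : (0 : ℝ) < n + 1 := by positivity
    have h1 : (⌊((n : ℝ) + 1) * s⌋₊ : ℝ) ≤ (n + 1) * s := Nat.floor_le (by positivity)
    have h2 : ((n : ℝ) + 1) * s < ⌊((n : ℝ) + 1) * s⌋₊ + 1 := Nat.lt_floor_add_one _
    have h3 : (⌊((n : ℝ) + 1) * s⌋₊ : ℝ) / (n + 1) ≤ s := by
      rw [div_le_iff₀ hn]; linarith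
    have h4 : s - 1 / (n + 1) ≤ (⌊((n : ℝ) + 1) * s⌋₊ : ℝ) / (n + 1) := by
      rw [le_div_iff₀ hn, sub_mul, div_mul_cancel₀ _ hn.ne']; linarith
    have h5 : ((q n s : ℝ≥0) : ℝ) = (⌊((n : ℝ) + 1) * s⌋₊ : ℝ) / (n + 1) := by
      simp only [q]
      push_cast
      exact min_eq_left (h3.trans hs.2)
    rw [NNReal.dist_eq, h5, Real.coe_toNNReal s hs0, abs_le]
    constructor
    · linarith
    · have : (0 : ℝ) ≤ 1 / (n + 1) := by positivity
      linarith
  have hfloor : ∀ n : ℕ, Measurable fun s : ℝ => ⌊((n : ℝ) + 1) * s⌋₊ := fun n =>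
    Nat.measurable_floor.comp (measurable_const_mul ((n : ℝ) + 1))
  have hqm : ∀ n, Measurable (fun p : ℝ × Ω => X (q n p.1) p.2) := by
    intro n
    have h1 : Measurable (fun p : ℕ × Ω => X (min ((p.1 : ℝ≥0) / (n + 1)) t) p.2) :=
      measurable_from_prod_countable_right fun k =>
        hX (min ((k : ℝ≥0) / (n + 1)) t) (min_le_right _ _)
    have h2 : Measurable (fun p : ℝ × Ω => (⌊((n : ℝ) + 1) * p.1⌋₊, p.2)) :=
      Measurable.prodMk ((hfloor n).comp measurable_fst) measurable_snd
    have h3 := h1.comp h2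
    simp only [Function.comp_def] at h3
    exact h3
  have hint : ∀ n, Measurable (fun ω => ∫ s in Set.Ioc (t₀ : ℝ) t, X (q n s) ω) := fun n =>
    ((hqm n).stronglyMeasurable.integral_prod_left'
      (μ := volume.restrict (Set.Ioc (t₀ : ℝ) t))).measurable
  refine ⟨fun ω => limsup (fun n => ∫ s in Set.Ioc (t₀ : ℝ) t, X (q n s) ω) atTop,
    Measurable.limsup hint, fun ω hω => ?_⟩
  refine Tendsto.limsup_eq ?_
  rw [intervalIntegral.integral_of_le h']
  obtain ⟨C, hC⟩ := (isCompact_Icc (a := (0 : ℝ≥0)) (b := t)).exists_bound_of_continuousOn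
    hω.continuousOn
  refine tendsto_integral_of_dominated_convergence (fun _ => C) (fun n => ?_)
    (integrable_const _) (fun n => ae_of_all _ fun s => hC _ ⟨zero_le, min_le_right _ _⟩) ?_
  · have : Measurable (fun s : ℝ => X (q n s) ω) := by
      have h0 : Measurable fun k : ℕ => X (min ((k : ℝ≥0) / (n + 1)) t) ω := measurable_from_nat
      have h1 := h0.comp (hfloor n)
      simp only [Function.comp_def] at h1
      exact h1
    exact this.aestronglyMeasurable
  · filter_upwards [ae_restrict_mem measurableSet_Ioc] with s hs
    exact (hω.tendsto _).comp (hq s hs)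

/-! ### Stochastic integrals of affine functions -/

/-- The integral `∫_{t₀}^{t} (α + β s) dX_s` along a continuous path, defined by integration by
parts. -/
def affineIntegral (X : ℝ≥0 → Ω → ℝ) (α β : ℝ) (t₀ t : ℝ≥0) (ω : Ω) : ℝ :=
  (α + β * t) * X t ω - (α + β * t₀) * X t₀ ω - β * ∫ s in (t₀ : ℝ)..t, X s.toNNReal ω

open Classical in
/-- The version of `∫_{t₀}^{t} (α + β s) dX_s` with continuous paths: it is set to zero where the
path of `X` is not continuous. -/
def affineVersion (X : ℝ≥0 → Ω → ℝ) (α β : ℝ) (t₀ t : ℝ≥0) (ω : Ω) : ℝ :=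
  if Continuous (fun s => X s ω) then affineIntegral X α β t₀ t ω else 0

section Affine

variable {𝓕 : Filtration ℝ≥0 mΩ} {P : Measure Ω} {X : ℝ≥0 → Ω → ℝ} {c : ℝ≥0} {α β : ℝ}
  {t₀ t T : ℝ≥0}

lemma continuous_path_toNNReal {ω : Ω} (h : Continuous fun s => X s ω) :
    Continuous fun s : ℝ => X s.toNNReal ω :=
  h.comp continuous_real_toNNReal

lemma continuous_affineIntegral {ω : Ω} (h : Continuous fun s => X s ω) :
    Continuous fun t => affineIntegral X α β t₀ t ω := by
  have h1 : Continuous fun t : ℝ≥0 => ∫ s in (t₀ : ℝ)..t, X s.toNNReal ω :=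
    (intervalIntegral.continuous_primitive
      (fun a b => (continuous_path_toNNReal h).intervalIntegrable a b) _).comp
      NNReal.continuous_coe
  unfold affineIntegral
  fun_prop

lemma affineIntegral_sub {ω : Ω} (h : Continuous fun s => X s ω) (s r : ℝ≥0) :
    affineIntegral X α β t₀ r ω - affineIntegral X α β t₀ s ω = affineIntegral X α β s r ω := by
  have h1 := intervalIntegral.integral_add_adjacent_intervals
    ((continuous_path_toNNReal h).intervalIntegrable t₀ s)
    ((continuous_path_toNNReal h).intervalIntegrable s r) (μ := volume)
  unfold affineIntegral
  rw [← h1]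
  ring

/-- The error that is made on one interval when the integrand is frozen at the left end. -/
lemma affineIntegral_sub_mul {ω : Ω} (h : Continuous fun s => X s ω) (s r : ℝ≥0) :
    affineIntegral X α β s r ω - (α + β * s) * (X r ω - X s ω) =
      β * ∫ u in (s : ℝ)..r, (X r ω - X u.toNNReal ω) := by
  rw [intervalIntegral.integral_sub intervalIntegrable_const
    ((continuous_path_toNNReal h).intervalIntegrable s r), intervalIntegral.integral_const]
  unfold affineIntegral
  rw [smul_eq_mul]
  ring

/-- Integration by parts is the limit of the elementary sums, path by path. -/
lemma tendsto_sum_affine {ω : Ω} (h : Continuous fun s => X s ω) (ht : t ∈ Set.Icc t₀ T) :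
    Tendsto (fun n => ∑ i ∈ Finset.range (n + 1), (α + β * (stoppedGrid t₀ T t n i : ℝ)) *
        (X (stoppedGrid t₀ T t n (i + 1)) ω - X (stoppedGrid t₀ T t n i) ω)) atTop
      (𝓝 (affineIntegral X α β t₀ t ω)) := by
  have huc := (isCompact_Icc (a := t₀) (b := t)).uniformContinuousOn_of_continuous
    h.continuousOn
  have h1 := tendsto_sum_stoppedGrid_zero ht (E := fun s r : ℝ≥0 =>
      affineIntegral X α β s r ω - (α + β * s) * (X r ω - X s ω)) (by
    intro ε hε
    obtain ⟨δ, hδ, hx⟩ := Metric.uniformContinuousOn_iff.1 huc (ε / (|β| + 1)) (by positivity)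
    refine ⟨δ, hδ, fun s r hs hsr hr hd => ?_⟩
    have hsr' : (s : ℝ) ≤ r := hsr
    rw [affineIntegral_sub_mul h, abs_mul]
    have h2 : |∫ u in (s : ℝ)..r, (X r ω - X u.toNNReal ω)| ≤ ε / (|β| + 1) * |(r : ℝ) - s| := by
      rw [← Real.norm_eq_abs]
      refine intervalIntegral.norm_integral_le_of_norm_le_const fun u hu => ?_
      rw [Set.uIoc_of_le hsr'] at hu
      have hu0 : (0 : ℝ) ≤ u := s.2.trans hu.1.le
      have hu1 : s ≤ u.toNNReal := by rw [← NNReal.coe_le_coe, Real.coe_toNNReal _ hu0]; exact hu.1.le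
      have hu2 : u.toNNReal ≤ r := Real.toNNReal_le_iff_le_coe.2 hu.2
      refine (hx r ⟨hs.trans hsr, hr⟩ _ ⟨hs.trans hu1, hu2.trans hr⟩ ?_).le
      rw [NNReal.dist_eq, Real.coe_toNNReal _ hu0, abs_of_nonneg (sub_nonneg.2 hu.2)]
      linarith [hu.1]
    rw [abs_of_nonneg (sub_nonneg.2 hsr')] at h2
    calc |β| * _ ≤ |β| * (ε / (|β| + 1) * (r - s)) := by gcongr
      _ = (|β| / (|β| + 1)) * (ε * (r - s)) := by ring
      _ ≤ 1 * (ε * (r - s)) := by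
          gcongr
          rw [div_le_one (by positivity)]; linarith
      _ = _ := one_mul _)
  have h3 : ∀ n, ∑ i ∈ Finset.range (n + 1), affineIntegral X α β (stoppedGrid t₀ T t n i)
      (stoppedGrid t₀ T t n (i + 1)) ω = affineIntegral X α β t₀ t ω := by
    intro n
    have h4 := sum_stoppedGrid_sub ht n (fun s => affineIntegral X α β t₀ s ω)
    simp only [affineIntegral_sub h] at h4
    exact h4
  simp only [Finset.sum_sub_distrib, h3] at h1
  have h5 := (tendsto_const_nhds (x := affineIntegral X α β t₀ t ω)).sub h1
  simpa using h5

variable [IsProbabilityMeasure P]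

omit [IsProbabilityMeasure P] in
lemma measurableSet_continuous_path (hnull : ∀ A : Set Ω, P A = 0 → MeasurableSet[𝓕 0] A)
    (hX : IsScaledBM 𝓕 P X c) (t : ℝ≥0) :
    MeasurableSet[𝓕 t] {ω | Continuous fun s => X s ω} := by
  have h1 : MeasurableSet[𝓕 0] {ω | Continuous fun s => X s ω}ᶜ := hnull _ hX.cont
  have h2 := @MeasurableSet.compl _ _ (𝓕 0) h1
  rw [compl_compl] at h2
  exact 𝓕.mono zero_le _ h2

omit [IsProbabilityMeasure P] in
lemma adapted_affineVersion (hnull : ∀ A : Set Ω, P A = 0 → MeasurableSet[𝓕 0] A)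
    (hX : IsScaledBM 𝓕 P X c) (ht : t₀ ≤ t) :
    Measurable[𝓕 t] (affineVersion X α β t₀ t) := by
  classical
  obtain ⟨Y, hY, hYe⟩ := exists_measurable_eq_integral (𝓕 t) ht
    fun s hs => (hX.adapted s).mono (𝓕.mono hs) le_rfl
  have e : affineVersion X α β t₀ t = fun ω => if Continuous (fun s => X s ω) then
      (α + β * t) * X t ω - (α + β * t₀) * X t₀ ω - β * Y ω else 0 := by
    ext ω
    unfold affineVersion affineIntegral
    split_ifs with h
    · rw [hYe ω h]
    · rfl
  rw [e]
  refine Measurable.ite (measurableSet_continuous_path hnull hX t) ?_ measurable_const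
  exact (((hX.adapted t).const_mul _).sub
    (((hX.adapted t₀).mono (𝓕.mono ht) le_rfl).const_mul _)).sub (hY.const_mul _)

lemma isItoIntegral_affine (hnull : ∀ A : Set Ω, P A = 0 → MeasurableSet[𝓕 0] A)
    (hX : IsScaledBM 𝓕 P X c) (α β : ℝ) (h : t₀ ≤ T) :
    IsItoIntegral 𝓕 P X (fun s _ => α + β * (s : ℝ)) t₀ T (affineVersion X α β t₀) := by
  have hC : ∀ t ∈ Set.Icc t₀ T, ∀ _ : Ω, |α + β * (t : ℝ)| ≤ |α| + |β| * T := fun t ht _ => by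
    refine (abs_add_le _ _).trans ?_
    rw [abs_mul, abs_of_nonneg t.coe_nonneg]
    have : (t : ℝ) ≤ T := ht.2
    gcongr
  refine isItoIntegral_of_tendstoInMeasure hX h (H := fun s _ => α + β * (s : ℝ))
    (fun _ _ => measurable_const) hC (fun ω => by fun_prop)
    (fun t ht => adapted_affineVersion hnull hX ht.1) (fun ω => ?_) (fun t ht => ?_)
  · unfold affineVersion
    split_ifs with hω
    · exact (continuous_affineIntegral hω).continuousOn
    · exact continuousOn_const
  · refine tendstoInMeasure_of_tendsto_ae
      (fun n => (SimpleIntegrand.memLp_integral _ hX _ _).1) ?_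
    filter_upwards [hX.cont] with ω hω
    simp only [gridIntegrand_integral h _ hC X ht, affineVersion, if_pos hω]
    exact tendsto_sum_affine hω ht

/-- Every version of the stochastic integral of an affine function is given by integration by
parts. -/
lemma IsItoIntegral.ae_eq_affineIntegral (hnull : ∀ A : Set Ω, P A = 0 → MeasurableSet[𝓕 0] A)
    (hX : IsScaledBM 𝓕 P X c) {J : ℝ≥0 → Ω → ℝ} (h : t₀ ≤ T)
    (hJ : IsItoIntegral 𝓕 P X (fun s _ => α + β * (s : ℝ)) t₀ T J) :
    ∀ᵐ ω ∂P, ∀ t ∈ Set.Icc t₀ T, J t ω = affineIntegral X α β t₀ t ω := by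
  filter_upwards [hJ.ae_eq hX (isItoIntegral_affine hnull hX α β h), hX.cont] with ω h1 h2 t ht
  rw [h1 t ht, affineVersion, if_pos h2]

end Affine

/-! ### The Langevin equation, path by path -/

lemma measurable_plane {α : Type*} {m : MeasurableSpace α} {f : α → Plane}
    (h : ∀ i, Measurable fun x => f x i) : Measurable f :=
  (MeasurableEquiv.toLp 2 (Fin 2 → ℝ)).measurable.comp (measurable_pi_lambda _ h)

lemma measurable_plane_apply {α : Type*} {m : MeasurableSpace α} {f : α → Plane}
    (h : Measurable f) (i : Fin 2) : Measurable fun x => f x i :=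
  (measurable_pi_apply i).comp ((MeasurableEquiv.toLp 2 (Fin 2 → ℝ)).symm.measurable.comp h)

@[fun_prop]
lemma measurable_plane_eval (i : Fin 2) : Measurable fun z : Plane => z i :=
  measurable_plane_apply measurable_id i

lemma continuous_plane {α : Type*} [TopologicalSpace α] {f : α → Plane}
    (h : ∀ i, Continuous fun x => f x i) : Continuous f :=
  (PiLp.continuous_toLp 2 _).comp (continuous_pi h)

lemma continuous_plane_apply {α : Type*} [TopologicalSpace α] {f : α → Plane}
    (h : Continuous f) (i : Fin 2) : Continuous fun x => f x i :=
  (EuclideanSpace.proj i : Plane →L[ℝ] ℝ).continuous.comp h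

lemma continuous_flow {α : Type*} [TopologicalSpace α] {f : α → ℝ} {g : α → Plane}
    (hf : Continuous f) (hg : Continuous g) : Continuous fun x => flow (f x) (g x) := by
  refine continuous_plane fun i => ?_
  have h0 := continuous_plane_apply hg 0
  have h1 := continuous_plane_apply hg 1
  fin_cases i
  · simp only [Fin.zero_eta, flow_fst]; fun_prop
  · simpa using h1

lemma intervalIntegral_plane_apply {f : ℝ → Plane} (hf : Continuous f) (a b : ℝ) (i : Fin 2) :
    (∫ s in a..b, f s) i = ∫ s in a..b, f s i :=
  ((EuclideanSpace.proj i : Plane →L[ℝ] ℝ).intervalIntegral_comp_comm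
    (hf.intervalIntegrable a b)).symm

/-- For a continuous driving path `x`, the integrated Langevin equation has exactly one continuous
solution. As the drift is nilpotent, it is solved by integrating twice. -/
lemma langevin_path_iff {x : ℝ≥0 → ℝ} (hx : Continuous x) {z : ℝ≥0 → Plane} (hz : Continuous z)
    (ζ : Plane) :
    (∀ t : ℝ≥0, z t = ζ + (∫ s in (0 : ℝ)..t, act kinMat (z s.toNNReal)) + (x t - x 0) • e2) ↔
      ∀ t : ℝ≥0, z t 0 = ζ 0 + t * ζ 1 + (∫ s in (0 : ℝ)..t, x s.toNNReal) - t * x 0 ∧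
        z t 1 = ζ 1 + (x t - x 0) := by
  have hz' : Continuous fun s : ℝ => act kinMat (z s.toNNReal) :=
    (Matrix.toEuclideanCLM (𝕜 := ℝ) kinMat).continuous.comp (hz.comp continuous_real_toNNReal)
  have key : ∀ t : ℝ≥0,
      z t = ζ + (∫ s in (0 : ℝ)..t, act kinMat (z s.toNNReal)) + (x t - x 0) • e2 ↔
      z t 0 = ζ 0 + (∫ s in (0 : ℝ)..t, z s.toNNReal 1) ∧ z t 1 = ζ 1 + (x t - x 0) := by
    intro t
    have h0 := intervalIntegral_plane_apply hz' 0 t 0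
    have h1 := intervalIntegral_plane_apply hz' 0 t 1
    simp only [act_fst, act_snd, kinMat, Matrix.of_apply, Matrix.cons_val', Matrix.cons_val_zero,
      Matrix.cons_val_one, Matrix.cons_val_fin_one, zero_mul, one_mul, zero_add, add_zero,
      intervalIntegral.integral_zero] at h0 h1
    constructor
    · intro h
      constructor
      · rw [h]
        simp only [PiLp.add_apply, PiLp.smul_apply, e2_fst, smul_zero, add_zero]
        exact congrArg _ h0
      · rw [h]
        simp only [PiLp.add_apply, PiLp.smul_apply, e2_snd, smul_eq_mul, mul_one]
        rw [show (∫ s in (0 : ℝ)..t, act kinMat (z s.toNNReal)).ofLp 1 = 0 from h1, add_zero]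
    · rintro ⟨g0, g1⟩
      refine plane_ext ?_ ?_
      · simp only [PiLp.add_apply, PiLp.smul_apply, e2_fst, smul_zero, add_zero]
        rw [g0]; exact congrArg _ h0.symm
      · simp only [PiLp.add_apply, PiLp.smul_apply, e2_snd, smul_eq_mul, mul_one]
        rw [g1, show (∫ s in (0 : ℝ)..t, act kinMat (z s.toNNReal)).ofLp 1 = 0 from h1, add_zero]
  simp only [key]
  have hint : (∀ t : ℝ≥0, z t 1 = ζ 1 + (x t - x 0)) → ∀ t : ℝ≥0,
      (∫ s in (0 : ℝ)..t, z s.toNNReal 1) =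
        t * ζ 1 + (∫ s in (0 : ℝ)..t, x s.toNNReal) - t * x 0 := by
    intro h t
    have hc : Continuous fun s : ℝ => x s.toNNReal := hx.comp continuous_real_toNNReal
    simp only [h]
    rw [intervalIntegral.integral_add intervalIntegrable_const
      ((hc.intervalIntegrable _ _).sub intervalIntegrable_const),
      intervalIntegral.integral_sub (hc.intervalIntegrable _ _) intervalIntegrable_const]
    simp
    ring
  constructor
  · intro h t
    exact ⟨by rw [(h t).1, hint fun t => (h t).2]; ring, (h t).2⟩
  · intro h t
    exact ⟨by rw [(h t).1, hint fun t => (h t).2]; ring, (h t).2⟩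

/-! ### The flow integral and the solution of the Langevin equation -/

section FlowIntegral

variable {𝓕 : Filtration ℝ≥0 mΩ} {P : Measure Ω} [IsProbabilityMeasure P] {X : ℝ≥0 → Ω → ℝ}
  {c : ℝ≥0} {I : ℝ≥0 → Ω → Plane}

lemma exists_isFlowIntegral (hnull : ∀ A : Set Ω, P A = 0 → MeasurableSet[𝓕 0] A)
    (hX : IsScaledBM 𝓕 P X c) : ∃ I, IsFlowIntegral 𝓕 P X I := by
  refine ⟨fun t ω => !₂[affineVersion X 0 (-1) 0 t ω, affineVersion X 1 0 0 t ω], fun T i => ?_⟩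
  fin_cases i
  · simpa using isItoIntegral_affine hnull hX 0 (-1) (zero_le (a := T))
  · simpa using isItoIntegral_affine hnull hX 1 0 (zero_le (a := T))

/-- Integration by parts for the flow integral. -/
lemma IsFlowIntegral.ae_eq (hnull : ∀ A : Set Ω, P A = 0 → MeasurableSet[𝓕 0] A)
    (hX : IsScaledBM 𝓕 P X c) (hI : IsFlowIntegral 𝓕 P X I) :
    ∀ᵐ ω ∂P, ∀ t : ℝ≥0, I t ω 0 = -(t * X t ω) + (∫ s in (0 : ℝ)..t, X s.toNNReal ω) ∧
      I t ω 1 = X t ω - X 0 ω := by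
  have h0 : ∀ᵐ ω ∂P, ∀ n : ℕ, ∀ t ∈ Set.Icc (0 : ℝ≥0) n,
      I t ω 0 = affineIntegral X 0 (-1) 0 t ω := ae_all_iff.2 fun n =>
    IsItoIntegral.ae_eq_affineIntegral hnull hX zero_le (by simpa using hI n 0)
  have h1 : ∀ᵐ ω ∂P, ∀ n : ℕ, ∀ t ∈ Set.Icc (0 : ℝ≥0) n,
      I t ω 1 = affineIntegral X 1 0 0 t ω := ae_all_iff.2 fun n =>
    IsItoIntegral.ae_eq_affineIntegral hnull hX zero_le (by simpa using hI n 1)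
  filter_upwards [h0, h1] with ω h0 h1 t
  obtain ⟨n, hn⟩ := exists_nat_ge t
  rw [h0 n t ⟨zero_le, hn⟩, h1 n t ⟨zero_le, hn⟩]
  simp [affineIntegral]

omit [IsProbabilityMeasure P] in
lemma IsFlowIntegral.adapted (hI : IsFlowIntegral 𝓕 P X I) (t : ℝ≥0) : Measurable[𝓕 t] (I t) :=
  @measurable_plane _ (𝓕 t) _ fun i => (hI t i).adapted t ⟨zero_le, le_rfl⟩

omit [IsProbabilityMeasure P] in
lemma IsFlowIntegral.continuous (hI : IsFlowIntegral 𝓕 P X I) (ω : Ω) :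
    Continuous fun t => I t ω := by
  refine continuous_plane fun i => continuous_iff_continuousAt.2 fun t => ?_
  exact ((hI (t + 1) i).cont ω).continuousAt
    (mem_of_superset (Iio_mem_nhds (lt_add_one t)) fun s hs => ⟨zero_le, le_of_lt hs⟩)

lemma flow_add_eq {ζ : Plane} {t : ℝ≥0} {ω : Ω} {A : ℝ}
    (h : I t ω 0 = -(t * X t ω) + A ∧ I t ω 1 = X t ω - X 0 ω) :
    flow t (ζ + I t ω) 0 = ζ 0 + t * ζ 1 + A - t * X 0 ω ∧
      flow t (ζ + I t ω) 1 = ζ 1 + (X t ω - X 0 ω) := by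
  rw [flow_fst, flow_snd]
  simp only [PiLp.add_apply, h.1, h.2]
  exact ⟨by ring, trivial⟩

end FlowIntegral

section Solution

variable {𝓕 : Filtration ℝ≥0 mΩ} {P : Measure Ω} [IsProbabilityMeasure P] {B W : ℝ≥0 → Ω → ℝ}
  {a σ : ℝ} {I : ℝ≥0 → Ω → Plane}

lemma measurable_flow (t : ℝ) : Measurable (flow t) :=
  (continuous_flow continuous_const continuous_id).measurable

lemma isLangevinSolution_flow (hnull : ∀ A : Set Ω, P A = 0 → MeasurableSet[𝓕 0] A)
    (hBW : IsBrownianPair 𝓕 P B W) (hI : IsFlowIntegral 𝓕 P (noise a σ B W) I) (ζ : Plane) :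
    IsLangevinSolution 𝓕 P B W a σ ζ (fun t ω => flow t (ζ + I t ω)) := by
  obtain ⟨c, hX⟩ := hBW.isScaledBM_noise a σ
  have hc : ∀ ω, Continuous fun t : ℝ≥0 => flow t (ζ + I t ω) := fun ω =>
    continuous_flow NNReal.continuous_coe (continuous_const.add (hI.continuous ω))
  refine ⟨fun t => (measurable_flow t).comp ((hI.adapted t).const_add ζ), ae_of_all _ hc, ?_⟩
  filter_upwards [hI.ae_eq hnull hX, hX.cont] with ω h1 h2
  exact (langevin_path_iff h2 (hc ω) ζ).2 fun t => flow_add_eq (h1 t)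

lemma IsLangevinSolution.ae_eq_flow (hnull : ∀ A : Set Ω, P A = 0 → MeasurableSet[𝓕 0] A)
    (hBW : IsBrownianPair 𝓕 P B W) (hI : IsFlowIntegral 𝓕 P (noise a σ B W) I) {ζ : Plane}
    {Z : ℝ≥0 → Ω → Plane} (hZ : IsLangevinSolution 𝓕 P B W a σ ζ Z) :
    ∀ᵐ ω ∂P, ∀ t, Z t ω = flow t (ζ + I t ω) := by
  obtain ⟨c, hX⟩ := hBW.isScaledBM_noise a σ
  filter_upwards [hI.ae_eq hnull hX, hX.cont, hZ.cont, hZ.eqn] with ω h1 h2 h3 h4 t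
  have h5 := (langevin_path_iff h2 h3 ζ).1 h4 t
  have h6 := flow_add_eq (ζ := ζ) (h1 t)
  exact plane_ext (h5.1.trans h6.1.symm) (h5.2.trans h6.2.symm)

/-- The stochastic integral with respect to the noise splits into its two parts. -/
lemma flowIntegral_noise_eq (hnull : ∀ A : Set Ω, P A = 0 → MeasurableSet[𝓕 0] A)
    (hBW : IsBrownianPair 𝓕 P B W) {J K : ℝ≥0 → Ω → Plane}
    (hI : IsFlowIntegral 𝓕 P (noise a σ B W) I) (hJ : IsFlowIntegral 𝓕 P B J)
    (hK : IsFlowIntegral 𝓕 P W K) :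
    ∀ᵐ ω ∂P, ∀ t, I t ω = √(a - σ ^ 2) • J t ω - σ • K t ω := by
  obtain ⟨c, hX⟩ := hBW.isScaledBM_noise a σ
  filter_upwards [hI.ae_eq hnull hX, hJ.ae_eq hnull hBW.isScaledBM_left,
    hK.ae_eq hnull hBW.isScaledBM_right, hBW.brownian_left.cont, hBW.brownian_right.cont]
    with ω h1 h2 h3 h4 h5 t
  have hB := ((continuous_path_toNNReal h4).intervalIntegrable 0 t (μ := volume)).const_mul
    √(a - σ ^ 2)
  have hW := ((continuous_path_toNNReal h5).intervalIntegrable 0 t (μ := volume)).const_mul σ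
  refine plane_ext ?_ ?_
  · simp only [PiLp.sub_apply, PiLp.smul_apply, smul_eq_mul, (h1 t).1, (h2 t).1, (h3 t).1, noise]
    rw [intervalIntegral.integral_sub hB hW, intervalIntegral.integral_const_mul,
      intervalIntegral.integral_const_mul]
    ring
  · simp only [PiLp.sub_apply, PiLp.smul_apply, smul_eq_mul, (h1 t).2, (h2 t).2, (h3 t).2, noise]
    ring

end Solution

/-! ### The Gaussian law of the flow integral -/

section Law

variable {𝓕 : Filtration ℝ≥0 mΩ} {P : Measure Ω} [IsProbabilityMeasure P] {X : ℝ≥0 → Ω → ℝ}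
  {c : ℝ≥0}

/-- Elementary sums with deterministic weights are centred Gaussian. -/
lemma IsScaledBM.hasLaw_sum (hX : IsScaledBM 𝓕 P X c) {τ : ℕ → ℝ≥0}
    (hτ : Monotone τ) (f : ℕ → ℝ) (k : ℕ) :
    HasLaw (fun ω => ∑ i ∈ Finset.range k, f i * (X (τ (i + 1)) ω - X (τ i) ω))
      (gaussianReal 0 (∑ i ∈ Finset.range k,
        .mk (f i ^ 2) (sq_nonneg _) * (c * (τ (i + 1) - τ i)))) P := by
  induction k with
  | zero =>
    simp only [Finset.range_zero, Finset.sum_empty, gaussianReal_zero_var]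
    exact hasLaw_dirac_of_ae_eq (ae_of_all _ fun _ => rfl)
  | succ k ih =>
    have hk := hτ (Nat.le_succ k)
    have h1 := gaussianReal_const_mul (hX.law _ _ hk) (f k)
    have hm : Measurable[𝓕 (τ k)]
        (fun ω => ∑ i ∈ Finset.range k, f i * (X (τ (i + 1)) ω - X (τ i) ω)) := by
      refine Finset.measurable_sum _ fun i hi => Measurable.const_mul ?_ _
      have hi : i + 1 ≤ k := Finset.mem_range.1 hi
      exact ((hX.adapted _).mono (𝓕.mono (hτ hi)) le_rfl).sub
        ((hX.adapted _).mono (𝓕.mono (hτ ((Nat.le_succ i).trans hi))) le_rfl)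
    have hi : IndepFun (fun ω => ∑ i ∈ Finset.range k, f i * (X (τ (i + 1)) ω - X (τ i) ω))
        (fun ω => f k * (X (τ (k + 1)) ω - X (τ k) ω)) P := by
      rw [IndepFun_iff_Indep]
      refine (indep_of_indep_of_le_left (indep_of_indep_of_le_right (hX.indep _ _ hk)
        hm.comap_le) ?_).symm
      rw [show (fun ω => f k * (X (τ (k + 1)) ω - X (τ k) ω)) =
        (fun x => f k * x) ∘ fun ω => X (τ (k + 1)) ω - X (τ k) ω from rfl,
        ← MeasurableSpace.comap_comp]
      exact MeasurableSpace.comap_mono (measurable_const_mul (f k)).comap_le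
    have h2 := gaussianReal_add_gaussianReal_of_indepFun hi ih.map_eq h1.map_eq
    simp only [Finset.sum_range_succ]
    refine ⟨ih.aemeasurable.add h1.aemeasurable, ?_⟩
    simpa using! h2

/-- The characteristic function, at `1`, of the stochastic integral of an affine function. -/
lemma IsScaledBM.integral_cexp_affineIntegral (hX : IsScaledBM 𝓕 P X c) (α β : ℝ) (t : ℝ≥0) :
    ∫ ω, Complex.exp (affineIntegral X α β 0 t ω * Complex.I) ∂P =
      Complex.exp (-((c * (α ^ 2 * t + α * β * t ^ 2 + β ^ 2 * t ^ 3 / 3) : ℝ) : ℂ) / 2) := by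
  have ht : t ∈ Set.Icc 0 t := ⟨zero_le, le_rfl⟩
  set τ := stoppedGrid 0 t t with hτ
  let S : ℕ → Ω → ℝ := fun n ω => ∑ i ∈ Finset.range (n + 1), (α + β * (τ n i : ℝ)) *
    (X (τ n (i + 1)) ω - X (τ n i) ω)
  let v : ℕ → ℝ := fun n => ∑ i ∈ Finset.range (n + 1), (α + β * (τ n i : ℝ)) ^ 2 *
    (c * ((τ n (i + 1) : ℝ) - τ n i))
  have hS : ∀ n, ∫ ω, Complex.exp (S n ω * Complex.I) ∂P = Complex.exp (-(v n : ℂ) / 2) := by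
    intro n
    have h1 := hX.hasLaw_sum (stoppedGrid_mono (t₀ := 0) (T := t) (t := t) n)
      (fun i => α + β * (τ n i : ℝ)) (n + 1)
    have h2 := h1.integral_comp (f := fun x : ℝ => Complex.exp (x * Complex.I))
      (by fun_prop)
    rw [Function.comp_def] at h2
    refine h2.trans ?_
    have h3 := charFun_gaussianReal (μ := 0) (v := ∑ i ∈ Finset.range (n + 1),
        .mk ((α + β * (τ n i : ℝ)) ^ 2) (sq_nonneg _) * (c * (τ n (i + 1) - τ n i))) 1
    rw [charFun_apply_real] at h3
    simp only [Complex.ofReal_one, one_mul, one_pow, mul_one, Complex.ofReal_zero, zero_mul,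
      zero_sub] at h3
    refine h3.trans ?_
    congr 1
    have h4 : ((∑ i ∈ Finset.range (n + 1), NNReal.mk ((α + β * (τ n i : ℝ)) ^ 2) (sq_nonneg _) *
        (c * (τ n (i + 1) - τ n i)) : ℝ≥0) : ℝ) = v n := by
      rw [NNReal.coe_sum]
      refine Finset.sum_congr rfl fun i _ => ?_
      rw [NNReal.coe_mul, NNReal.coe_mul, NNReal.coe_sub (stoppedGrid_mono n (Nat.le_succ i))]
      rfl
    rw [← h4]
    push_cast
    ring
  have hv : Tendsto v atTop (𝓝 (c * (α ^ 2 * t + α * β * t ^ 2 + β ^ 2 * t ^ 3 / 3))) := by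
    let G : ℝ≥0 → ℝ := fun s => c * (α ^ 2 * s + α * β * s ^ 2 + β ^ 2 * s ^ 3 / 3)
    have h1 := tendsto_sum_stoppedGrid_zero ht (E := fun s r : ℝ≥0 =>
        (α + β * (s : ℝ)) ^ 2 * (c * (r - s)) - (G r - G s)) (by
      intro ε hε
      set M := (c : ℝ) * ((|α| + |β| * t) * |β| + β ^ 2 * t) + 1 with hM
      have hM0 : 0 < M := by positivity
      refine ⟨ε / M, by positivity, fun s r _ hsr hr hd => ?_⟩
      have hsr' : (0 : ℝ) ≤ r - s := sub_nonneg.2 (NNReal.coe_le_coe.2 hsr)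
      have hr' : (r : ℝ) ≤ t := NNReal.coe_le_coe.2 hr
      have hs' : (s : ℝ) ≤ t := (NNReal.coe_le_coe.2 hsr).trans hr'
      have hs0 : (0 : ℝ) ≤ s := s.coe_nonneg
      have e : (α + β * (s : ℝ)) ^ 2 * (c * (r - s)) - (G r - G s) =
          -((r - s) * (r - s)) * (c * ((α + β * s) * β + β ^ 2 * (r - s) / 3)) := by
        simp only [G]; ring
      rw [e, abs_mul, abs_neg, abs_mul, abs_of_nonneg hsr']
      have h2 : |(c : ℝ) * ((α + β * s) * β + β ^ 2 * (r - s) / 3)| ≤ M := by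
        rw [abs_mul, abs_of_nonneg c.coe_nonneg, hM]
        have h3 : |(α + β * s) * β + β ^ 2 * (r - s) / 3| ≤
            (|α| + |β| * t) * |β| + β ^ 2 * t := by
          refine (abs_add_le _ _).trans (add_le_add ?_ ?_)
          · rw [abs_mul]
            gcongr
            refine (abs_add_le _ _).trans ?_
            rw [abs_mul, abs_of_nonneg hs0]
            gcongr
          · rw [abs_of_nonneg (by positivity), mul_div_assoc]
            gcongr
            linarith
        nlinarith [mul_le_mul_of_nonneg_left h3 c.coe_nonneg]
      calc (r - s : ℝ) * (r - s) * _ ≤ (r - s) * (ε / M) * M := by gcongr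
        _ = ε * (r - s) := by field_simp)
    simp only [Finset.sum_sub_distrib] at h1
    have h2 : ∀ n, ∑ i ∈ Finset.range (n + 1), G (τ n (i + 1)) -
        ∑ i ∈ Finset.range (n + 1), G (τ n i) = G t - G 0 := fun n => by
      rw [← sum_stoppedGrid_sub ht n G, Finset.sum_sub_distrib]
    simp only [← hτ, h2] at h1
    have h3 := h1.add_const (G t - G 0)
    simp only [sub_add_cancel, zero_add] at h3
    simpa [v, G] using h3
  have hlim : Tendsto (fun n => ∫ ω, Complex.exp (S n ω * Complex.I) ∂P) atTop
      (𝓝 (∫ ω, Complex.exp (affineIntegral X α β 0 t ω * Complex.I) ∂P)) := by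
    refine tendsto_integral_of_dominated_convergence (fun _ => 1) (fun n => ?_)
      (integrable_const _) (fun n => ae_of_all _ fun ω => ?_) ?_
    · have hm : Measurable (S n) := Finset.measurable_sum _ fun i _ =>
        ((hX.measurable _).sub (hX.measurable _)).const_mul _
      have : Measurable fun ω => Complex.exp (S n ω * Complex.I) := by fun_prop
      exact this.aestronglyMeasurable
    · rw [Complex.norm_exp_ofReal_mul_I]
    · filter_upwards [hX.cont] with ω hω
      have h1 := tendsto_sum_affine (α := α) (β := β) hω ht
      have h2 : Continuous fun x : ℝ => Complex.exp (x * Complex.I) := by fun_prop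
      exact (h2.tendsto _).comp h1
  refine tendsto_nhds_unique hlim ?_
  simp only [hS]
  have h1 : Continuous fun x : ℝ => Complex.exp (-(x : ℂ) / 2) := by fun_prop
  exact (h1.tendsto _).comp hv

omit [IsProbabilityMeasure P] in
lemma IsFlowIntegral.measurable {I : ℝ≥0 → Ω → Plane} (hI : IsFlowIntegral 𝓕 P X I) (t : ℝ≥0) :
    Measurable (I t) :=
  (hI.adapted t).mono (𝓕.le t) le_rfl

lemma multivariateGaussian_eq_map_const_add (m : Plane) (C : Matrix (Fin 2) (Fin 2) ℝ) :
    multivariateGaussian m C = (multivariateGaussian 0 C).map (fun x => m + x) := by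
  unfold multivariateGaussian
  rw [Measure.map_map (by fun_prop) (by fun_prop)]
  simp [Function.comp_def]

lemma flow_add (t : ℝ) (y z : Plane) : flow t (y + z) = flow t y + flow t z :=
  map_add (Matrix.toEuclideanCLM (𝕜 := ℝ) (NormedSpace.exp (t • kinMat))) y z

lemma flow_smul (t r : ℝ) (z : Plane) : flow t (r • z) = r • flow t z :=
  map_smul (Matrix.toEuclideanCLM (𝕜 := ℝ) (NormedSpace.exp (t • kinMat))) r z

/-- The flow integral with respect to a standard Brownian motion, transported by the flow, is
Gaussian with covariance matrix `Q_t`, up to the factor `a - σ²`. -/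
lemma IsFlowIntegral.hasLaw (hnull : ∀ A : Set Ω, P A = 0 → MeasurableSet[𝓕 0] A)
    (hX : IsScaledBM 𝓕 P X 1) {I : ℝ≥0 → Ω → Plane} (hI : IsFlowIntegral 𝓕 P X I) {a σ : ℝ}
    (h : 0 ≤ a - σ ^ 2) (t : ℝ≥0) :
    HasLaw (fun ω => flow t (√(a - σ ^ 2) • I t ω)) (multivariateGaussian 0 (Cmat a σ t)) P := by
  have hI' : Measurable (fun ω => √(a - σ ^ 2) • I t ω) := (hI.measurable t).fun_const_smul _
  have hm : Measurable fun ω => flow t (√(a - σ ^ 2) • I t ω) := (measurable_flow t).comp hI'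
  refine ⟨hm.aemeasurable, ?_⟩
  have := Measure.isProbabilityMeasure_map (μ := P) hm.aemeasurable
  apply Measure.ext_of_charFun
  ext u
  rw [charFun_multivariateGaussian (Cmat_posSemidef h t.coe_nonneg), charFun_apply,
    integral_map hm.aemeasurable (by fun_prop)]
  set κ := √(a - σ ^ 2) with hκ
  have hκ2 : κ ^ 2 = a - σ ^ 2 := Real.sq_sqrt h
  have e : ∀ᵐ ω ∂P, inner ℝ (flow t (κ • I t ω)) u =
      affineIntegral X (κ * (u 0 * t + u 1)) (-(κ * u 0)) 0 t ω := by
    filter_upwards [hI.ae_eq hnull hX] with ω hω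
    rw [inner_plane, flow_fst, flow_snd]
    simp only [PiLp.smul_apply, smul_eq_mul, (hω t).1, (hω t).2, affineIntegral]
    push_cast
    ring
  have e2 : ∫ ω, Complex.exp (inner ℝ (flow t (κ • I t ω)) u * Complex.I) ∂P =
      ∫ ω, Complex.exp (affineIntegral X (κ * (u 0 * t + u 1)) (-(κ * u 0)) 0 t ω * Complex.I)
        ∂P := by
    refine integral_congr_ae ?_
    filter_upwards [e] with ω hω
    rw [hω]
  rw [e2, hX.integral_cexp_affineIntegral]
  congr 1
  rw [inner_zero_right, Complex.ofReal_zero, zero_mul, zero_sub, neg_div, neg_inj]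
  congr 1
  rw [Complex.ofReal_inj, Cmat_eq]
  simp only [Matrix.mulVec, dotProduct, Fin.sum_univ_two, Matrix.of_apply, Matrix.cons_val',
    Matrix.cons_val_zero, Matrix.cons_val_one, Matrix.cons_val_fin_one]
  rw [← hκ2]
  push_cast
  ring

end Law

/-! ### Conditioning on an independent part -/

lemma measurable_observed {X : ℝ≥0 → Ω → ℝ} {s t : ℝ≥0} (h : s ≤ t) :
    Measurable[observed X t] (X s) :=
  Measurable.of_comap_le (le_iSup₂ (f := fun s (_ : s ∈ Set.Iic t) =>
    MeasurableSpace.comap (X s) inferInstance) s h)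

lemma observed_le {X : ℝ≥0 → Ω → ℝ} (h : ∀ t, Measurable (X t)) (t : ℝ≥0) :
    observed X t ≤ mΩ :=
  iSup₂_le fun s _ => (h s).comap_le

lemma observed_le_comap {X : ℝ≥0 → Ω → ℝ} (t : ℝ≥0) :
    observed X t ≤ MeasurableSpace.comap (fun ω s => X s ω) inferInstance := by
  refine iSup₂_le fun s _ => ?_
  rw [show X s = (fun x : ℝ≥0 → ℝ => x s) ∘ fun ω s => X s ω from rfl,
    ← MeasurableSpace.comap_comp]
  exact MeasurableSpace.comap_mono (measurable_pi_apply s).comap_le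

section Conditioning

variable {Ω : Type*} {𝓖 𝓗 mΩ : MeasurableSpace Ω} {P : Measure Ω} [IsProbabilityMeasure P]

/-- The conditional law of `m + N`, where `m` is observed and `N` is independent of the
observation, is the law of `N` translated by `m`. -/
lemma isCondLaw_add_of_indep (h𝓖 : 𝓖 ≤ mΩ) (h𝓗 : 𝓗 ≤ mΩ) (hi : Indep 𝓗 𝓖 P) {m N Y : Ω → Plane}
    (hm : Measurable[𝓖] m) (hN : Measurable[𝓗] N) {μ : Measure Plane} [IsProbabilityMeasure μ]
    (hμ : HasLaw N μ P) (hY : Y =ᵐ[P] fun ω => m ω + N ω) :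
    IsCondLaw P 𝓖 Y (fun ω => μ.map (fun x => m ω + x)) := by
  have hadd : ∀ y : Plane, Measurable fun x : Plane => y + x := fun y => by fun_prop
  refine ⟨ae_of_all _ fun ω => Measure.isProbabilityMeasure_map (hadd _).aemeasurable,
    fun A hA => ?_⟩
  let V : Set (Plane × Plane) := {p | p.1 + p.2 ∈ A}
  have hV : MeasurableSet V := (measurable_fst.add measurable_snd) hA
  have hκ : Measurable fun y : Plane => μ (Prod.mk y ⁻¹' V) := measurable_measure_prodMk_left hV
  have hm' : Measurable m := hm.mono h𝓖 le_rfl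
  have hN' : Measurable N := hN.mono h𝓗 le_rfl
  have hmap : ∀ ω, (μ.map (fun x => m ω + x)).real A = (μ (Prod.mk (m ω) ⁻¹' V)).toReal :=
    fun ω => by rw [Measure.real, Measure.map_apply (hadd _) hA]; rfl
  simp only [hmap]
  have hf : (Y ⁻¹' A).indicator (fun _ => (1 : ℝ)) =ᵐ[P]
      ({ω | (m ω, N ω) ∈ V}).indicator (fun _ => (1 : ℝ)) := by
    filter_upwards [hY] with ω hω
    have h : ω ∈ Y ⁻¹' A ↔ ω ∈ {ω | (m ω, N ω) ∈ V} := by rw [Set.mem_preimage, hω]; rfl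
    by_cases h' : ω ∈ {ω | (m ω, N ω) ∈ V}
    · rw [Set.indicator_of_mem h', Set.indicator_of_mem (h.2 h')]
    · rw [Set.indicator_of_notMem h', Set.indicator_of_notMem (h' ∘ h.1)]
  have hD : MeasurableSet {ω | (m ω, N ω) ∈ V} := (hm'.prodMk hN') hV
  have hint : Integrable (fun ω => (μ (Prod.mk (m ω) ⁻¹' V)).toReal) P := by
    refine Integrable.of_bound (hκ.ennreal_toReal.comp hm').aestronglyMeasurable 1
      (ae_of_all _ fun ω => ?_)
    rw [Real.norm_of_nonneg ENNReal.toReal_nonneg]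
    exact ENNReal.toReal_le_of_le_ofReal zero_le_one (by simpa using prob_le_one)
  refine (condExp_congr_ae hf).trans (ae_eq_condExp_of_forall_setIntegral_eq h𝓖
    ((integrable_const (1 : ℝ)).indicator hD) (fun _ _ _ => hint.integrableOn) (fun S hS _ => ?_)
    (hκ.ennreal_toReal.comp hm).aestronglyMeasurable).symm
  -- the pair formed by the indicator of `S` and `m` is independent of `N`
  have hS' : MeasurableSet S := h𝓖 S hS
  let U : Ω → ℝ × Plane := fun ω => (S.indicator (fun _ => 1) ω, m ω)
  have hU : Measurable[𝓖] U := (measurable_const.indicator hS).prodMk hm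
  have hU' : Measurable U := hU.mono h𝓖 le_rfl
  have hUN : IndepFun U N P := by
    rw [IndepFun_iff_Indep]
    exact (indep_of_indep_of_le_left (indep_of_indep_of_le_right hi hU.comap_le) hN.comap_le).symm
  have hprod := (indepFun_iff_map_prod_eq_prod_map_map hU'.aemeasurable hN'.aemeasurable).1 hUN
  rw [hμ.map_eq] at hprod
  let D : Set ((ℝ × Plane) × Plane) := {p | p.1.1 = 1} ∩ {p | p.1.2 + p.2 ∈ A}
  have hDm : MeasurableSet D :=
    (measurableSet_eq_fun (measurable_fst.comp measurable_fst) measurable_const).inter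
      (((measurable_snd.comp measurable_fst).add measurable_snd) hA)
  have key : P ({ω | (m ω, N ω) ∈ V} ∩ S) = ∫⁻ ω in S, μ (Prod.mk (m ω) ⁻¹' V) ∂P := by
    have h1 : {ω | (m ω, N ω) ∈ V} ∩ S = (fun ω => (U ω, N ω)) ⁻¹' D := by
      ext ω
      by_cases h : ω ∈ S <;> simp [D, U, V, h]
    rw [h1, ← Measure.map_apply (hU'.prodMk hN') hDm, hprod, Measure.prod_apply hDm,
      lintegral_map (measurable_measure_prodMk_left hDm) hU', ← lintegral_indicator hS']
    refine lintegral_congr fun ω => ?_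
    by_cases h : ω ∈ S
    · simp only [Set.indicator_of_mem h]
      congr 1
      ext x
      simp [D, U, V, h]
    · simp only [Set.indicator_of_notMem h]
      convert measure_empty (μ := μ)
      ext x
      simp [D, U, h]
  have hκm : AEMeasurable (fun ω => μ (Prod.mk (m ω) ⁻¹' V)) (P.restrict S) :=
    (hκ.comp hm').aemeasurable
  rw [integral_toReal hκm (ae_of_all _ fun ω => measure_lt_top _ _),
    setIntegral_indicator hD, setIntegral_const, smul_eq_mul, mul_one, Measure.real, ← key,
    Set.inter_comm]

omit [IsProbabilityMeasure P] in
lemma IsCondLaw.congr {Y : Ω → Plane} {ν ν' : Ω → Measure Plane} (h : IsCondLaw P 𝓖 Y ν)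
    (h' : ν =ᵐ[P] ν') : IsCondLaw P 𝓖 Y ν' := by
  refine ⟨?_, fun A hA => (h.2 A hA).trans ?_⟩
  · filter_upwards [h.1, h'] with ω h1 h2
    rwa [← h2]
  · filter_upwards [h'] with ω h2
    rw [h2]

/-- The conditional expectation of `m + N`, where `m` is observed and `N` is centred and
independent of the observation. -/
lemma condExp_add_of_indep {E : Type*} [NormedAddCommGroup E] [NormedSpace ℝ E] [CompleteSpace E]
    (h𝓖 : 𝓖 ≤ mΩ) (h𝓗 : 𝓗 ≤ mΩ) (hi : Indep 𝓗 𝓖 P) {m N Y : Ω → E}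
    (hm : StronglyMeasurable[𝓖] m) (hN : StronglyMeasurable[𝓗] N) (hmi : Integrable m P)
    (hNi : Integrable N P) (hN0 : ∫ ω, N ω ∂P = 0) (hY : Y =ᵐ[P] fun ω => m ω + N ω) :
    P[Y | 𝓖] =ᵐ[P] m := by
  refine (condExp_congr_ae hY).trans ((condExp_add hmi hNi 𝓖).trans ?_)
  rw [condExp_of_stronglyMeasurable h𝓖 hm hmi]
  filter_upwards [condExp_indep_eq h𝓗 h𝓖 hN hi] with ω hω
  rw [Pi.add_apply, hω, hN0, add_zero]

end Conditioning

section Filter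

variable {𝓕 : Filtration ℝ≥0 mΩ} {P : Measure Ω} [IsProbabilityMeasure P] {X : ℝ≥0 → Ω → ℝ}
  {c : ℝ≥0} {I : ℝ≥0 → Ω → Plane} {a σ : ℝ}

/-- The flow integral up to time `t` is a functional of the path up to time `t`. -/
lemma IsFlowIntegral.exists_measurable (hnull : ∀ A : Set Ω, P A = 0 → MeasurableSet[𝓕 0] A)
    (hX : IsScaledBM 𝓕 P X c) (hI : IsFlowIntegral 𝓕 P X I) (t : ℝ≥0) :
    ∃ I' : Ω → Plane, Measurable[observed X t] I' ∧ I t =ᵐ[P] I' := by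
  obtain ⟨Y, hY, hYX⟩ := exists_measurable_eq_integral (observed X t) (zero_le (a := t))
    fun s hs => measurable_observed (X := X) hs
  have h0 := measurable_observed (X := X) (zero_le (a := t))
  have ht := measurable_observed (X := X) (le_refl t)
  refine ⟨fun ω => !₂[-(t * X t ω) + Y ω, X t ω - X 0 ω],
    @measurable_plane _ (observed X t) _ fun i => ?_, ?_⟩
  · fin_cases i
    · exact (ht.const_mul _).neg.add hY
    · exact ht.sub h0
  · filter_upwards [hI.ae_eq hnull hX, hX.cont] with ω h1 h2
    refine plane_ext ?_ ?_
    · rw [(h1 t).1, ← NNReal.coe_zero, ← hYX ω h2]; rfl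
    · rw [(h1 t).2]; rfl

omit [IsProbabilityMeasure P] in
lemma memLp_two_of_hasLaw_multivariateGaussian {N : Ω → Plane} {m : Plane}
    {C : Matrix (Fin 2) (Fin 2) ℝ} (h : HasLaw N (multivariateGaussian m C) P) : MemLp N 2 P := by
  have h1 : MemLp id 2 (P.map N) := by
    rw [h.map_eq]
    exact IsGaussian.memLp_two_id
  exact (memLp_map_measure_iff aestronglyMeasurable_id h.aemeasurable).1 h1

lemma IsFlowIntegral.memLp (hnull : ∀ A : Set Ω, P A = 0 → MeasurableSet[𝓕 0] A)
    (hX : IsScaledBM 𝓕 P X 1) (hI : IsFlowIntegral 𝓕 P X I) (t : ℝ≥0) :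
    MemLp (fun ω => flow t (I t ω)) 2 P := by
  have h := hI.hasLaw hnull hX (a := 1) (σ := 0) (by norm_num) t
  have h' := memLp_two_of_hasLaw_multivariateGaussian h
  simpa using h'

lemma condMean_eq (σ : ℝ) (I : ℝ≥0 → Ω → Plane) (ζ : Plane) (t : ℝ≥0) (ω : Ω) :
    condMean σ I ζ t ω = flow t ζ - σ • flow t (I t ω) := by
  rw [condMean, sub_eq_add_neg, flow_add, ← neg_smul, flow_smul, neg_smul, ← sub_eq_add_neg]

variable {B W : ℝ≥0 → Ω → ℝ}

/-- The solution at time `t` is the sum of the observed variable `m` and of the variable `N`,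
which is independent of the observation, centred and Gaussian with covariance `C_t`. -/
lemma IsLangevinSolution.exists_decomposition
    (hnull : ∀ A : Set Ω, P A = 0 → MeasurableSet[𝓕 0] A) (hBW : IsBrownianPair 𝓕 P B W)
    (h : 0 ≤ a - σ ^ 2) (hI : IsFlowIntegral 𝓕 P W I) {ζ : Plane} {Z : ℝ≥0 → Ω → Plane}
    (hZ : IsLangevinSolution 𝓕 P B W a σ ζ Z) (t : ℝ≥0) :
    ∃ m N : Ω → Plane, Measurable[observed W t] m ∧ Measurable[observed B t] N ∧
      MemLp m 2 P ∧ HasLaw N (multivariateGaussian 0 (Cmat a σ t)) P ∧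
      condMean σ I ζ t =ᵐ[P] m ∧ Z t =ᵐ[P] fun ω => m ω + N ω := by
  obtain ⟨c, hX⟩ := hBW.isScaledBM_noise a σ
  obtain ⟨I₀, hI₀⟩ := exists_isFlowIntegral hnull hX
  obtain ⟨J, hJ⟩ := exists_isFlowIntegral hnull hBW.isScaledBM_left
  obtain ⟨I', hI', hII'⟩ := hI.exists_measurable hnull hBW.isScaledBM_right t
  obtain ⟨J', hJ', hJJ'⟩ := hJ.exists_measurable hnull hBW.isScaledBM_left t
  have hmI : condMean σ I ζ t =ᵐ[P] fun ω => flow t (ζ - σ • I' ω) := by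
    filter_upwards [hII'] with ω h
    rw [condMean, h]
  have hNJ : (fun ω => flow t (√(a - σ ^ 2) • J t ω)) =ᵐ[P]
      fun ω => flow t (√(a - σ ^ 2) • J' ω) := by
    filter_upwards [hJJ'] with ω h
    rw [h]
  have h1 : Measurable[observed W t] fun ω => ζ - σ • I' ω :=
    (hI'.fun_const_smul σ).const_sub ζ
  have h2 : Measurable[observed B t] fun ω => √(a - σ ^ 2) • J' ω := hJ'.fun_const_smul _
  have h3 : Measurable[observed B t] fun ω => flow t (√(a - σ ^ 2) • J' ω) :=
    (measurable_flow t).comp h2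
  refine ⟨fun ω => flow t (ζ - σ • I' ω), fun ω => flow t (√(a - σ ^ 2) • J' ω),
    (measurable_flow t).comp h1, h3, ?_, ?_, hmI, ?_⟩
  · refine MemLp.ae_eq hmI ?_
    have h4 := (memLp_const (flow t ζ)).sub ((hI.memLp hnull hBW.isScaledBM_right t).const_smul σ)
      (p := 2) (μ := P)
    refine h4.ae_eq (ae_of_all _ fun ω => ?_)
    rw [condMean_eq]
    rfl
  · exact (hJ.hasLaw hnull hBW.isScaledBM_left h t).congr hNJ.symm
  · filter_upwards [hZ.ae_eq_flow hnull hBW hI₀, flowIntegral_noise_eq hnull hBW hI₀ hJ hI, hII',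
      hJJ'] with ω h1 h2 h3 h4
    rw [h1 t, h2 t, ← flow_add, h3, h4]
    congr 1
    abel

omit [IsProbabilityMeasure P] in
lemma IsBrownianPair.observed_left_le (hBW : IsBrownianPair 𝓕 P B W) (t : ℝ≥0) :
    observed B t ≤ mΩ := observed_le hBW.isScaledBM_left.measurable t

omit [IsProbabilityMeasure P] in
lemma IsBrownianPair.observed_right_le (hBW : IsBrownianPair 𝓕 P B W) (t : ℝ≥0) :
    observed W t ≤ mΩ := observed_le hBW.isScaledBM_right.measurable t

omit [IsProbabilityMeasure P] in
lemma IsBrownianPair.indep_observed (hBW : IsBrownianPair 𝓕 P B W) (t : ℝ≥0) :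
    Indep (observed B t) (observed W t) P :=
  indep_of_indep_of_le_left (indep_of_indep_of_le_right hBW.indep (observed_le_comap t))
    (observed_le_comap t)

lemma IsLangevinSolution.memLp (hnull : ∀ A : Set Ω, P A = 0 → MeasurableSet[𝓕 0] A)
    (hBW : IsBrownianPair 𝓕 P B W) (h : 0 ≤ a - σ ^ 2) {ζ : Plane} {Z : ℝ≥0 → Ω → Plane}
    (hZ : IsLangevinSolution 𝓕 P B W a σ ζ Z) (t : ℝ≥0) : MemLp (Z t) 2 P := by
  obtain ⟨I, hI⟩ := exists_isFlowIntegral hnull hBW.isScaledBM_right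
  obtain ⟨m, N, -, -, hm2, hN2, -, hZ⟩ := hZ.exists_decomposition hnull hBW h hI t
  exact (hm2.add (memLp_two_of_hasLaw_multivariateGaussian hN2)).ae_eq hZ.symm

lemma IsLangevinSolution.condExp_eq (hnull : ∀ A : Set Ω, P A = 0 → MeasurableSet[𝓕 0] A)
    (hBW : IsBrownianPair 𝓕 P B W) (h : 0 ≤ a - σ ^ 2) (hI : IsFlowIntegral 𝓕 P W I) {ζ : Plane}
    {Z : ℝ≥0 → Ω → Plane} (hZ : IsLangevinSolution 𝓕 P B W a σ ζ Z) (t : ℝ≥0) :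
    P[Z t | observed W t] =ᵐ[P] condMean σ I ζ t := by
  obtain ⟨m, N, hm, hN, hm2, hN2, hmI, hZ⟩ := hZ.exists_decomposition hnull hBW h hI t
  have hNL := memLp_two_of_hasLaw_multivariateGaussian hN2
  refine (condExp_add_of_indep (hBW.observed_right_le t) (hBW.observed_left_le t)
    (hBW.indep_observed t) hm.stronglyMeasurable hN.stronglyMeasurable (hm2.integrable one_le_two)
    (hNL.integrable one_le_two) ?_ hZ).trans hmI.symm
  rw [hN2.integral_eq, integral_id_multivariateGaussian]

lemma IsLangevinSolution.condCov_eq (hnull : ∀ A : Set Ω, P A = 0 → MeasurableSet[𝓕 0] A)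
    (hBW : IsBrownianPair 𝓕 P B W) (h : 0 ≤ a - σ ^ 2) {ζ : Plane} {Z : ℝ≥0 → Ω → Plane}
    (hZ : IsLangevinSolution 𝓕 P B W a σ ζ Z) (t : ℝ≥0) (i j : Fin 2) :
    condCov P (observed W t) (Z t) i j =ᵐ[P] fun _ => Cmat a σ t i j := by
  obtain ⟨I, hI⟩ := exists_isFlowIntegral hnull hBW.isScaledBM_right
  obtain ⟨m, N, hm, hN, hm2, hN2, -, hZ⟩ := hZ.exists_decomposition hnull hBW h hI t
  have hNL := memLp_two_of_hasLaw_multivariateGaussian hN2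
  have hev : ∀ i : Fin 2, Measurable fun z : Plane => z i := measurable_plane_eval
  have hN0 : ∀ i, ∫ ω, N ω i ∂P = 0 := fun i => by
    have h1 := hN2.integral_comp (f := fun z : Plane => z i) (hev i).aestronglyMeasurable
    have h2 := integral_id_multivariateGaussian (μ := (0 : Plane)) (S := Cmat a σ t)
    have h3 := (EuclideanSpace.proj (𝕜 := ℝ) (ι := Fin 2) i).integral_comp_comm
      (μ := multivariateGaussian (0 : Plane) (Cmat a σ t)) (φ := fun x => x)
      (IsGaussian.integrable_id)
    rw [h2] at h3
    exact h1.trans (h3.trans (by simp))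
  have hmean : ∀ i, P[fun ω => Z t ω i | observed W t] =ᵐ[P] fun ω => m ω i := fun i => by
    have h1 := MemLp.eval_piLp hm2 i
    have h2 := MemLp.eval_piLp hNL i
    refine condExp_add_of_indep (hBW.observed_right_le t) (hBW.observed_left_le t)
      (hBW.indep_observed t) (N := fun ω => N ω i) ((hev i).comp hm).stronglyMeasurable
      ((hev i).comp hN).stronglyMeasurable (h1.integrable one_le_two)
      (h2.integrable one_le_two) (hN0 i) ?_
    filter_upwards [hZ] with ω hω
    rw [hω]
    rfl
  have hprod : (fun ω => (Z t ω i - (P[fun ω' => Z t ω' i | observed W t]) ω) *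
      (Z t ω j - (P[fun ω' => Z t ω' j | observed W t]) ω)) =ᵐ[P] fun ω => N ω i * N ω j := by
    filter_upwards [hmean i, hmean j, hZ] with ω h1 h2 h3
    rw [h1, h2, h3]
    simp
  have hNN : StronglyMeasurable[observed B t] fun ω => N ω i * N ω j :=
    (((hev i).comp hN).mul ((hev j).comp hN)).stronglyMeasurable
  refine (condExp_congr_ae hprod).trans ((condExp_indep_eq (hBW.observed_left_le t)
    (hBW.observed_right_le t) hNN (hBW.indep_observed t)).trans (ae_of_all _ fun _ => ?_))
  have h1 := covariance_eval_multivariateGaussian (μ := (0 : Plane))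
    (Cmat_posSemidef h t.coe_nonneg) i j
  rw [← h1, ← hN2.covariance_fun_comp (hev i).aemeasurable (hev j).aemeasurable, covariance]
  simp [hN0]

lemma IsLangevinSolution.isCondLaw (hnull : ∀ A : Set Ω, P A = 0 → MeasurableSet[𝓕 0] A)
    (hBW : IsBrownianPair 𝓕 P B W) (h : 0 ≤ a - σ ^ 2) (hI : IsFlowIntegral 𝓕 P W I) {ζ : Plane}
    {Z : ℝ≥0 → Ω → Plane} (hZ : IsLangevinSolution 𝓕 P B W a σ ζ Z) (t : ℝ≥0) :
    IsCondLaw P (observed W t) (Z t)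
      (fun ω => multivariateGaussian (condMean σ I ζ t ω) (Cmat a σ t)) := by
  obtain ⟨m, N, hm, hN, hm2, hN2, hmI, hZ⟩ := hZ.exists_decomposition hnull hBW h hI t
  refine (isCondLaw_add_of_indep (hBW.observed_right_le t) (hBW.observed_left_le t)
    (hBW.indep_observed t) hm hN hN2 hZ).congr ?_
  filter_upwards [hmI] with ω hω
  rw [hω, multivariateGaussian_eq_map_const_add (m ω)]

/-- The degenerate case `σ = √a`. -/
lemma multivariateGaussian_zero_matrix (m : Plane) :
    multivariateGaussian m (0 : Matrix (Fin 2) (Fin 2) ℝ) = Measure.dirac m := by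
  simp [multivariateGaussian, CFC.sqrt_zero]

lemma exists_isItoIntegral_sub (hnull : ∀ A : Set Ω, P A = 0 → MeasurableSet[𝓕 0] A)
    (hX : IsScaledBM 𝓕 P X c) (t : ℝ≥0) :
    ∃ K, IsItoIntegral 𝓕 P X (fun s _ => (t : ℝ) - s) 0 t K := by
  refine ⟨affineVersion X t (-1) 0, ?_⟩
  simpa [sub_eq_add_neg] using isItoIntegral_affine hnull hX (t : ℝ) (-1) (zero_le (a := t))

/-- The conditional mean in coordinates. -/
lemma condMean_ae_eq (hnull : ∀ A : Set Ω, P A = 0 → MeasurableSet[𝓕 0] A)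
    (hBW : IsBrownianPair 𝓕 P B W) (hI : IsFlowIntegral 𝓕 P W I) (ζ : Plane) {t : ℝ≥0}
    {K : ℝ≥0 → Ω → ℝ} (hK : IsItoIntegral 𝓕 P W (fun s _ => (t : ℝ) - s) 0 t K) :
    ∀ᵐ ω ∂P, condMean σ I ζ t ω = !₂[ζ 0 + t * ζ 1 - σ * K t ω, ζ 1 - σ * W t ω] := by
  have hK' : IsItoIntegral 𝓕 P W (fun s _ => (t : ℝ) + -1 * s) 0 t K := by
    simpa [sub_eq_add_neg] using hK
  filter_upwards [hI.ae_eq hnull hBW.isScaledBM_right,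
    hK'.ae_eq_affineIntegral hnull hBW.isScaledBM_right zero_le,
    hBW.brownian_right.eval_zero_ae_eq_zero] with ω h1 h2 h3
  refine plane_ext ?_ ?_
  · simp only [condMean, flow_fst, PiLp.sub_apply, PiLp.smul_apply, smul_eq_mul, (h1 t).1,
      (h1 t).2, h2 t ⟨zero_le, le_rfl⟩, affineIntegral, h3]
    simp
    ring
  · simp only [condMean, flow_snd, PiLp.sub_apply, PiLp.smul_apply, smul_eq_mul, (h1 t).2, h3]
    simp

end Filter

/-! ### The Gaussian density on the plane -/

lemma measurePreserving_toPlane :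
    MeasurePreserving (fun p : ℝ × ℝ => (!₂[p.1, p.2] : Plane)) volume volume :=
  (PiLp.volume_preserving_toLp (Fin 2)).comp (volume_preserving_finTwoArrow ℝ).symm

/-- The flow has determinant one. -/
lemma measurePreserving_flow (t : ℝ) : MeasurePreserving (flow t) volume volume := by
  refine ⟨measurable_flow t, ?_⟩
  let b := PiLp.basisFun 2 ℝ (Fin 2)
  have h1 : flow t = Matrix.toLin b b !![1, t; 0, 1] := by
    funext z
    rw [flow, exp_smul_kinMat, act, ← Matrix.toLpLin_eq_toLin]
    rfl
  have h2 : LinearMap.det (Matrix.toLin b b !![1, t; 0, 1]) = 1 := by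
    rw [LinearMap.det_toLin]
    simp [Matrix.det_fin_two]
  rw [h1, Measure.map_linearMap_addHaar_eq_smul_addHaar volume (by rw [h2]; exact one_ne_zero), h2]
  simp

lemma _root_.MeasureTheory.MeasurePreserving.map_withDensity {α β : Type*} [MeasurableSpace α]
    [MeasurableSpace β] {μ : Measure α} {ν : Measure β} {g : α → β} (hg : MeasurePreserving g μ ν)
    {f : β → ℝ≥0∞} (hf : Measurable f) :
    (μ.withDensity fun a => f (g a)).map g = ν.withDensity f := by
  ext s hs
  rw [Measure.map_apply hg.measurable hs, withDensity_apply _ (hg.measurable hs),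
    withDensity_apply _ hs, hg.setLIntegral_comp_preimage hs hf]

/-- The linear image `(g₁, g₂) ↦ e^{(t/2)B} (√(c t³ / 12) g₁, √(c t) g₂)`, `c = a - σ²`, which
carries the standard Gaussian law to the centred Gaussian law with covariance `C_t`. -/
def gaussMap (a σ t : ℝ) (g : ℝ × ℝ) : Plane :=
  flow (t / 2) !₂[√((a - σ ^ 2) * t ^ 3 / 12) * g.1, √((a - σ ^ 2) * t) * g.2]

lemma continuous_gaussMap {α : Type*} [TopologicalSpace α] (a σ : ℝ) {f : α → ℝ} {g : α → ℝ × ℝ}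
    (hf : Continuous f) (hg : Continuous g) : Continuous fun x => gaussMap a σ (f x) (g x) := by
  unfold gaussMap
  refine continuous_flow (by fun_prop) (continuous_plane fun i => ?_)
  fin_cases i
  · simp only [Fin.zero_eta, Matrix.cons_val_zero]
    fun_prop
  · simp only [Fin.mk_one, Matrix.cons_val_one, Matrix.cons_val_fin_one]
    fun_prop

lemma measurable_gaussMap (a σ t : ℝ) : Measurable (gaussMap a σ t) :=
  (continuous_gaussMap a σ continuous_const continuous_id).measurable

/-- The standard Gaussian law on `ℝ × ℝ`. -/
abbrev stdPair : Measure (ℝ × ℝ) := (gaussianReal 0 1).prod (gaussianReal 0 1)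

/-- The proof compares characteristic functions; there the two components of the map give the square
completion of the quadratic form of `C_t`. -/
lemma map_gaussMap_eq_multivariateGaussian {a σ t : ℝ} (h : 0 ≤ a - σ ^ 2) (ht : 0 ≤ t) :
    stdPair.map (gaussMap a σ t) = multivariateGaussian 0 (Cmat a σ t) := by
  have := Measure.isProbabilityMeasure_map (μ := stdPair) (measurable_gaussMap a σ t).aemeasurable
  apply Measure.ext_of_charFun
  ext u
  rw [charFun_multivariateGaussian (Cmat_posSemidef h ht), charFun_apply,
    integral_map (measurable_gaussMap a σ t).aemeasurable (by fun_prop)]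
  set k₁ := √((a - σ ^ 2) * t ^ 3 / 12) with hk₁
  set k₂ := √((a - σ ^ 2) * t) with hk₂
  have h1 : k₁ ^ 2 = (a - σ ^ 2) * t ^ 3 / 12 := Real.sq_sqrt (by positivity)
  have h2 : k₂ ^ 2 = (a - σ ^ 2) * t := Real.sq_sqrt (by positivity)
  have e : ∀ g : ℝ × ℝ, Complex.exp (inner ℝ (gaussMap a σ t g) u * Complex.I) =
      Complex.exp ((k₁ * u 0 : ℝ) * g.1 * Complex.I) *
        Complex.exp ((k₂ * (u 0 * t / 2 + u 1) : ℝ) * g.2 * Complex.I) := fun g => by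
    rw [← Complex.exp_add, inner_plane, gaussMap, flow_fst, flow_snd]
    congr 1
    simp only [Matrix.cons_val_zero, Matrix.cons_val_one,
      Matrix.cons_val_fin_one, ← hk₁, ← hk₂]
    push_cast
    ring
  simp only [e]
  rw [integral_prod_mul (fun x : ℝ => Complex.exp ((k₁ * u 0 : ℝ) * x * Complex.I))
    (fun x : ℝ => Complex.exp ((k₂ * (u 0 * t / 2 + u 1) : ℝ) * x * Complex.I)),
    ← charFun_apply_real, ← charFun_apply_real, charFun_gaussianReal, charFun_gaussianReal,
    ← Complex.exp_add]
  congr 1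
  rw [inner_zero_right, Cmat_eq]
  simp only [Matrix.mulVec, dotProduct, Fin.sum_univ_two, Matrix.of_apply, Matrix.cons_val',
    Matrix.cons_val_zero, Matrix.cons_val_one, Matrix.cons_val_fin_one, Complex.ofReal_zero,
    mul_zero, zero_mul, zero_sub, NNReal.coe_one, Complex.ofReal_one, one_mul]
  rw [← neg_add, neg_inj, ← add_div]
  congr 1
  norm_cast
  rw [mul_pow, mul_pow, h1, h2]
  ring

lemma measurable_Gam0 (a σ t : ℝ) : Measurable (Gam0 a σ t) := by
  have h := measurable_plane_eval
  have h0 := h 0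
  have h1 := h 1
  unfold Gam0
  fun_prop

/-- The flow preserves volume, so the density is the product of two one-dimensional Gaussian densities,
evaluated at `e^{-(t/2)B} y`. -/
lemma map_gaussMap_eq_withDensity {a σ t : ℝ} (h : 0 < a - σ ^ 2) (ht : 0 < t) :
    stdPair.map (gaussMap a σ t) =
      volume.withDensity fun y => ENNReal.ofReal (Gam0 a σ t y) := by
  set v₁ : ℝ≥0 := ⟨(a - σ ^ 2) * t ^ 3 / 12, by positivity⟩ with hv₁
  set v₂ : ℝ≥0 := ⟨(a - σ ^ 2) * t, by positivity⟩ with hv₂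
  have hv₁0 : v₁ ≠ 0 := fun h0 => by
    have : (a - σ ^ 2) * t ^ 3 / 12 = 0 := congrArg NNReal.toReal h0
    exact (by positivity : (a - σ ^ 2) * t ^ 3 / 12 ≠ 0) this
  have hv₂0 : v₂ ≠ 0 := fun h0 => by
    have : (a - σ ^ 2) * t = 0 := congrArg NNReal.toReal h0
    exact (by positivity : (a - σ ^ 2) * t ≠ 0) this
  let F : ℝ × ℝ → Plane := fun p => flow (t / 2) !₂[p.1, p.2]
  have hF : MeasurePreserving F volume volume :=
    (measurePreserving_flow (t / 2)).comp measurePreserving_toPlane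
  have hstd : ∀ {v : ℝ≥0}, (gaussianReal 0 1).map (fun x => √v * x) = gaussianReal 0 v :=
    fun {v} => by
      rw [gaussianReal_map_const_mul, mul_zero, mul_one]
      congr 1
      exact NNReal.coe_injective (Real.sq_sqrt v.coe_nonneg)
  have h1 : gaussMap a σ t = F ∘ Prod.map (fun x => √(v₁ : ℝ) * x) (fun x => √(v₂ : ℝ) * x) := rfl
  rw [h1, ← Measure.map_map hF.measurable (by fun_prop), ← Measure.map_prod_map _ _ (by fun_prop)
    (by fun_prop), hstd, hstd, gaussianReal_of_var_ne_zero _ hv₁0, gaussianReal_of_var_ne_zero _ hv₂0,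
    prod_withDensity (measurable_gaussianPDF _ _) (measurable_gaussianPDF _ _),
    ← hF.map_withDensity (measurable_Gam0 a σ t).ennreal_ofReal]
  congr 2
  funext p
  rw [gaussianPDF, gaussianPDF, ← ENNReal.ofReal_mul (gaussianPDFReal_nonneg _ _ _)]
  congr 1
  have hc₁ : (v₁ : ℝ) = (a - σ ^ 2) * t ^ 3 / 12 := rfl
  have hc₂ : (v₂ : ℝ) = (a - σ ^ 2) * t := rfl
  have e : (√(2 * Real.pi * v₁))⁻¹ * (√(2 * Real.pi * v₂))⁻¹ =
      √3 / (Real.pi * t ^ 2 * (a - σ ^ 2)) := by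
    rw [← mul_inv, ← Real.sqrt_mul (by positivity), hc₁, hc₂,
      show 2 * Real.pi * ((a - σ ^ 2) * t ^ 3 / 12) * (2 * Real.pi * ((a - σ ^ 2) * t)) =
        (Real.pi * t ^ 2 * (a - σ ^ 2)) ^ 2 / 3 by ring, Real.sqrt_div (by positivity),
      Real.sqrt_sq (by positivity), inv_div]
  rw [gaussianPDFReal, gaussianPDFReal, mul_mul_mul_comm, e, ← Real.exp_add, Gam0]
  congr 2
  simp only [F, flow_fst, flow_snd, Matrix.cons_val_zero, Matrix.cons_val_one,
      Matrix.cons_val_fin_one, hc₁, hc₂]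
  field_simp
  ring

lemma Gam0_nonneg {a σ t : ℝ} (h : 0 ≤ a - σ ^ 2) (y : Plane) : 0 ≤ Gam0 a σ t y := by
  unfold Gam0
  positivity

lemma multivariateGaussian_eq_withDensity {a σ t : ℝ} (h : 0 < a - σ ^ 2) (ht : 0 < t)
    (m : Plane) : multivariateGaussian m (Cmat a σ t) =
      volume.withDensity fun z => ENNReal.ofReal (Gam0 a σ t (z - m)) := by
  have hm : MeasurePreserving (fun x : Plane => m + x) volume volume :=
    measurePreserving_add_left volume m
  have hg : Measurable fun z : Plane => ENNReal.ofReal (Gam0 a σ t (z - m)) :=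
    ((measurable_Gam0 a σ t).comp (measurable_id.sub_const m)).ennreal_ofReal
  rw [multivariateGaussian_eq_map_const_add, ← map_gaussMap_eq_multivariateGaussian h.le ht.le,
    map_gaussMap_eq_withDensity h ht, ← hm.map_withDensity hg]
  simp

/-- The explicit kernel integrates a function to its Gaussian mean. -/
lemma integral_Gam0_mul {a σ t : ℝ} (h : 0 < a - σ ^ 2) (ht : 0 < t) {f : Plane → ℝ}
    (hf : Continuous f) :
    ∫ y, Gam0 a σ t y * f y = ∫ g, f (gaussMap a σ t g) ∂stdPair := by
  rw [← integral_map (measurable_gaussMap a σ t).aemeasurable hf.aestronglyMeasurable,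
    map_gaussMap_eq_withDensity h ht, integral_withDensity_eq_integral_toReal_smul
    (measurable_Gam0 a σ t).ennreal_ofReal (ae_of_all _ fun _ => ENNReal.ofReal_lt_top)]
  refine integral_congr_ae (ae_of_all _ fun y => ?_)
  simp only [ENNReal.toReal_ofReal (Gam0_nonneg h.le y), smul_eq_mul]

lemma flow_flow (s t : ℝ) (z : Plane) : flow s (flow t z) = flow (s + t) z :=
  plane_ext (by simp; ring) (by simp)

lemma flow_zero (z : Plane) : flow 0 z = z := plane_ext (by simp) (by simp)

/-- The integral of a function against the random kernel, in the pole variable, as a Gaussian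
mean. -/
lemma integral_Gam_mul {a σ : ℝ} (h : 0 < a - σ ^ 2) (I : ℝ≥0 → Ω → Plane) {t : ℝ≥0} (ht : 0 < t)
    (z : Plane) (ω : Ω) {φ : Plane → ℝ} (hφ : Continuous φ) :
    ∫ ζ, Gam a σ I t z ζ ω * φ ζ =
      ∫ g, φ (flow (-t) (z - gaussMap a σ t g) + σ • I t ω) ∂stdPair := by
  let f : Plane → ℝ := fun y => φ (flow (-t) (z - y) + σ • I t ω)
  have hf : Continuous f :=
    hφ.comp ((continuous_flow continuous_const (by fun_prop)).add continuous_const)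
  rw [← integral_Gam0_mul h (NNReal.coe_pos.2 ht) hf]
  -- the change of variables `y = z - m_t(ζ)` preserves the volume
  let S : Plane → Plane := fun ζ => z - flow t (ζ - σ • I t ω)
  have hS : MeasurePreserving S volume volume :=
    (Measure.measurePreserving_sub_left volume z).comp
      ((measurePreserving_flow t).comp (measurePreserving_sub_right volume _))
  have hSe : MeasurableEmbedding S := by
    refine (Continuous.measurableEmbedding ?_ ?_)
    · exact continuous_const.sub (continuous_flow continuous_const (by fun_prop))
    · intro x y hxy
      have h1 := congrArg (flow (-t)) (sub_right_injective hxy)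
      simpa [flow_flow, flow_zero] using h1
  rw [← hS.integral_comp hSe (fun y => Gam0 a σ t y * f y)]
  refine integral_congr_ae (ae_of_all _ fun ζ => ?_)
  simp only [S, f]
  rw [Gam_eq_Gam0 h I ht, condMean, sub_sub_cancel, flow_flow, neg_add_cancel, flow_zero,
    sub_add_cancel]

/-- The random kernel is an approximate identity as `t → 0`, on every path along which the flow
integral tends to zero. -/
lemma tendsto_integral_Gam {a σ : ℝ} (h : 0 < a - σ ^ 2) (I : ℝ≥0 → Ω → Plane) {ω : Ω}
    (hc : Continuous fun t => I t ω) (h0 : I 0 ω = 0) (φ : BoundedContinuousFunction Plane ℝ)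
    (z₀ : Plane) :
    Tendsto (fun p : ℝ≥0 × Plane => ∫ ζ, Gam a σ I p.1 p.2 ζ ω * φ ζ) (𝓝[>] 0 ×ˢ 𝓝 z₀)
      (𝓝 (φ z₀)) := by
  have hlim : Tendsto (fun p : ℝ≥0 × Plane =>
      ∫ g, φ (flow (-p.1) (p.2 - gaussMap a σ p.1 g) + σ • I p.1 ω) ∂stdPair) (𝓝[>] 0 ×ˢ 𝓝 z₀)
      (𝓝 (∫ g, φ z₀ ∂stdPair)) := by
    have hcont : ∀ g, Continuous fun p : ℝ≥0 × Plane =>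
        φ (flow (-p.1) (p.2 - gaussMap a σ p.1 g) + σ • I p.1 ω) := fun g => by
      have h1 : Continuous fun p : ℝ≥0 × Plane => gaussMap a σ p.1 g :=
        continuous_gaussMap a σ (NNReal.continuous_coe.comp continuous_fst) continuous_const
      have h2 : Continuous fun p : ℝ≥0 × Plane => -(p.1 : ℝ) :=
        (NNReal.continuous_coe.comp continuous_fst).neg
      have h3 : Continuous fun p : ℝ≥0 × Plane => flow (-p.1) (p.2 - gaussMap a σ p.1 g) :=
        continuous_flow h2 (continuous_snd.sub h1)
      have h4 : Continuous fun p : ℝ≥0 × Plane => σ • I p.1 ω :=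
        (hc.comp continuous_fst).const_smul σ
      exact φ.continuous.comp (h3.add h4)
    refine tendsto_integral_filter_of_dominated_convergence (fun _ => ‖φ‖)
      (Eventually.of_forall fun p => ?_) (Eventually.of_forall fun p => ae_of_all _ fun g =>
        φ.norm_coe_le_norm _) (integrable_const _) (ae_of_all _ fun g => ?_)
    · have h1 : Measurable fun g => p.2 - gaussMap a σ p.1 g :=
        (measurable_gaussMap a σ p.1).const_sub p.2
      have h2 : Measurable fun g => flow (-p.1) (p.2 - gaussMap a σ p.1 g) :=
        (measurable_flow (-p.1)).comp h1
      exact (φ.continuous.measurable.comp (h2.add_const _)).aestronglyMeasurable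
    · have h1 := (hcont g).tendsto (0, z₀)
      have h2 : flow (-((0 : ℝ≥0) : ℝ)) (z₀ - gaussMap a σ ((0 : ℝ≥0) : ℝ) g) + σ • I 0 ω = z₀ := by
        have h3 : gaussMap a σ ((0 : ℝ≥0) : ℝ) g = 0 := by
          refine plane_ext ?_ ?_ <;> simp [gaussMap]
        rw [h3, h0, NNReal.coe_zero, neg_zero, flow_zero, smul_zero, sub_zero, add_zero]
      simp only [h2] at h1
      refine h1.mono_left ?_
      rw [nhds_prod_eq]
      exact Filter.prod_mono nhdsWithin_le_nhds le_rfl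
  rw [integral_const, probReal_univ, one_smul] at hlim
  refine hlim.congr' ?_
  have h1 : ∀ᶠ t in 𝓝[>] (0 : ℝ≥0), 0 < t := eventually_mem_nhdsWithin
  filter_upwards [h1.prod_inl (𝓝 z₀)] with p hp
  exact (integral_Gam_mul h I hp p.2 ω φ.continuous).symm

/-! ### Derivatives of the explicit kernel -/

/-- Up to the factor `-2 / (a - σ²)`, the logarithmic derivative `∂_v log Γ₀`. -/
def slopeV (t : ℝ) (y : Plane) : ℝ := 2 * y 1 / t - 3 * y 0 / t ^ 2

/-- Up to the factor `-2 / (a - σ²)`, the logarithmic derivative `∂_x log Γ₀`. -/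
def slopeX (t : ℝ) (y : Plane) : ℝ := 6 * y 0 / t ^ 3 - 3 * y 1 / t ^ 2

/-- The derivative `∂_x Γ₀`. -/
def Gam0x (a σ t : ℝ) (y : Plane) : ℝ := -(2 / (a - σ ^ 2) * slopeX t y) * Gam0 a σ t y

/-- The derivative `∂_v Γ₀`. -/
def Gam0v (a σ t : ℝ) (y : Plane) : ℝ := -(2 / (a - σ ^ 2) * slopeV t y) * Gam0 a σ t y

/-- The derivative `∂_vv Γ₀`. -/
def Gam0vv (a σ t : ℝ) (y : Plane) : ℝ :=
  ((2 / (a - σ ^ 2) * slopeV t y) ^ 2 - 2 / (a - σ ^ 2) * (2 / t)) * Gam0 a σ t y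

/-- The derivative `∂_vvv Γ₀`. -/
def Gam0vvv (a σ t : ℝ) (y : Plane) : ℝ :=
  (6 * (2 / (a - σ ^ 2)) ^ 2 * slopeV t y / t - (2 / (a - σ ^ 2) * slopeV t y) ^ 3) *
    Gam0 a σ t y

variable {a σ t : ℝ}

lemma hasDerivAt_slopeV (x v : ℝ) :
    HasDerivAt (fun v => slopeV t !₂[x, v]) (2 / t) v := by
  have h := ((hasDerivAt_id v).const_mul 2).div_const t |>.sub_const (3 * x / t ^ 2)
  simpa [slopeV] using h

lemma hasDerivAt_Gam0 (x v : ℝ) :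
    HasDerivAt (fun v => Gam0 a σ t !₂[x, v]) (Gam0v a σ t !₂[x, v]) v := by
  have h1 : HasDerivAt (fun v : ℝ => v ^ 2 / t - 3 * v * x / t ^ 2 + 3 * x ^ 2 / t ^ 3)
      (2 * v / t - 3 * x / t ^ 2) v := by
    have h2 := (((hasDerivAt_pow 2 v).div_const t).sub
      ((((hasDerivAt_id v).const_mul 3).mul_const x).div_const (t ^ 2))).add_const
        (3 * x ^ 2 / t ^ 3)
    simpa using h2
  have h3 := ((h1.const_mul (-(2 / (a - σ ^ 2)))).exp).const_mul
    (√3 / (Real.pi * t ^ 2 * (a - σ ^ 2)))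
  have e : Gam0v a σ t !₂[x, v] = √3 / (Real.pi * t ^ 2 * (a - σ ^ 2)) *
      (Real.exp (-(2 / (a - σ ^ 2)) * (v ^ 2 / t - 3 * v * x / t ^ 2 + 3 * x ^ 2 / t ^ 3)) *
        (-(2 / (a - σ ^ 2)) * (2 * v / t - 3 * x / t ^ 2))) := by
    simp only [Gam0v, Gam0, slopeV, Matrix.cons_val_zero, Matrix.cons_val_one,
      Matrix.cons_val_fin_one]
    ring
  rw [e]
  exact h3

lemma hasDerivAt_Gam0v (x v : ℝ) :
    HasDerivAt (fun v => Gam0v a σ t !₂[x, v]) (Gam0vv a σ t !₂[x, v]) v := by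
  have h := ((hasDerivAt_slopeV (t := t) x v).const_mul (2 / (a - σ ^ 2))).neg.mul
    (hasDerivAt_Gam0 (a := a) (σ := σ) (t := t) x v)
  refine h.congr_deriv ?_
  simp only [Gam0vv, Gam0v, Pi.neg_apply]
  ring

lemma hasDerivAt_Gam0vv (x v : ℝ) :
    HasDerivAt (fun v => Gam0vv a σ t !₂[x, v]) (Gam0vvv a σ t !₂[x, v]) v := by
  have h := ((((hasDerivAt_slopeV (t := t) x v).const_mul (2 / (a - σ ^ 2))).pow 2).sub_const
    (2 / (a - σ ^ 2) * (2 / t))).mul (hasDerivAt_Gam0 (a := a) (σ := σ) (t := t) x v)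
  refine h.congr_deriv ?_
  simp only [Gam0vvv, Gam0v, Pi.pow_apply]
  push_cast
  ring

lemma hasDerivAt_Gam0_fst (x v : ℝ) :
    HasDerivAt (fun x => Gam0 a σ t !₂[x, v]) (Gam0x a σ t !₂[x, v]) x := by
  have h1 : HasDerivAt (fun x : ℝ => v ^ 2 / t - 3 * v * x / t ^ 2 + 3 * x ^ 2 / t ^ 3)
      (6 * x / t ^ 3 - 3 * v / t ^ 2) x := by
    have h2 := ((((hasDerivAt_id x).const_mul (3 * v)).div_const (t ^ 2)).const_sub
      (v ^ 2 / t)).add (((hasDerivAt_pow 2 x).const_mul 3).div_const (t ^ 3))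
    refine h2.congr_deriv ?_
    push_cast
    ring
  have h3 := ((h1.const_mul (-(2 / (a - σ ^ 2)))).exp).const_mul
    (√3 / (Real.pi * t ^ 2 * (a - σ ^ 2)))
  have e : Gam0x a σ t !₂[x, v] = √3 / (Real.pi * t ^ 2 * (a - σ ^ 2)) *
      (Real.exp (-(2 / (a - σ ^ 2)) * (v ^ 2 / t - 3 * v * x / t ^ 2 + 3 * x ^ 2 / t ^ 3)) *
        (-(2 / (a - σ ^ 2)) * (6 * x / t ^ 3 - 3 * v / t ^ 2))) := by
    simp only [Gam0x, Gam0, slopeX, Matrix.cons_val_zero, Matrix.cons_val_one,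
      Matrix.cons_val_fin_one]
    ring
  rw [e]
  exact h3

/-- The deterministic Kolmogorov equation, along the integral curves of the transport field. -/
lemma hasDerivAt_Gam0_flow (h : 0 < a - σ ^ 2) (ht : 0 < t) (y : Plane) :
    HasDerivAt (fun s => Gam0 a σ s (flow s y))
      ((a - σ ^ 2) / 2 * Gam0vv a σ t (flow t y)) t := by
  set c := a - σ ^ 2 with hc
  set k := 2 / c with hk
  -- as a function of `r = 1 / s` the kernel is `r ^ 2` times the exponential of a polynomial
  let F : ℝ → ℝ := fun r => √3 / (Real.pi * c) * (r ^ 2 *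
    Real.exp (-k * (y 1 ^ 2 * r + 3 * y 1 * y 0 * r ^ 2 + 3 * y 0 ^ 2 * r ^ 3)))
  have hF : ∀ r, HasDerivAt F (√3 / (Real.pi * c) * (2 * r * Real.exp (-k * (y 1 ^ 2 * r +
      3 * y 1 * y 0 * r ^ 2 + 3 * y 0 ^ 2 * r ^ 3)) + r ^ 2 * (Real.exp (-k * (y 1 ^ 2 * r +
      3 * y 1 * y 0 * r ^ 2 + 3 * y 0 ^ 2 * r ^ 3)) * (-k * (y 1 ^ 2 + 3 * y 1 * y 0 * (2 * r) +
      3 * y 0 ^ 2 * (3 * r ^ 2)))))) r := fun r => by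
    have h1 := (((hasDerivAt_id r).const_mul (y 1 ^ 2)).add
      ((hasDerivAt_pow 2 r).const_mul (3 * y 1 * y 0))).add
      ((hasDerivAt_pow 3 r).const_mul (3 * y 0 ^ 2))
    have h2 := ((hasDerivAt_pow 2 r).mul (h1.const_mul (-k)).exp).const_mul (√3 / (Real.pi * c))
    simpa [F] using h2
  have e : ∀ s : ℝ, s ≠ 0 → F s⁻¹ = Gam0 a σ s (flow s y) := fun s hs => by
    simp only [F, Gam0, flow_fst, flow_snd, ← hc, ← hk]
    rw [← mul_assoc]
    congr 1
    · field_simp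
    · congr 2
      field_simp
      ring
  have h1 : HasDerivAt (fun s => F s⁻¹) _ t := (hF t⁻¹).comp t (hasDerivAt_inv ht.ne')
  have h2 : (fun s => Gam0 a σ s (flow s y)) =ᶠ[𝓝 t] fun s => F s⁻¹ := by
    filter_upwards [eventually_ne_nhds ht.ne'] with s hs
    exact (e s hs).symm
  refine (h1.congr_of_eventuallyEq h2).congr_deriv ?_
  rw [Gam0vv, ← e t ht.ne']
  simp only [F, slopeV, flow_fst, flow_snd, ← hc, ← hk]
  set E := Real.exp (-k * (y 1 ^ 2 * t⁻¹ + 3 * y 1 * y 0 * t⁻¹ ^ 2 + 3 * y 0 ^ 2 * t⁻¹ ^ 3))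
  have hk' : c = 2 / k := by rw [hk]; field_simp
  have hk0 : k ≠ 0 := by rw [hk]; positivity
  rw [hk']
  field_simp
  ring

lemma pow_two_add_one_mul_exp_neg_le {E : ℝ} (hE : 0 ≤ E) : (1 + E ^ 2) * Real.exp (-E) ≤ 3 := by
  have h := Real.quadratic_le_exp_of_nonneg hE
  rw [Real.exp_neg, ← div_eq_mul_inv, div_le_iff₀ (Real.exp_pos E)]
  nlinarith

/-- The exponent of the kernel dominates the squares of the logarithmic derivatives. -/
lemma slope_sq_le (ht : 0 < t) (y : Plane) :
    slopeV t y ^ 2 ≤ 4 / t * (y 1 ^ 2 / t - 3 * y 1 * y 0 / t ^ 2 + 3 * y 0 ^ 2 / t ^ 3) ∧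
    slopeX t y ^ 2 ≤ 12 / t ^ 3 * (y 1 ^ 2 / t - 3 * y 1 * y 0 / t ^ 2 + 3 * y 0 ^ 2 / t ^ 3) := by
  constructor
  · have : 4 / t * (y 1 ^ 2 / t - 3 * y 1 * y 0 / t ^ 2 + 3 * y 0 ^ 2 / t ^ 3) -
        slopeV t y ^ 2 = 3 * (y 0 / t ^ 2) ^ 2 := by
      simp only [slopeV]; field_simp; ring
    linarith [sq_nonneg (y 0 / t ^ 2)]
  · have : 12 / t ^ 3 * (y 1 ^ 2 / t - 3 * y 1 * y 0 / t ^ 2 + 3 * y 0 ^ 2 / t ^ 3) -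
        slopeX t y ^ 2 = 3 * (y 1 / t ^ 2) ^ 2 := by
      simp only [slopeX]; field_simp; ring
    linarith [sq_nonneg (y 1 / t ^ 2)]

/-- All powers of `s` up to the third are controlled by `1 + E ^ 2`, which the factor `exp (-E)` of the
kernel absorbs. -/
lemma abs_pow_le_of_sq_le {s L E : ℝ} (hL : 0 ≤ L) (h : s ^ 2 ≤ L * E) :
    |s| ≤ (1 + L) * (1 + E ^ 2) ∧ s ^ 2 ≤ L * (1 + E ^ 2) ∧
      |s| ^ 3 ≤ (L + L ^ 2) * (1 + E ^ 2) := by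
  have hEU : E ≤ 1 + E ^ 2 := by nlinarith [sq_nonneg (E - 1)]
  have h2 : s ^ 2 ≤ L * (1 + E ^ 2) := h.trans (by gcongr)
  have habs : |s| ≤ 1 + s ^ 2 := by
    rw [← sq_abs]; nlinarith [sq_nonneg (|s| - 1), abs_nonneg s]
  refine ⟨habs.trans (by nlinarith [sq_nonneg E]), h2, ?_⟩
  have h4 : (s ^ 2) ^ 2 ≤ L ^ 2 * (1 + E ^ 2) := by
    refine (pow_le_pow_left₀ (sq_nonneg _) h 2).trans ?_
    rw [mul_pow]
    linarith [sq_nonneg L]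
  calc |s| ^ 3 = s ^ 2 * |s| := by rw [← sq_abs]; ring
    _ ≤ s ^ 2 * (1 + s ^ 2) := mul_le_mul_of_nonneg_left habs (sq_nonneg s)
    _ = s ^ 2 + (s ^ 2) ^ 2 := by ring
    _ ≤ _ := by linarith

/-- The derivatives of the kernel are bounded away from the pole. -/
lemma exists_bound_derivs (h : 0 < a - σ ^ 2) {t₀ : ℝ} (ht₀ : 0 < t₀) :
    ∃ M : ℝ, 0 ≤ M ∧ ∀ t, t₀ ≤ t → ∀ y, |Gam0x a σ t y| ≤ M ∧ |Gam0v a σ t y| ≤ M ∧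
      |Gam0vv a σ t y| ≤ M ∧ |Gam0vvv a σ t y| ≤ M := by
  -- `A` bounds the prefactor of the kernel, `L` and `L'` are the constants in `slope_sq_le`
  -- relative to the exponent `E`
  set k := 2 / (a - σ ^ 2) with hk
  have hk0 : 0 < k := by positivity
  set A := √3 / (Real.pi * t₀ ^ 2 * (a - σ ^ 2)) with hA
  set L := 4 / (t₀ * k) with hL
  set L' := 12 / (t₀ ^ 3 * k) with hL'
  have hL0 : 0 < L := by positivity
  have hL'0 : 0 < L' := by positivity
  have hA0 : 0 < A := by positivity
  set Cx := k * (1 + L') with hCx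
  set Cv := k * (1 + L) with hCv
  set Cvv := k ^ 2 * L + k * (2 / t₀) with hCvv
  set Cvvv := 6 * k ^ 2 * (1 + L) / t₀ + k ^ 3 * (L + L ^ 2) with hCvvv
  have hCx0 : 0 < Cx := by positivity
  have hCv0 : 0 < Cv := by positivity
  have hCvv0 : 0 < Cvv := by positivity
  have hCvvv0 : 0 < Cvvv := by positivity
  refine ⟨(Cx + Cv + Cvv + Cvvv) * (A * 3), by positivity, fun t ht y => ?_⟩
  have ht' : 0 < t := ht₀.trans_le ht
  set Q := y 1 ^ 2 / t - 3 * y 1 * y 0 / t ^ 2 + 3 * y 0 ^ 2 / t ^ 3 with hQ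
  set E := k * Q with hE
  set U := 1 + E ^ 2 with hU
  obtain ⟨hvQ, hxQ⟩ := slope_sq_le ht' y
  rw [← hQ] at hvQ hxQ
  have hQ0 : 0 ≤ Q :=
    nonneg_of_mul_nonneg_right ((sq_nonneg _).trans hvQ) (by positivity)
  have hE0 : 0 ≤ E := mul_nonneg hk0.le hQ0
  have hv : slopeV t y ^ 2 ≤ L * E := hvQ.trans (by
    rw [hL, hE, show 4 / (t₀ * k) * (k * Q) = 4 / t₀ * Q by field_simp]
    gcongr)
  have hx : slopeX t y ^ 2 ≤ L' * E := hxQ.trans (by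
    rw [hL', hE, show 12 / (t₀ ^ 3 * k) * (k * Q) = 12 / t₀ ^ 3 * Q by field_simp]
    gcongr)
  obtain ⟨hv1, hv2, hv3⟩ := abs_pow_le_of_sq_le hL0.le hv
  obtain ⟨hx1, -, -⟩ := abs_pow_le_of_sq_le hL'0.le hx
  rw [← hU] at hv1 hv2 hv3 hx1
  have hU1 : 1 ≤ U := by rw [hU]; linarith [sq_nonneg E]
  have hG : ∀ {p C : ℝ}, 0 ≤ C → C ≤ Cx + Cv + Cvv + Cvvv → |p| ≤ C * U →
      |p * Gam0 a σ t y| ≤ (Cx + Cv + Cvv + Cvvv) * (A * 3) := fun {p C} hC hC' hp => by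
    rw [abs_mul, abs_of_nonneg (Gam0_nonneg h.le y)]
    have h1 : Gam0 a σ t y ≤ A * Real.exp (-E) := by
      rw [Gam0, ← hk, ← hQ, neg_mul, ← hE, hA]
      gcongr
    calc |p| * Gam0 a σ t y ≤ C * U * (A * Real.exp (-E)) :=
          mul_le_mul hp h1 (Gam0_nonneg h.le y) (by positivity)
      _ = C * (A * (U * Real.exp (-E))) := by ring
      _ ≤ (Cx + Cv + Cvv + Cvvv) * (A * 3) := by
          gcongr
          exact pow_two_add_one_mul_exp_neg_le hE0
  refine ⟨hG hCx0.le (by linarith) ?_, hG hCv0.le (by linarith) ?_, hG hCvv0.le (by linarith) ?_,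
    hG hCvvv0.le (by linarith) ?_⟩
  · rw [abs_neg, abs_mul, abs_of_pos hk0, hCx, mul_assoc]
    gcongr
  · rw [abs_neg, abs_mul, abs_of_pos hk0, hCv, mul_assoc]
    gcongr
  · refine (abs_sub _ _).trans ?_
    rw [abs_of_nonneg (sq_nonneg _), abs_of_pos (by positivity), mul_pow, hCvv, add_mul, mul_assoc]
    refine add_le_add (by gcongr) ?_
    calc k * (2 / t) ≤ k * (2 / t₀) := by gcongr
      _ ≤ k * (2 / t₀) * U := le_mul_of_one_le_right (by positivity) hU1
  · refine (abs_sub _ _).trans ?_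
    rw [abs_div, abs_mul, abs_of_pos ht', abs_of_pos (by positivity), abs_pow, abs_mul,
      abs_of_pos hk0, mul_pow, hCvvv, add_mul, mul_assoc (k ^ 3)]
    gcongr
    calc 6 * k ^ 2 * |slopeV t y| / t ≤ 6 * k ^ 2 * ((1 + L) * U) / t₀ := by gcongr
      _ = _ := by ring

/-! ### Joint continuity of the kernel -/

lemma continuousOn_slopeV : ContinuousOn (fun p : ℝ × Plane => slopeV p.1 p.2) {p | 0 < p.1} := by
  have h : ∀ p ∈ {p : ℝ × Plane | 0 < p.1}, p.1 ≠ 0 := fun p hp => (ne_of_gt hp)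
  have h0 : Continuous fun p : ℝ × Plane => p.2 0 := continuous_plane_apply continuous_snd 0
  have h1 : Continuous fun p : ℝ × Plane => p.2 1 := continuous_plane_apply continuous_snd 1
  exact ((h1.const_mul 2).continuousOn.div continuous_fst.continuousOn h).sub
    ((h0.const_mul 3).continuousOn.div (continuous_fst.pow 2).continuousOn
      fun p hp => pow_ne_zero 2 (h p hp))

lemma continuousOn_Gam0 (h : 0 < a - σ ^ 2) :
    ContinuousOn (fun p : ℝ × Plane => Gam0 a σ p.1 p.2) {p | 0 < p.1} := by
  have h' : ∀ p ∈ {p : ℝ × Plane | 0 < p.1}, p.1 ≠ 0 := fun p hp => (ne_of_gt hp)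
  have h0 : Continuous fun p : ℝ × Plane => p.2 0 := continuous_plane_apply continuous_snd 0
  have h1 : Continuous fun p : ℝ × Plane => p.2 1 := continuous_plane_apply continuous_snd 1
  have hp : ∀ n : ℕ, ContinuousOn (fun p : ℝ × Plane => p.1 ^ n) {p | 0 < p.1} := fun n =>
    (continuous_fst.pow n).continuousOn
  refine (continuousOn_const.div ((continuousOn_const.mul (hp 2)).mul continuousOn_const)
    fun p hp => ?_).mul (Real.continuous_exp.comp_continuousOn (continuousOn_const.mul
    ((((h1.pow 2).continuousOn.div continuous_fst.continuousOn h').sub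
    (((h1.const_mul 3).mul h0).continuousOn.div (hp 2) fun p hp => pow_ne_zero 2 (h' p hp))).add
    (((h0.pow 2).const_mul 3).continuousOn.div (hp 3) fun p hp => pow_ne_zero 3 (h' p hp)))))
  have : (0 : ℝ) < p.1 := hp
  have hpi := Real.pi_pos
  exact (mul_pos (mul_pos hpi (pow_pos this 2)) h).ne'

lemma continuousOn_Gam0v (h : 0 < a - σ ^ 2) :
    ContinuousOn (fun p : ℝ × Plane => Gam0v a σ p.1 p.2) {p | 0 < p.1} :=
  (continuousOn_const.mul continuousOn_slopeV).neg.mul (continuousOn_Gam0 h)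

lemma continuousOn_Gam0vv (h : 0 < a - σ ^ 2) :
    ContinuousOn (fun p : ℝ × Plane => Gam0vv a σ p.1 p.2) {p | 0 < p.1} :=
  (((continuousOn_const.mul continuousOn_slopeV).pow 2).sub (continuousOn_const.mul
    (continuousOn_const.div continuous_fst.continuousOn fun _ hp => ne_of_gt hp))).mul
    (continuousOn_Gam0 h)

section Composition

variable {α : Type*} [TopologicalSpace α] {s : Set α} {f : α → ℝ} {g : α → Plane}

lemma continuousOn_Gam0_comp (h : 0 < a - σ ^ 2) (hf : ContinuousOn f s) (hg : ContinuousOn g s)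
    (hpos : ∀ x ∈ s, 0 < f x) : ContinuousOn (fun x => Gam0 a σ (f x) (g x)) s := by
  have h1 : Set.MapsTo (fun x => (f x, g x)) s {p : ℝ × Plane | 0 < p.1} := fun x hx => hpos x hx
  have h2 := (continuousOn_Gam0 h).comp (hf.prodMk hg) h1
  exact h2

lemma continuousOn_Gam0v_comp (h : 0 < a - σ ^ 2) (hf : ContinuousOn f s) (hg : ContinuousOn g s)
    (hpos : ∀ x ∈ s, 0 < f x) : ContinuousOn (fun x => Gam0v a σ (f x) (g x)) s := by
  have h1 : Set.MapsTo (fun x => (f x, g x)) s {p : ℝ × Plane | 0 < p.1} := fun x hx => hpos x hx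
  have h2 := (continuousOn_Gam0v h).comp (hf.prodMk hg) h1
  exact h2

lemma continuousOn_Gam0vv_comp (h : 0 < a - σ ^ 2) (hf : ContinuousOn f s) (hg : ContinuousOn g s)
    (hpos : ∀ x ∈ s, 0 < f x) : ContinuousOn (fun x => Gam0vv a σ (f x) (g x)) s := by
  have h1 : Set.MapsTo (fun x => (f x, g x)) s {p : ℝ × Plane | 0 < p.1} := fun x hx => hpos x hx
  have h2 := (continuousOn_Gam0vv h).comp (hf.prodMk hg) h1
  exact h2

end Composition

/-! ### Partial derivatives in the velocity -/

lemma dv_comp_sub_const (f : Plane → ℝ) (m z : Plane) : dv (fun y => f (y - m)) z = dv f (z - m) := by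
  have h : ∀ v : ℝ, (!₂[z 0, v] : Plane) - m = !₂[(z - m) 0, v - m 1] := fun v =>
    plane_ext (by simp) (by simp)
  simp only [dv, h]
  rw [deriv_comp_sub_const (f := fun v => f !₂[(z - m) 0, v])]
  rfl

lemma toPlane_eq (z : Plane) : (!₂[z 0, z 1] : Plane) = z := plane_ext (by simp) (by simp)

lemma dv_eq_of_hasDerivAt {f g : Plane → ℝ}
    (h : ∀ x v, HasDerivAt (fun v => f !₂[x, v]) (g !₂[x, v]) v) : dv f = g := by
  funext z
  rw [dv, (h (z 0) (z 1)).deriv, toPlane_eq]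

lemma dv_Gam0 : dv (Gam0 a σ t) = Gam0v a σ t := dv_eq_of_hasDerivAt hasDerivAt_Gam0

lemma dv_Gam0v : dv (Gam0v a σ t) = Gam0vv a σ t := dv_eq_of_hasDerivAt hasDerivAt_Gam0v

lemma dv_Gam (h : 0 < a - σ ^ 2) (I : ℝ≥0 → Ω → Plane) {t : ℝ≥0} (ht : 0 < t) (z ζ : Plane)
    (ω : Ω) : dv (fun y => Gam a σ I t y ζ ω) z = Gam0v a σ t (z - condMean σ I ζ t ω) := by
  simp only [Gam_eq_Gam0 h I ht]
  rw [dv_comp_sub_const (Gam0 a σ t), dv_Gam0]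

lemma dv_dv_Gam (h : 0 < a - σ ^ 2) (I : ℝ≥0 → Ω → Plane) {t : ℝ≥0} (ht : 0 < t) (z ζ : Plane)
    (ω : Ω) :
    dv (dv fun y => Gam a σ I t y ζ ω) z = Gam0vv a σ t (z - condMean σ I ζ t ω) := by
  have e : (dv fun y => Gam a σ I t y ζ ω) = fun y => Gam0v a σ t (y - condMean σ I ζ t ω) :=
    funext fun y => dv_Gam h I ht y ζ ω
  rw [e, dv_comp_sub_const (Gam0v a σ t), dv_Gam0v]

/-! ### Second order Taylor expansion -/

lemma abs_sub_le_of_abs_deriv_le {g g' : ℝ → ℝ} (hg : ∀ u, HasDerivAt g (g' u) u) {v w C : ℝ}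
    (hC : ∀ u ∈ Set.uIcc v w, |g' u| ≤ C) : |g w - g v| ≤ C * |w - v| :=
  (convex_uIcc v w).norm_image_sub_le_of_norm_hasDerivWithin_le
    (fun u _ => (hg u).hasDerivWithinAt) hC Set.left_mem_uIcc Set.right_mem_uIcc

/-- The remainder of the Taylor expansion of order two is controlled by the third derivative. -/
lemma abs_taylor_two_le {f f₁ f₂ f₃ : ℝ → ℝ} (h₁ : ∀ u, HasDerivAt f (f₁ u) u)
    (h₂ : ∀ u, HasDerivAt f₁ (f₂ u) u) (h₃ : ∀ u, HasDerivAt f₂ (f₃ u) u) {M : ℝ}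
    (hM : ∀ u, |f₃ u| ≤ M) (v δ : ℝ) :
    |f (v + δ) - f v - f₁ v * δ - 1 / 2 * f₂ v * δ ^ 2| ≤ M * |δ| ^ 3 := by
  have hM0 : 0 ≤ M := (abs_nonneg _).trans (hM 0)
  have hu : ∀ u ∈ Set.uIcc v (v + δ), |u - v| ≤ |δ| := fun u hu => by
    simpa using Set.abs_sub_left_of_mem_uIcc hu
  have hsub : ∀ u ∈ Set.uIcc v (v + δ), Set.uIcc v u ⊆ Set.uIcc v (v + δ) := fun u hu =>
    Set.uIcc_subset_uIcc_left hu
  have e2 : ∀ u ∈ Set.uIcc v (v + δ), |f₂ u - f₂ v| ≤ M * |δ| := fun u hu' =>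
    (abs_sub_le_of_abs_deriv_le h₃ fun w _ => hM w).trans
      (mul_le_mul_of_nonneg_left (hu u hu') hM0)
  have e1 : ∀ u ∈ Set.uIcc v (v + δ), |f₁ u - f₁ v - f₂ v * (u - v)| ≤ M * |δ| * |δ| :=
    fun u hu' => by
      have h := abs_sub_le_of_abs_deriv_le (g := fun w => f₁ w - f₂ v * w)
        (g' := fun w => f₂ w - f₂ v) (v := v) (w := u) (C := M * |δ|)
        (fun w => ((h₂ w).sub ((hasDerivAt_id w).const_mul (f₂ v))).congr_deriv (by ring))
        (fun w hw => e2 w (hsub u hu' hw))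
      calc |f₁ u - f₁ v - f₂ v * (u - v)| = |f₁ u - f₂ v * u - (f₁ v - f₂ v * v)| := by
            congr 1; ring
        _ ≤ M * |δ| * |u - v| := h
        _ ≤ _ := mul_le_mul_of_nonneg_left (hu u hu') (by positivity)
  have h := abs_sub_le_of_abs_deriv_le
    (g := fun w => f w - f₁ v * w - 1 / 2 * f₂ v * (w - v) ^ 2)
    (g' := fun w => f₁ w - f₁ v - f₂ v * (w - v)) (v := v) (w := v + δ) (C := M * |δ| * |δ|)
    (fun w => by
      have h1 := ((h₁ w).sub ((hasDerivAt_id w).const_mul (f₁ v))).sub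
        ((((hasDerivAt_id w).sub_const v).pow 2).const_mul (1 / 2 * f₂ v))
      refine h1.congr_deriv ?_
      simp only [id]
      push_cast
      ring) e1
  calc _ = |f (v + δ) - f₁ v * (v + δ) - 1 / 2 * f₂ v * (v + δ - v) ^ 2 -
        (f v - f₁ v * v - 1 / 2 * f₂ v * (v - v) ^ 2)| := by congr 1; ring
    _ ≤ M * |δ| * |δ| * |v + δ - v| := h
    _ = _ := by rw [add_sub_cancel_left]; ring

/-! ### Quadratic variation -/

section Variation

variable {𝓕 : Filtration ℝ≥0 mΩ} {P : Measure Ω} [IsProbabilityMeasure P] {X : ℝ≥0 → Ω → ℝ}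
  {c : ℝ≥0} {t₀ t T : ℝ≥0}

lemma IsScaledBM.memLp_sq_sub (hX : IsScaledBM 𝓕 P X c) {s r : ℝ≥0}
    (h : s ≤ r) (d : ℝ) : MemLp (fun ω => (X r ω - X s ω) ^ 2 - d) 2 P := by
  have hm : Measurable fun ω => (X r ω - X s ω) ^ 2 :=
    ((hX.measurable r).sub (hX.measurable s)).pow_const 2
  refine MemLp.sub ((memLp_two_iff_integrable_sq hm.aestronglyMeasurable).2 ?_) (memLp_const d)
  have h4 := (hX.memLp_sub h (p := (4 : ℕ)) (by simp)).integrable_norm_pow (by norm_num)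
  refine h4.congr (ae_of_all _ fun ω => ?_)
  simp only [Real.norm_eq_abs]
  rw [← pow_mul, show 2 * 2 = 4 from rfl, Even.pow_abs (by decide)]

/-- The errors `Y_s ((X_r - X_s)² - c (r - s))` over successive intervals are orthogonal, so that
their squares add up. -/
lemma IsScaledBM.integral_sum_sq_le (hX : IsScaledBM 𝓕 P X c) {τ : ℕ → ℝ≥0} (hτ : Monotone τ)
    {Y : ℝ≥0 → Ω → ℝ} (hY : ∀ i, Measurable[𝓕 (τ i)] (Y (τ i))) {C : ℝ}
    (hC : ∀ i ω, |Y (τ i) ω| ≤ C) (k : ℕ) :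
    MemLp (fun ω => ∑ i ∈ Finset.range k, Y (τ i) ω *
      ((X (τ (i + 1)) ω - X (τ i) ω) ^ 2 - c * (τ (i + 1) - τ i))) 2 P ∧
    ∫ ω, (∑ i ∈ Finset.range k, Y (τ i) ω *
      ((X (τ (i + 1)) ω - X (τ i) ω) ^ 2 - c * (τ (i + 1) - τ i))) ^ 2 ∂P ≤
    ∑ i ∈ Finset.range k, C ^ 2 * (c ^ 2 * ∫ x, (x ^ 2 - 1) ^ 2 ∂(gaussianReal 0 1)) *
      ((τ (i + 1) : ℝ) - τ i) ^ 2 := by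
  -- the variance of `(X_r - X_s)²` is `c² (r - s)²` times that of the square of a standard Gaussian
  set m₄ := ∫ x, (x ^ 2 - 1) ^ 2 ∂(gaussianReal 0 1) with hm₄
  let q : ℕ → Ω → ℝ := fun i ω => (X (τ (i + 1)) ω - X (τ i) ω) ^ 2 - c * (τ (i + 1) - τ i)
  have hle : ∀ i, τ i ≤ τ (i + 1) := fun i => hτ (Nat.le_succ i)
  have hq2 : ∀ i, MemLp (q i) 2 P := fun i => hX.memLp_sq_sub (hle i) _
  have hYm : ∀ i, Measurable (Y (τ i)) := fun i => (hY i).mono (𝓕.le _) le_rfl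
  have hYq2 : ∀ i, MemLp (fun ω => Y (τ i) ω * q i ω) 2 P := fun i => by
    refine MemLp.of_le_mul (c := C) (hq2 i) ((hYm i).aestronglyMeasurable.mul (hq2 i).1)
      (ae_of_all _ fun ω => ?_)
    rw [norm_mul]
    exact mul_le_mul_of_nonneg_right (hC i ω) (norm_nonneg _)
  have hq0 : ∀ i, ∫ ω, q i ω ∂P = 0 := fun i => by
    have h1 : Integrable (fun ω => (X (τ (i + 1)) ω - X (τ i) ω) ^ 2) P :=
      (hX.memLp_sub (hle i) (p := 2) (by simp)).integrable_sq
    simp only [q]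
    rw [integral_sub h1 (integrable_const _), hX.integral_sub_sq (hle i), integral_const]
    simp
  have hqq : ∀ i, ∫ ω, q i ω ^ 2 ∂P = c ^ 2 * m₄ * ((τ (i + 1) : ℝ) - τ i) ^ 2 := fun i => by
    have h1 := hX.integral_comp_sub (hle i)
      (h := fun x => (x ^ 2 - c * (τ (i + 1) - τ i)) ^ 2) (by fun_prop)
    have h2 : (0 : ℝ) ≤ c * (τ (i + 1) - τ i) :=
      mul_nonneg c.coe_nonneg (sub_nonneg.2 (NNReal.coe_le_coe.2 (hle i)))
    refine h1.trans ?_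
    have e : ∀ x : ℝ, ((√(c * (τ (i + 1) - τ i)) * x) ^ 2 - c * (τ (i + 1) - τ i)) ^ 2 =
        c ^ 2 * (τ (i + 1) - τ i) ^ 2 * (x ^ 2 - 1) ^ 2 := fun x => by
      rw [mul_pow, Real.sq_sqrt h2]; ring
    simp only [e]
    rw [integral_const_mul, ← hm₄]
    ring
  induction k with
  | zero => simp
  | succ k ih =>
    obtain ⟨ih1, ih2⟩ := ih
    set S : Ω → ℝ := fun ω => ∑ i ∈ Finset.range k, Y (τ i) ω * q i ω with hS
    have hSm : Measurable[𝓕 (τ k)] S := by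
      refine Finset.measurable_sum _ fun i hi => ?_
      have hi : i + 1 ≤ k := Finset.mem_range.1 hi
      have h1 := (hX.adapted (τ (i + 1))).mono (𝓕.mono (hτ hi)) le_rfl
      have h2 := (hX.adapted (τ i)).mono (𝓕.mono (hτ ((Nat.le_succ i).trans hi))) le_rfl
      have h3 := (hY i).mono (𝓕.mono (hτ ((Nat.le_succ i).trans hi))) le_rfl
      exact h3.mul (((h1.sub h2).pow_const 2).sub_const _)
    have hsum : ∀ ω, (∑ i ∈ Finset.range (k + 1), Y (τ i) ω *
        ((X (τ (i + 1)) ω - X (τ i) ω) ^ 2 - c * (τ (i + 1) - τ i))) =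
        S ω + Y (τ k) ω * q k ω := fun ω => Finset.sum_range_succ _ _
    simp only [hsum]
    refine ⟨ih1.add (hYq2 k), ?_⟩
    have hcross : ∫ ω, S ω * (Y (τ k) ω * q k ω) ∂P = 0 := by
      have h1 := hX.integral_mul_comp_sub (hle k) (hSm.mul (hY k))
        (h := fun x => x ^ 2 - c * (τ (k + 1) - τ k)) (by fun_prop)
      have h2 : ∫ ω, ((X (τ (k + 1)) ω - X (τ k) ω) ^ 2 - c * (τ (k + 1) - τ k)) ∂P = 0 := hq0 k
      rw [h2, mul_zero] at h1
      rw [← h1]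
      simp only [Pi.mul_apply, mul_assoc, q]
    have hi1 : Integrable (fun ω => S ω ^ 2) P := ih1.integrable_sq
    have hi2 : Integrable (fun ω => S ω * (Y (τ k) ω * q k ω)) P := ih1.integrable_mul (hYq2 k)
    have hi3 : Integrable (fun ω => (Y (τ k) ω * q k ω) ^ 2) P := (hYq2 k).integrable_sq
    have e : ∀ ω, (S ω + Y (τ k) ω * q k ω) ^ 2 =
        S ω ^ 2 + 2 * (S ω * (Y (τ k) ω * q k ω)) + (Y (τ k) ω * q k ω) ^ 2 := fun ω => by ring
    simp only [e]
    have hi12 : Integrable (fun ω => S ω ^ 2 + 2 * (S ω * (Y (τ k) ω * q k ω))) P :=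
      hi1.add (hi2.const_mul 2)
    rw [integral_add hi12 hi3, integral_add hi1 (hi2.const_mul 2),
      integral_const_mul, hcross, mul_zero, add_zero, Finset.sum_range_succ]
    refine add_le_add ih2 ?_
    calc ∫ ω, (Y (τ k) ω * q k ω) ^ 2 ∂P ≤ ∫ ω, C ^ 2 * q k ω ^ 2 ∂P := by
          refine integral_mono hi3 ((hq2 k).integrable_sq.const_mul _) fun ω => ?_
          rw [mul_pow]
          refine mul_le_mul_of_nonneg_right ?_ (sq_nonneg _)
          rw [← sq_abs]
          exact pow_le_pow_left₀ (abs_nonneg _) (hC k ω) 2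
      _ = _ := by rw [integral_const_mul, hqq k]; ring

/-- The weighted quadratic variation: squared increments may be replaced by the lengths of the
intervals. -/
lemma IsScaledBM.tendstoInMeasure_sum_sq (hX : IsScaledBM 𝓕 P X c) (ht : t ∈ Set.Icc t₀ T)
    {Y : ℝ≥0 → Ω → ℝ} (hY : ∀ s ∈ Set.Icc t₀ T, Measurable[𝓕 s] (Y s)) {C : ℝ}
    (hC : ∀ s ∈ Set.Icc t₀ T, ∀ ω, |Y s ω| ≤ C) :
    TendstoInMeasure P (fun n ω => ∑ i ∈ Finset.range (n + 1), Y (stoppedGrid t₀ T t n i) ω *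
      ((X (stoppedGrid t₀ T t n (i + 1)) ω - X (stoppedGrid t₀ T t n i) ω) ^ 2 -
        c * (stoppedGrid t₀ T t n (i + 1) - stoppedGrid t₀ T t n i))) atTop (fun _ => 0) := by
  have hmem : ∀ n i, stoppedGrid t₀ T t n i ∈ Set.Icc t₀ T := fun n i =>
    ⟨le_stoppedGrid n i, (stoppedGrid_le ht n i).trans ht.2⟩
  have key := fun n => hX.integral_sum_sq_le (stoppedGrid_mono (t₀ := t₀) (T := T) (t := t) n)
    (fun i => hY _ (hmem n i)) (fun i => hC _ (hmem n i)) (n + 1)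
  set K := C ^ 2 * (c ^ 2 * ∫ x, (x ^ 2 - 1) ^ 2 ∂(gaussianReal 0 1)) with hK
  have hK0 : 0 ≤ K := by
    have : 0 ≤ ∫ x, (x ^ 2 - 1) ^ 2 ∂(gaussianReal 0 1) := integral_nonneg fun _ => sq_nonneg _
    positivity
  have hbound : ∀ n, ∑ i ∈ Finset.range (n + 1), K *
      ((stoppedGrid t₀ T t n (i + 1) : ℝ) - stoppedGrid t₀ T t n i) ^ 2 ≤
      K * (((T : ℝ) - t₀) / (n + 1) * (t - t₀)) := fun n => by
    rw [← sum_stoppedGrid_sub ht n (fun s => (s : ℝ)), ← Finset.mul_sum]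
    refine mul_le_mul_of_nonneg_left ?_ hK0
    rw [Finset.mul_sum]
    refine Finset.sum_le_sum fun i _ => ?_
    rw [sq]
    exact mul_le_mul_of_nonneg_right (stoppedGrid_succ_sub_le ht n i)
      (sub_nonneg.2 (NNReal.coe_le_coe.2 (stoppedGrid_mono n (Nat.le_succ i))))
  refine tendstoInMeasure_of_tendsto_eLpNorm two_ne_zero (fun n => (key n).1.1)
    aestronglyMeasurable_const ?_
  have e : ∀ (f : Ω → ℝ), (f - fun _ => 0) = f := fun f => by ext; simp
  simp only [e]
  simp only [fun n => eLpNorm_two_eq_sqrt (key n).1]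
  have h1 : Tendsto (fun n : ℕ => K * (((T : ℝ) - t₀) / (n + 1) * (t - t₀))) atTop (𝓝 0) := by
    simpa using ((tendsto_mesh t₀ T).mul_const ((t : ℝ) - t₀)).const_mul K
  have h2 := squeeze_zero (fun n => integral_nonneg fun _ => sq_nonneg _)
    (fun n => (key n).2.trans (hbound n)) h1
  have h3 := (ENNReal.continuous_ofReal.tendsto _).comp ((Real.continuous_sqrt.tendsto _).comp h2)
  simpa [Function.comp_def] using h3

omit [IsProbabilityMeasure P] in
/-- Errors of the third order in the increments do not add up: the third absolute moment of an
increment is of the order `3 / 2` in the length of the interval. -/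
lemma IsScaledBM.tendstoInMeasure_sum_cube (hX : IsScaledBM 𝓕 P X c) (ht : t ∈ Set.Icc t₀ T)
    {R : ℝ≥0 → ℝ≥0 → Ω → ℝ} (hR : ∀ s r, s ∈ Set.Icc t₀ T → r ∈ Set.Icc t₀ T → Measurable (R s r))
    {M : ℝ} (hM : ∀ s r, s ∈ Set.Icc t₀ T → r ∈ Set.Icc t₀ T → ∀ ω,
      |R s r ω| ≤ M * |X r ω - X s ω| ^ 3) :
    TendstoInMeasure P (fun n ω => ∑ i ∈ Finset.range (n + 1),
      R (stoppedGrid t₀ T t n i) (stoppedGrid t₀ T t n (i + 1)) ω) atTop (fun _ => 0) := by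
  wlog hM0 : 0 ≤ M generalizing M
  · refine this (M := |M|) (fun s r hs hr ω => (hM s r hs hr ω).trans ?_) (abs_nonneg M)
    exact mul_le_mul_of_nonneg_right (le_abs_self M) (by positivity)
  have hmem : ∀ n i, stoppedGrid t₀ T t n i ∈ Set.Icc t₀ T := fun n i =>
    ⟨le_stoppedGrid n i, (stoppedGrid_le ht n i).trans ht.2⟩
  have hmono : ∀ n i, stoppedGrid t₀ T t n i ≤ stoppedGrid t₀ T t n (i + 1) := fun n i =>
    stoppedGrid_mono n (Nat.le_succ i)
  set m₃ := ∫ x, |x| ^ 3 ∂(gaussianReal 0 1) with hm₃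
  have hm₃0 : 0 ≤ m₃ := integral_nonneg fun _ => by positivity
  have hint : ∀ n i, Integrable (fun ω => |X (stoppedGrid t₀ T t n (i + 1)) ω -
      X (stoppedGrid t₀ T t n i) ω| ^ 3) P := fun n i => by
    have h3 := (hX.memLp_sub (hmono n i) (p := (3 : ℕ)) (by simp)).integrable_norm_pow
      (by norm_num)
    simpa only [Real.norm_eq_abs] using h3
  have hcube : ∀ n i, ∫ ω, |X (stoppedGrid t₀ T t n (i + 1)) ω -
      X (stoppedGrid t₀ T t n i) ω| ^ 3 ∂P ≤ √(c * (((T : ℝ) - t₀) / (n + 1))) * c * m₃ *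
        ((stoppedGrid t₀ T t n (i + 1) : ℝ) - stoppedGrid t₀ T t n i) := fun n i => by
    have h1 := hX.integral_comp_sub (hmono n i) (h := fun x => |x| ^ 3) (by fun_prop)
    have h2 : (0 : ℝ) ≤ stoppedGrid t₀ T t n (i + 1) - stoppedGrid t₀ T t n i :=
      sub_nonneg.2 (NNReal.coe_le_coe.2 (hmono n i))
    rw [h1]
    simp only [abs_mul, mul_pow]
    rw [integral_const_mul, ← hm₃, abs_of_nonneg (Real.sqrt_nonneg _), pow_succ',
      Real.sq_sqrt (mul_nonneg c.coe_nonneg h2)]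
    calc _ = √(c * (stoppedGrid t₀ T t n (i + 1) - stoppedGrid t₀ T t n i)) * c * m₃ *
          ((stoppedGrid t₀ T t n (i + 1) : ℝ) - stoppedGrid t₀ T t n i) := by ring
      _ ≤ _ := by
        gcongr
        exact stoppedGrid_succ_sub_le ht n i
  refine tendstoInMeasure_of_tendsto_eLpNorm one_ne_zero (fun n =>
    (Finset.measurable_sum _ fun i _ => hR _ _ (hmem n i) (hmem n (i + 1))).aestronglyMeasurable)
    aestronglyMeasurable_const ?_
  have e : ∀ (f : Ω → ℝ), (f - fun _ => 0) = f := fun f => by ext; simp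
  simp only [e]
  have hbound : ∀ n : ℕ, eLpNorm (fun ω => ∑ i ∈ Finset.range (n + 1),
      R (stoppedGrid t₀ T t n i) (stoppedGrid t₀ T t n (i + 1)) ω) 1 P ≤
      ENNReal.ofReal (M * (√(c * (((T : ℝ) - t₀) / (n + 1))) * c * m₃ * (t - t₀))) := fun n => by
    have h1 : Integrable (fun ω => ∑ i ∈ Finset.range (n + 1), M *
        |X (stoppedGrid t₀ T t n (i + 1)) ω - X (stoppedGrid t₀ T t n i) ω| ^ 3) P :=
      integrable_finsetSum _ fun i _ => (hint n i).const_mul M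
    calc _ ≤ eLpNorm (fun ω => ∑ i ∈ Finset.range (n + 1), M *
        |X (stoppedGrid t₀ T t n (i + 1)) ω - X (stoppedGrid t₀ T t n i) ω| ^ 3) 1 P := by
          refine eLpNorm_mono_real fun ω => ?_
          rw [Real.norm_eq_abs]
          exact (Finset.abs_sum_le_sum_abs _ _).trans
            (Finset.sum_le_sum fun i _ => hM _ _ (hmem n i) (hmem n (i + 1)) ω)
      _ = ENNReal.ofReal (∫ ω, ∑ i ∈ Finset.range (n + 1), M *
        |X (stoppedGrid t₀ T t n (i + 1)) ω - X (stoppedGrid t₀ T t n i) ω| ^ 3 ∂P) := by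
          rw [eLpNorm_one_eq_lintegral_enorm, ofReal_integral_eq_lintegral_ofReal h1
            (ae_of_all _ fun ω => Finset.sum_nonneg fun i _ => by positivity)]
          refine lintegral_congr fun ω => ?_
          rw [Real.enorm_eq_ofReal (Finset.sum_nonneg fun i _ => by positivity)]
      _ ≤ _ := by
          refine ENNReal.ofReal_le_ofReal ?_
          rw [integral_finsetSum _ fun i _ => (hint n i).const_mul M,
            ← sum_stoppedGrid_sub ht n (fun s => (s : ℝ)), Finset.mul_sum, Finset.mul_sum]
          refine Finset.sum_le_sum fun i _ => ?_
          rw [integral_const_mul]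
          exact mul_le_mul_of_nonneg_left (hcube n i) hM0
  refine tendsto_of_tendsto_of_tendsto_of_le_of_le tendsto_const_nhds ?_ (fun _ => zero_le) hbound
  have h1 : Tendsto (fun n : ℕ => √(c * (((T : ℝ) - t₀) / (n + 1)))) atTop (𝓝 0) := by
    have := (Real.continuous_sqrt.tendsto _).comp ((tendsto_mesh t₀ T).const_mul (c : ℝ))
    simpa [Function.comp_def] using this
  have h2 := ENNReal.tendsto_ofReal ((((h1.mul_const (c : ℝ)).mul_const m₃).mul_const
    ((t : ℝ) - t₀)).const_mul M)
  simpa using h2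

end Variation

/-! ### Small time expansion of the kernel along a path -/

section Path

variable {a σ : ℝ} {t₀ T : ℝ≥0}

/-- The process `Y_s = e^{-t₀ B} z - ζ + σ I_s`, which represents the argument of the kernel along
the integral curve through `(t₀, z)` as `e^{sB} Y_s`. -/
def kernelArg (σ : ℝ) (I : ℝ≥0 → Ω → Plane) (ζ z : Plane) (t₀ s : ℝ≥0) (ω : Ω) : Plane :=
  flow (-(t₀ : ℝ)) z - ζ + σ • I s ω

lemma flow_sub_condMean (σ : ℝ) (I : ℝ≥0 → Ω → Plane) (ζ z : Plane) (t₀ s : ℝ≥0) (ω : Ω) :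
    flow ((s : ℝ) - t₀) z - condMean σ I ζ s ω = flow s (kernelArg σ I ζ z t₀ s ω) := by
  refine plane_ext ?_ ?_
  · simp only [condMean, kernelArg, flow_fst, flow_snd, PiLp.sub_apply, PiLp.add_apply]
    ring
  · simp only [condMean, kernelArg, flow_snd, PiLp.sub_apply, PiLp.add_apply]
    ring

/-- The second derivative of the kernel at time `u` and at the position of the path at time `w`. The
time is frozen before `t₀`, which keeps it away from the pole and makes the function continuous on
all of `ℝ × ℝ`. -/
def pathVV (a σ : ℝ) (t₀ : ℝ≥0) (y : ℝ≥0 → Plane) (u w : ℝ) : ℝ :=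
  Gam0vv a σ (max t₀ u) (flow (max t₀ u) (y w.toNNReal))

lemma pathVV_eq {y : ℝ≥0 → Plane} {u w : ℝ} (hu : (t₀ : ℝ) ≤ u) :
    pathVV a σ t₀ y u w = Gam0vv a σ u (flow u (y w.toNNReal)) := by
  rw [pathVV, max_eq_right hu]

lemma continuous_pathVV (h : 0 < a - σ ^ 2) (ht₀ : 0 < t₀) {y : ℝ≥0 → Plane} (hy : Continuous y) :
    Continuous fun p : ℝ × ℝ => pathVV a σ t₀ y p.1 p.2 := by
  have h1 : Continuous fun p : ℝ × ℝ => max (t₀ : ℝ) p.1 := continuous_const.max continuous_fst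
  have h2 : Continuous fun p : ℝ × ℝ => flow (max (t₀ : ℝ) p.1) (y p.2.toNNReal) :=
    continuous_flow h1 (hy.comp (continuous_real_toNNReal.comp continuous_snd))
  refine continuousOn_univ.1 ?_
  unfold pathVV
  exact continuousOn_Gam0vv_comp h h1.continuousOn h2.continuousOn
    fun p _ => lt_max_of_lt_left (NNReal.coe_pos.2 ht₀)

/-- The deterministic Kolmogorov equation, integrated in time. -/
lemma Gam0_flow_sub_eq_integral (h : 0 < a - σ ^ 2) {s r : ℝ} (hs : 0 < s) (hsr : s ≤ r)
    (y : Plane) : Gam0 a σ r (flow r y) - Gam0 a σ s (flow s y) =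
      ∫ u in s..r, (a - σ ^ 2) / 2 * Gam0vv a σ u (flow u y) := by
  have hpos : ∀ u ∈ Set.uIcc s r, 0 < u := fun u hu => by
    rw [Set.uIcc_of_le hsr] at hu
    exact hs.trans_le hu.1
  refine (intervalIntegral.integral_eq_sub_of_hasDerivAt (f := fun u => Gam0 a σ u (flow u y))
    (fun u hu => hasDerivAt_Gam0_flow h (hpos u hu) y) ?_).symm
  have h1 : Continuous fun u : ℝ => flow u y := continuous_flow continuous_id continuous_const
  have h2 : ContinuousOn (fun u : ℝ => Gam0vv a σ u (flow u y)) (Set.uIcc s r) :=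
    continuousOn_Gam0vv_comp h continuousOn_id h1.continuousOn hpos
  exact (continuousOn_const.mul h2).intervalIntegrable

/-- The terms of the expansion that are negligible path by path: the deterministic part of the
expansion of the kernel along `y`, when the velocity of `y` is `σ x` and its position is
transported. -/
lemma exists_forall_remainder_le (h : 0 < a - σ ^ 2) (ht₀ : 0 < t₀) {y : ℝ≥0 → Plane}
    (hy : Continuous y) {x : ℝ≥0 → ℝ} (hx : Continuous x)
    (hxy₁ : ∀ s r, y r 1 - y s 1 = σ * (x r - x s))
    (hxy₀ : ∀ s r : ℝ≥0, y r 0 - y s 0 + s * (y r 1 - y s 1) =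
      σ * ∫ u in (s : ℝ)..r, (x u.toNNReal - x r)) {ε : ℝ} (hε : 0 < ε) :
    ∃ δ > 0, ∀ s r : ℝ≥0, t₀ ≤ s → s ≤ r → r ≤ T → (r : ℝ) - s < δ →
      |Gam0 a σ r (flow r (y r)) -
          Gam0 a σ s !₂[(flow s (y s)) 0, (flow s (y s)) 1 + σ * (x r - x s)] -
          (∫ u in (s : ℝ)..r, 1 / 2 * a * pathVV a σ t₀ y u u) +
          1 / 2 * σ ^ 2 * ((r : ℝ) - s) * pathVV a σ t₀ y s s| ≤ ε * (r - s) := by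
  obtain ⟨M, hM0, hM⟩ := exists_bound_derivs h (NNReal.coe_pos.2 ht₀)
  have ha : 0 < a := by nlinarith [sq_nonneg σ]
  -- two of the three errors below enter with a factor of at most `a / 2`, one with `M * |σ|`
  set ε₁ := ε / (a + M * |σ| + 1) with hε₁
  have hε₁0 : 0 < ε₁ := by positivity
  have hV := continuous_pathVV h ht₀ hy
  have hcpt : IsCompact (Set.Icc (0 : ℝ) T ×ˢ Set.Icc (0 : ℝ) T) := isCompact_Icc.prod isCompact_Icc
  obtain ⟨δ₁, hδ₁, hVu⟩ := Metric.uniformContinuousOn_iff.1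
    (hcpt.uniformContinuousOn_of_continuous hV.continuousOn) ε₁ hε₁0
  obtain ⟨δ₂, hδ₂, hxu⟩ := Metric.uniformContinuousOn_iff.1
    ((isCompact_Icc (a := (0 : ℝ)) (b := T)).uniformContinuousOn_of_continuous
      (hx.comp continuous_real_toNNReal).continuousOn) ε₁ hε₁0
  refine ⟨min δ₁ δ₂, lt_min hδ₁ hδ₂, fun s r hs hsr hr hd => ?_⟩
  have hs' : (t₀ : ℝ) ≤ s := hs
  have hsr' : (s : ℝ) ≤ r := hsr
  have hr' : (r : ℝ) ≤ T := hr
  have hs0 : (0 : ℝ) < s := (NNReal.coe_pos.2 ht₀).trans_le hs'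
  have hd₁ : (r : ℝ) - s < δ₁ := hd.trans_le (min_le_left _ _)
  have hd₂ : (r : ℝ) - s < δ₂ := hd.trans_le (min_le_right _ _)
  -- the three differences on the interval `[s, r]`
  have hVd : ∀ u w : ℝ, u ∈ Set.Icc (s : ℝ) r → w ∈ Set.Icc (s : ℝ) r →
      |pathVV a σ t₀ y u w - pathVV a σ t₀ y s s| ≤ ε₁ := fun u w hu hw => by
    have h1 := hVu (u, w) ⟨⟨hs0.le.trans hu.1, hu.2.trans hr'⟩, ⟨hs0.le.trans hw.1, hw.2.trans hr'⟩⟩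
      ((s : ℝ), (s : ℝ)) ⟨⟨hs0.le, hsr'.trans hr'⟩, ⟨hs0.le, hsr'.trans hr'⟩⟩ (by
        rw [Prod.dist_eq, Real.dist_eq, Real.dist_eq, abs_of_nonneg (sub_nonneg.2 hu.1),
          abs_of_nonneg (sub_nonneg.2 hw.1)]
        exact max_lt (by linarith [hu.2]) (by linarith [hw.2]))
    rw [Real.dist_eq] at h1
    exact h1.le
  have hmem : ∀ u ∈ Set.uIoc (s : ℝ) r, u ∈ Set.Icc (s : ℝ) r := fun u hu => by
    rw [Set.uIoc_of_le hsr'] at hu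
    exact ⟨hu.1.le, hu.2⟩
  have hi₁ : |∫ u in (s : ℝ)..r, (pathVV a σ t₀ y u r - pathVV a σ t₀ y s s)| ≤ ε₁ * (r - s) := by
    have h1 := intervalIntegral.norm_integral_le_of_norm_le_const (a := (s : ℝ)) (b := r)
      (f := fun u => pathVV a σ t₀ y u r - pathVV a σ t₀ y s s)
      fun u hu => hVd u r (hmem u hu) ⟨hsr', le_rfl⟩
    rwa [abs_of_nonneg (sub_nonneg.2 hsr')] at h1
  have hi₂ : |∫ u in (s : ℝ)..r, (pathVV a σ t₀ y u u - pathVV a σ t₀ y s s)| ≤ ε₁ * (r - s) := by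
    have h1 := intervalIntegral.norm_integral_le_of_norm_le_const (a := (s : ℝ)) (b := r)
      (f := fun u => pathVV a σ t₀ y u u - pathVV a σ t₀ y s s)
      fun u hu => hVd u u (hmem u hu) (hmem u hu)
    rwa [abs_of_nonneg (sub_nonneg.2 hsr')] at h1
  have hi₃ : |∫ u in (s : ℝ)..r, (x u.toNNReal - x r)| ≤ ε₁ * (r - s) := by
    have h1 := intervalIntegral.norm_integral_le_of_norm_le_const (a := (s : ℝ)) (b := r)
      (f := fun u => x u.toNNReal - x r) (C := ε₁) fun u hu => by
        have hu' := hmem u hu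
        have h2 := hxu u ⟨hs0.le.trans hu'.1, hu'.2.trans hr'⟩ r ⟨r.2, hr'⟩ (by
          rw [dist_comm, Real.dist_eq, abs_of_nonneg (sub_nonneg.2 hu'.2)]
          linarith [hu'.1])
        simp only [Function.comp_apply, Real.toNNReal_coe, Real.dist_eq] at h2
        exact h2.le
    rwa [abs_of_nonneg (sub_nonneg.2 hsr')] at h1
  have hc₁ : Continuous fun u : ℝ => pathVV a σ t₀ y u r := by
    have h1 := hV.comp (continuous_id.prodMk (continuous_const (y := (r : ℝ))))
    exact h1
  have hc₂ : Continuous fun u : ℝ => pathVV a σ t₀ y u u := by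
    have h1 := hV.comp (continuous_id.prodMk continuous_id)
    exact h1
  -- the time increment at the final position
  have e₁ : Gam0 a σ r (flow r (y r)) - Gam0 a σ s (flow s (y r)) =
      (a - σ ^ 2) / 2 * ((∫ u in (s : ℝ)..r, (pathVV a σ t₀ y u r - pathVV a σ t₀ y s s)) +
        (r - s) * pathVV a σ t₀ y s s) := by
    rw [Gam0_flow_sub_eq_integral h hs0 hsr', intervalIntegral.integral_const_mul,
      intervalIntegral.integral_sub (hc₁.intervalIntegrable _ _)
        (continuous_const.intervalIntegrable _ _), intervalIntegral.integral_const, smul_eq_mul,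
      sub_add_cancel]
    congr 1
    refine intervalIntegral.integral_congr fun u hu => ?_
    rw [Set.uIcc_of_le hsr'] at hu
    simp only [pathVV_eq (hs'.trans hu.1), Real.toNNReal_coe]
  have e₂ : (∫ u in (s : ℝ)..r, 1 / 2 * a * pathVV a σ t₀ y u u) =
      1 / 2 * a * ((∫ u in (s : ℝ)..r, (pathVV a σ t₀ y u u - pathVV a σ t₀ y s s)) +
        (r - s) * pathVV a σ t₀ y s s) := by
    rw [intervalIntegral.integral_const_mul,
      intervalIntegral.integral_sub (hc₂.intervalIntegrable _ _)
        (continuous_const.intervalIntegrable _ _), intervalIntegral.integral_const, smul_eq_mul,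
      sub_add_cancel]
  -- the increment of the position
  have e₃ : flow s (y r) = !₂[(flow s (y s)) 0 + σ * ∫ u in (s : ℝ)..r, (x u.toNNReal - x r),
      (flow s (y s)) 1 + σ * (x r - x s)] := by
    refine plane_ext ?_ ?_
    · rw [flow_fst, flow_fst, ← hxy₀ s r]
      simp only [Matrix.cons_val_zero]
      ring
    · rw [flow_snd, flow_snd, ← hxy₁ s r]
      simp
  have i₃ : |Gam0 a σ s (flow s (y r)) -
      Gam0 a σ s !₂[(flow s (y s)) 0, (flow s (y s)) 1 + σ * (x r - x s)]| ≤
      M * (|σ| * (ε₁ * (r - s))) := by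
    have h1 := abs_sub_le_of_abs_deriv_le
      (fun u => hasDerivAt_Gam0_fst (a := a) (σ := σ) (t := s) u
        ((flow s (y s)) 1 + σ * (x r - x s))) (v := (flow s (y s)) 0)
      (w := (flow s (y s)) 0 + σ * ∫ u in (s : ℝ)..r, (x u.toNNReal - x r)) (C := M)
      fun u _ => (hM s hs' _).1
    rw [e₃]
    refine h1.trans (mul_le_mul_of_nonneg_left ?_ hM0)
    rw [add_sub_cancel_left, abs_mul]
    exact mul_le_mul_of_nonneg_left hi₃ (abs_nonneg σ)
  have hκ : 0 ≤ (a - σ ^ 2) / 2 := by positivity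
  have hκa : (a - σ ^ 2) / 2 ≤ a / 2 := by linarith [sq_nonneg σ]
  have hrs : (0 : ℝ) ≤ r - s := sub_nonneg.2 hsr'
  set A₁ := ∫ u in (s : ℝ)..r, (pathVV a σ t₀ y u r - pathVV a σ t₀ y s s)
  set A₂ := ∫ u in (s : ℝ)..r, (pathVV a σ t₀ y u u - pathVV a σ t₀ y s s)
  set G₃ := Gam0 a σ s !₂[(flow s (y s)) 0, (flow s (y s)) 1 + σ * (x r - x s)]
  rw [e₂]
  have e₄ : Gam0 a σ r (flow r (y r)) - G₃ -
      1 / 2 * a * (A₂ + (r - s) * pathVV a σ t₀ y s s) +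
      1 / 2 * σ ^ 2 * ((r : ℝ) - s) * pathVV a σ t₀ y s s =
      (a - σ ^ 2) / 2 * A₁ + (Gam0 a σ s (flow s (y r)) - G₃) - a / 2 * A₂ := by
    linear_combination e₁
  rw [e₄]
  calc _ ≤ |(a - σ ^ 2) / 2 * A₁| + |Gam0 a σ s (flow s (y r)) - G₃| + |a / 2 * A₂| :=
        (abs_sub _ _).trans (add_le_add (abs_add_le _ _) le_rfl)
    _ ≤ a / 2 * (ε₁ * (r - s)) + M * (|σ| * (ε₁ * (r - s))) + a / 2 * (ε₁ * (r - s)) := by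
        refine add_le_add (add_le_add ?_ i₃) ?_
        · rw [abs_mul, abs_of_nonneg hκ]
          gcongr
        · rw [abs_mul, abs_of_pos (by positivity)]
          gcongr
    _ = (a + M * |σ|) * ε₁ * (r - s) := by ring
    _ ≤ ε * (r - s) := by
        refine mul_le_mul_of_nonneg_right ?_ hrs
        rw [hε₁, mul_div_assoc', div_le_iff₀ (by positivity)]
        nlinarith

end Path

/-! ### The Itô formula for the kernel -/

lemma tendstoInMeasure_zero_add {P : Measure Ω} {f g : ℕ → Ω → ℝ}
    (hf : TendstoInMeasure P f atTop fun _ => 0) (hg : TendstoInMeasure P g atTop fun _ => 0) :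
    TendstoInMeasure P (fun n ω => f n ω + g n ω) atTop fun _ => 0 := by
  rw [tendstoInMeasure_iff_norm] at *
  intro ε hε
  have h := (hf (ε / 2) (half_pos hε)).add (hg (ε / 2) (half_pos hε))
  rw [add_zero] at h
  refine tendsto_of_tendsto_of_tendsto_of_le_of_le tendsto_const_nhds h (fun _ => zero_le)
    fun n => (measure_mono fun ω hω => ?_).trans (measure_union_le _ _)
  by_contra hcon
  simp only [Set.mem_union, Set.mem_ofPred_eq, not_or, not_le, sub_zero] at hcon hω
  have := norm_add_le (f n ω) (g n ω)
  linarith [hcon.1, hcon.2]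

section Ito

variable {𝓕 : Filtration ℝ≥0 mΩ} {P : Measure Ω} [IsProbabilityMeasure P] {W : ℝ≥0 → Ω → ℝ}
  {I : ℝ≥0 → Ω → Plane} {a σ : ℝ} {t₀ T : ℝ≥0}

/-- The process which the equation prescribes as its stochastic integral: the increment of the
kernel along the integral curve through `(t₀, z)`, minus the time integral. -/
def spdeIntegral (a σ : ℝ) (I : ℝ≥0 → Ω → Plane) (ζ : Plane) (t₀ : ℝ≥0) (z : Plane) (t : ℝ≥0)
    (ω : Ω) : ℝ :=
  Gam a σ I t (flow ((t : ℝ) - t₀) z) ζ ω - Gam a σ I t₀ z ζ ω -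
    ∫ s in (t₀ : ℝ)..t, 1 / 2 * a * dv (dv fun y => Gam a σ I s.toNNReal y ζ ω) (flow (s - t₀) z)

lemma Gam_flow_eq (h : 0 < a - σ ^ 2) (I : ℝ≥0 → Ω → Plane) (ζ z : Plane) (t₀ : ℝ≥0) {s : ℝ≥0}
    (hs : 0 < s) (ω : Ω) : Gam a σ I s (flow ((s : ℝ) - t₀) z) ζ ω =
      Gam0 a σ s (flow s (kernelArg σ I ζ z t₀ s ω)) := by
  rw [Gam_eq_Gam0 h I hs, flow_sub_condMean]

lemma spdeIntegral_eq (h : 0 < a - σ ^ 2) (ht₀ : 0 < t₀) (I : ℝ≥0 → Ω → Plane) (ζ z : Plane)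
    {t : ℝ≥0} (ht : t₀ ≤ t) (ω : Ω) : spdeIntegral a σ I ζ t₀ z t ω =
      Gam0 a σ t (flow t (kernelArg σ I ζ z t₀ t ω)) -
        Gam0 a σ t₀ (flow t₀ (kernelArg σ I ζ z t₀ t₀ ω)) -
        ∫ u in (t₀ : ℝ)..t, 1 / 2 * a * pathVV a σ t₀ (fun s => kernelArg σ I ζ z t₀ s ω) u u := by
  have ht' : (t₀ : ℝ) ≤ t := ht
  have h0 := Gam_flow_eq h I ζ z t₀ ht₀ ω
  rw [sub_self, flow_zero] at h0
  rw [spdeIntegral, Gam_flow_eq h I ζ z t₀ (ht₀.trans_le ht), h0]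
  congr 1
  refine intervalIntegral.integral_congr fun u hu => ?_
  rw [Set.uIcc_of_le ht'] at hu
  have hu0 : 0 < u := (NNReal.coe_pos.2 ht₀).trans_le hu.1
  have h1 := flow_sub_condMean σ I ζ z t₀ u.toNNReal ω
  rw [Real.coe_toNNReal u hu0.le] at h1
  rw [dv_dv_Gam h I (Real.toNNReal_pos.2 hu0), h1, pathVV_eq hu.1, Real.coe_toNNReal u hu0.le]

omit [IsProbabilityMeasure P] in
lemma IsFlowIntegral.adapted_kernelArg (hI : IsFlowIntegral 𝓕 P W I) (σ : ℝ) (ζ z : Plane)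
    (t₀ s : ℝ≥0) : Measurable[𝓕 s] (kernelArg σ I ζ z t₀ s) := by
  have h1 : Measurable[𝓕 s] fun ω => σ • I s ω := (hI.adapted s).fun_const_smul σ
  exact h1.const_add _

omit [IsProbabilityMeasure P] in
lemma IsFlowIntegral.continuous_kernelArg (hI : IsFlowIntegral 𝓕 P W I) (σ : ℝ) (ζ z : Plane)
    (t₀ : ℝ≥0) (ω : Ω) : Continuous fun s => kernelArg σ I ζ z t₀ s ω :=
  continuous_const.add ((hI.continuous ω).const_smul σ)

lemma measurable_slopeV (t : ℝ) : Measurable (slopeV t) :=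
  (((measurable_plane_eval 1).const_mul 2).div_const t).sub
    (((measurable_plane_eval 0).const_mul 3).div_const (t ^ 2))

lemma measurable_Gam0v (a σ t : ℝ) : Measurable (Gam0v a σ t) :=
  ((measurable_slopeV t).const_mul _).neg.mul (measurable_Gam0 a σ t)

lemma measurable_Gam0vv (a σ t : ℝ) : Measurable (Gam0vv a σ t) :=
  ((((measurable_slopeV t).const_mul _).pow_const 2).sub_const _).mul (measurable_Gam0 a σ t)

omit [IsProbabilityMeasure P] in
lemma IsFlowIntegral.adapted_comp_kernelArg (hI : IsFlowIntegral 𝓕 P W I) (σ : ℝ) (ζ z : Plane)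
    (t₀ s : ℝ≥0) {f : Plane → ℝ} (hf : Measurable f) :
    Measurable[𝓕 s] fun ω => f (flow s (kernelArg σ I ζ z t₀ s ω)) := by
  have h1 : Measurable[𝓕 s] fun ω => flow s (kernelArg σ I ζ z t₀ s ω) :=
    (measurable_flow s).comp (hI.adapted_kernelArg σ ζ z t₀ s)
  exact hf.comp h1

omit [IsProbabilityMeasure P] in
lemma IsFlowIntegral.continuous_pathVV (hI : IsFlowIntegral 𝓕 P W I) (h : 0 < a - σ ^ 2)
    (ht₀ : 0 < t₀) (ζ z : Plane) (ω : Ω) :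
    Continuous fun u : ℝ => pathVV a σ t₀ (fun s => kernelArg σ I ζ z t₀ s ω) u u := by
  have h1 := (Langevin.continuous_pathVV h ht₀ (hI.continuous_kernelArg σ ζ z t₀ ω)).comp
    (continuous_id.prodMk continuous_id)
  exact h1

omit [IsProbabilityMeasure P] in
lemma IsFlowIntegral.adapted_spdeIntegral (hI : IsFlowIntegral 𝓕 P W I) (h : 0 < a - σ ^ 2)
    (ht₀ : 0 < t₀) (ζ z : Plane) {t : ℝ≥0} (ht : t₀ ≤ t) :
    Measurable[𝓕 t] (spdeIntegral a σ I ζ t₀ z t) := by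
  let V : ℝ≥0 → Ω → ℝ := fun s ω =>
    pathVV a σ t₀ (fun s => kernelArg σ I ζ z t₀ s ω) (max t₀ s : ℝ≥0) (max t₀ s : ℝ≥0)
  have hV : ∀ s ≤ t, Measurable[𝓕 t] (V s) := fun s hs => by
    have h1 := hI.adapted_comp_kernelArg σ ζ z t₀ (max t₀ s)
      (measurable_Gam0vv a σ (max t₀ s : ℝ≥0))
    have e : V s = fun ω => Gam0vv a σ (max t₀ s : ℝ≥0)
        (flow (max t₀ s : ℝ≥0) (kernelArg σ I ζ z t₀ (max t₀ s) ω)) := by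
      funext ω
      simp only [V]
      rw [pathVV_eq (NNReal.coe_le_coe.2 (le_max_left t₀ s)), Real.toNNReal_coe]
    rw [e]
    exact h1.mono (𝓕.mono (max_le ht hs)) le_rfl
  obtain ⟨Y, hY, hYe⟩ := exists_measurable_eq_integral (𝓕 t) ht hV
  have hVc : ∀ ω, Continuous fun s => V s ω := fun ω => by
    have h1 : Continuous fun s : ℝ≥0 => ((max t₀ s : ℝ≥0) : ℝ) :=
      NNReal.continuous_coe.comp (continuous_const.max continuous_id)
    have h2 := (hI.continuous_pathVV h ht₀ ζ z ω).comp h1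
    exact h2
  have e : spdeIntegral a σ I ζ t₀ z t = fun ω =>
      Gam0 a σ t (flow t (kernelArg σ I ζ z t₀ t ω)) -
        Gam0 a σ t₀ (flow t₀ (kernelArg σ I ζ z t₀ t₀ ω)) - 1 / 2 * a * Y ω := by
    funext ω
    rw [spdeIntegral_eq h ht₀ I ζ z ht, intervalIntegral.integral_const_mul, hYe ω (hVc ω)]
    congr 2
    refine intervalIntegral.integral_congr fun u hu => ?_
    rw [Set.uIcc_of_le (NNReal.coe_le_coe.2 ht)] at hu
    have h1 : t₀ ≤ u.toNNReal := NNReal.le_toNNReal_of_coe_le hu.1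
    simp only [V, max_eq_right h1, Real.coe_toNNReal u (t₀.2.trans hu.1)]
  rw [e]
  have h1 := hI.adapted_comp_kernelArg σ ζ z t₀ t (measurable_Gam0 a σ t)
  have h2 := (hI.adapted_comp_kernelArg σ ζ z t₀ t₀ (measurable_Gam0 a σ t₀)).mono (𝓕.mono ht)
    le_rfl
  exact (h1.sub h2).sub (hY.const_mul _)

omit [IsProbabilityMeasure P] in
lemma IsFlowIntegral.continuous_flow_kernelArg (hI : IsFlowIntegral 𝓕 P W I) (ζ z : Plane)
    (ω : Ω) : Continuous fun t : ℝ≥0 => flow t (kernelArg σ I ζ z t₀ t ω) :=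
  continuous_flow NNReal.continuous_coe (hI.continuous_kernelArg σ ζ z t₀ ω)

omit [IsProbabilityMeasure P] in
lemma IsFlowIntegral.continuousOn_spdeIntegral (hI : IsFlowIntegral 𝓕 P W I) (h : 0 < a - σ ^ 2)
    (ht₀ : 0 < t₀) (ζ z : Plane) (ω : Ω) :
    ContinuousOn (fun t => spdeIntegral a σ I ζ t₀ z t ω) (Set.Icc t₀ T) := by
  have hpos : ∀ t ∈ Set.Icc t₀ T, (0 : ℝ) < t := fun t ht => NNReal.coe_pos.2 (ht₀.trans_le ht.1)
  have h1 : ContinuousOn (fun t : ℝ≥0 => Gam0 a σ t (flow t (kernelArg σ I ζ z t₀ t ω)))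
      (Set.Icc t₀ T) := continuousOn_Gam0_comp h NNReal.continuous_coe.continuousOn
    (hI.continuous_flow_kernelArg ζ z ω).continuousOn hpos
  have h2 := intervalIntegral.continuous_primitive (μ := volume) (f := fun u : ℝ =>
    1 / 2 * a * pathVV a σ t₀ (fun s => kernelArg σ I ζ z t₀ s ω) u u)
    (fun a b => (((hI.continuous_pathVV h ht₀ ζ z ω).const_mul _).intervalIntegrable a b)) t₀
  refine ((h1.sub (continuousOn_const
    (c := Gam0 a σ t₀ (flow t₀ (kernelArg σ I ζ z t₀ t₀ ω))))).sub
    (h2.comp NNReal.continuous_coe).continuousOn).congr fun t ht => ?_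
  exact spdeIntegral_eq h ht₀ I ζ z ht.1 ω

/-- The Itô formula: the process prescribed by the equation is the stochastic integral of
`σ ∂_v Γ` along the integral curve. The increments of that process over small intervals are
expanded in the increments of `W`; what is left after the term of first order is an error of the
quadratic variation, an error of third order, and terms which are negligible path by path. -/
lemma IsFlowIntegral.isItoIntegral_spdeIntegral
    (hnull : ∀ A : Set Ω, P A = 0 → MeasurableSet[𝓕 0] A) (hW : IsScaledBM 𝓕 P W 1)
    (hI : IsFlowIntegral 𝓕 P W I) (h : 0 < a - σ ^ 2) (ht₀ : 0 < t₀) (hT : t₀ ≤ T) (ζ z : Plane) :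
    IsItoIntegral 𝓕 P W
      (fun s ω => σ * dv (fun y => Gam a σ I s y ζ ω) (flow ((s : ℝ) - t₀) z)) t₀ T
      (spdeIntegral a σ I ζ t₀ z) := by
  obtain ⟨M, hM0, hM⟩ := exists_bound_derivs h (NNReal.coe_pos.2 ht₀)
  set J := spdeIntegral a σ I ζ t₀ z with hJ
  let p : ℝ≥0 → Ω → Plane := fun s ω => flow s (kernelArg σ I ζ z t₀ s ω)
  set H : ℝ≥0 → Ω → ℝ := fun s ω => σ * dv (fun y => Gam a σ I s y ζ ω) (flow ((s : ℝ) - t₀) z)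
    with hH
  have hHe : ∀ s ∈ Set.Icc t₀ T, ∀ ω, H s ω = σ * Gam0v a σ s (p s ω) := fun s hs ω => by
    simp only [hH, p]
    rw [dv_Gam h I (ht₀.trans_le hs.1), flow_sub_condMean]
  have hHm : ∀ s ∈ Set.Icc t₀ T, Measurable[𝓕 s] (H s) := fun s hs => by
    rw [show H s = fun ω => σ * Gam0v a σ s (p s ω) from funext (hHe s hs)]
    exact (hI.adapted_comp_kernelArg σ ζ z t₀ s (measurable_Gam0v a σ s)).const_mul σ
  have hHb : ∀ s ∈ Set.Icc t₀ T, ∀ ω, |H s ω| ≤ |σ| * M := fun s hs ω => by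
    rw [hHe s hs, abs_mul]
    exact mul_le_mul_of_nonneg_left (hM s (NNReal.coe_le_coe.2 hs.1) _).2.1 (abs_nonneg σ)
  have hpc : ∀ ω, Continuous fun s => p s ω := fun ω => hI.continuous_flow_kernelArg ζ z ω
  have hHc : ∀ ω, ContinuousOn (fun s => H s ω) (Set.Icc t₀ T) := fun ω => by
    have h1 : ContinuousOn (fun s : ℝ≥0 => Gam0v a σ s (p s ω)) (Set.Icc t₀ T) :=
      continuousOn_Gam0v_comp h NNReal.continuous_coe.continuousOn (hpc ω).continuousOn
        fun s hs => NNReal.coe_pos.2 (ht₀.trans_le hs.1)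
    exact (continuousOn_const.mul h1).congr fun s hs => hHe s hs ω
  have hJm : ∀ t ∈ Set.Icc t₀ T, Measurable[𝓕 t] (J t) := fun t ht =>
    hI.adapted_spdeIntegral h ht₀ ζ z ht.1
  refine isItoIntegral_of_tendstoInMeasure hW hT hHm hHb hHc hJm
    (fun ω => hI.continuousOn_spdeIntegral h ht₀ ζ z ω) fun t ht => ?_
  -- the second derivative along the path, and the two parts of the error
  let V : ℝ≥0 → Ω → ℝ := fun s ω => 1 / 2 * σ ^ 2 * Gam0vv a σ s (p s ω)
  let C : ℝ≥0 → ℝ≥0 → Ω → ℝ := fun s r ω =>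
    Gam0 a σ s !₂[(p s ω) 0, (p s ω) 1 + σ * (W r ω - W s ω)] - Gam0 a σ s (p s ω) -
      Gam0v a σ s (p s ω) * (σ * (W r ω - W s ω)) -
      1 / 2 * Gam0vv a σ s (p s ω) * (σ * (W r ω - W s ω)) ^ 2
  let R : ℝ≥0 → ℝ≥0 → Ω → ℝ := fun s r ω => J r ω - J s ω - H s ω * (W r ω - W s ω) -
    V s ω * ((W r ω - W s ω) ^ 2 - (1 : ℝ≥0) * (r - s)) - C s r ω
  have hpm : ∀ s, Measurable (p s) := fun s =>
    (measurable_flow s).comp ((hI.adapted_kernelArg σ ζ z t₀ s).mono (𝓕.le s) le_rfl)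
  have hVm : ∀ s ∈ Set.Icc t₀ T, Measurable[𝓕 s] (V s) := fun s _ =>
    (hI.adapted_comp_kernelArg σ ζ z t₀ s (measurable_Gam0vv a σ s)).const_mul _
  have hCm : ∀ s r, Measurable (C s r) := fun s r => by
    have hΔ : Measurable fun ω => σ * (W r ω - W s ω) :=
      ((hW.measurable r).sub (hW.measurable s)).const_mul σ
    have h1 : Measurable fun ω => (!₂[(p s ω) 0, (p s ω) 1 + σ * (W r ω - W s ω)] : Plane) := by
      have h2 : Measurable fun ω => (p s ω) 0 := (measurable_plane_eval 0).comp (hpm s)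
      have h3 : Measurable fun ω => (p s ω) 1 := (measurable_plane_eval 1).comp (hpm s)
      refine measurable_plane fun i => ?_
      fin_cases i
      · exact h2
      · exact h3.add hΔ
    exact ((((measurable_Gam0 a σ s).comp h1).sub ((measurable_Gam0 a σ s).comp (hpm s))).sub
      (((measurable_Gam0v a σ s).comp (hpm s)).mul hΔ)).sub
      ((((measurable_Gam0vv a σ s).comp (hpm s)).const_mul _).mul (hΔ.pow_const 2))
  have hRm : ∀ s r, s ∈ Set.Icc t₀ T → r ∈ Set.Icc t₀ T → Measurable (R s r) := fun s r hs hr => by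
    have hΔ : Measurable fun ω => W r ω - W s ω := (hW.measurable r).sub (hW.measurable s)
    have h1 := (hJm r hr).mono (𝓕.le r) le_rfl
    have h2 := (hJm s hs).mono (𝓕.le s) le_rfl
    have h3 := (hHm s hs).mono (𝓕.le s) le_rfl
    have h4 := (hVm s hs).mono (𝓕.le s) le_rfl
    exact (((h1.sub h2).sub (h3.mul hΔ)).sub (h4.mul ((hΔ.pow_const 2).sub_const _))).sub (hCm s r)
  have hQ := hW.tendstoInMeasure_sum_sq ht hVm (C := 1 / 2 * σ ^ 2 * M) fun s hs ω => by
    rw [abs_mul, abs_of_nonneg (by positivity)]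
    exact mul_le_mul_of_nonneg_left (hM s (NNReal.coe_le_coe.2 hs.1) _).2.2.1 (by positivity)
  have hCub := hW.tendstoInMeasure_sum_cube ht (R := C) (M := M * |σ| ^ 3)
    (fun s r _ _ => hCm s r) fun s r hs _ ω => by
      have h1 := abs_taylor_two_le (M := M) (hasDerivAt_Gam0 (a := a) (σ := σ) (t := s) (p s ω 0))
        (hasDerivAt_Gam0v (p s ω 0)) (hasDerivAt_Gam0vv (p s ω 0))
        (fun u => (hM s (NNReal.coe_le_coe.2 hs.1) _).2.2.2) (p s ω 1) (σ * (W r ω - W s ω))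
      rw [toPlane_eq] at h1
      rw [mul_assoc, ← mul_pow, ← abs_mul]
      exact h1
  have hRes : TendstoInMeasure P (fun n ω => ∑ i ∈ Finset.range (n + 1),
      R (stoppedGrid t₀ T t n i) (stoppedGrid t₀ T t n (i + 1)) ω) atTop (fun _ => 0) := by
    have hmem : ∀ n i, stoppedGrid t₀ T t n i ∈ Set.Icc t₀ T := fun n i =>
      ⟨le_stoppedGrid n i, (stoppedGrid_le ht n i).trans ht.2⟩
    refine tendstoInMeasure_of_tendsto_ae (fun n => (Finset.measurable_sum _ fun i _ =>
      hRm _ _ (hmem n i) (hmem n (i + 1))).aestronglyMeasurable) ?_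
    filter_upwards [hI.ae_eq hnull hW, hW.cont] with ω hω hWc
    refine tendsto_sum_stoppedGrid_zero ht (E := fun s r => R s r ω) fun ε hε => ?_
    have hW' := continuous_path_toNNReal hWc
    obtain ⟨δ, hδ, hR⟩ := exists_forall_remainder_le (T := T) h ht₀
      (hI.continuous_kernelArg σ ζ z t₀ ω) hWc (fun s r => by
        simp only [kernelArg, PiLp.add_apply, PiLp.smul_apply, smul_eq_mul, (hω r).2, (hω s).2]
        ring) (fun s r => by
        have h1 := intervalIntegral.integral_add_adjacent_intervals
          (hW'.intervalIntegrable 0 s) (hW'.intervalIntegrable s r) (μ := volume)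
        rw [intervalIntegral.integral_sub (hW'.intervalIntegrable s r)
          intervalIntegrable_const, intervalIntegral.integral_const]
        simp only [kernelArg, PiLp.add_apply, PiLp.smul_apply, smul_eq_mul, (hω r).2, (hω s).2,
          (hω r).1, (hω s).1, ← h1]
        ring) hε
    refine ⟨δ, hδ, fun s r hs hsr hr hd => ?_⟩
    have hr' : r ≤ T := hr.trans ht.2
    have h2 := hR s r hs hsr hr' hd
    refine le_trans (le_of_eq ?_) h2
    congr 1
    have hc := (hI.continuous_pathVV h ht₀ ζ z ω).const_mul (1 / 2 * a)
    have h3 := intervalIntegral.integral_add_adjacent_intervals (μ := volume)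
      (hc.intervalIntegrable t₀ s) (hc.intervalIntegrable s r)
    have hJr := spdeIntegral_eq h ht₀ I ζ z (hs.trans hsr) ω
    have hJs := spdeIntegral_eq h ht₀ I ζ z hs ω
    rw [← h3] at hJr
    have hVs := pathVV_eq (a := a) (σ := σ) (y := fun s => kernelArg σ I ζ z t₀ s ω)
      (w := s) (NNReal.coe_le_coe.2 hs)
    rw [Real.toNNReal_coe] at hVs
    simp only [R, C, V, hJ, hJr, hJs, hHe s ⟨hs, hsr.trans hr'⟩ ω, hVs, p, NNReal.coe_one]
    ring
  have hall := tendstoInMeasure_zero_add (tendstoInMeasure_zero_add hQ hCub) hRes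
  rw [tendstoInMeasure_iff_norm] at hall ⊢
  intro ε hε
  refine (hall ε hε).congr fun n => ?_
  congr 1
  ext ω
  have h0 : J t₀ ω = 0 := by
    have h1 := spdeIntegral_eq h ht₀ I ζ z (le_refl t₀) ω
    rw [hJ, h1, intervalIntegral.integral_same]
    ring
  have hsum : (gridIntegrand hT hHm hHb n).integral W t₀ t ω - J t ω =
      -((∑ i ∈ Finset.range (n + 1), V (stoppedGrid t₀ T t n i) ω *
        ((W (stoppedGrid t₀ T t n (i + 1)) ω - W (stoppedGrid t₀ T t n i) ω) ^ 2 -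
          (1 : ℝ≥0) * (stoppedGrid t₀ T t n (i + 1) - stoppedGrid t₀ T t n i)) +
      ∑ i ∈ Finset.range (n + 1),
        C (stoppedGrid t₀ T t n i) (stoppedGrid t₀ T t n (i + 1)) ω) +
      ∑ i ∈ Finset.range (n + 1),
        R (stoppedGrid t₀ T t n i) (stoppedGrid t₀ T t n (i + 1)) ω) := by
    have h1 := sum_stoppedGrid_sub ht n (fun s => J s ω)
    rw [gridIntegrand_integral hT hHm hHb W ht n ω, ← Finset.sum_add_distrib,
      ← Finset.sum_add_distrib, ← sub_zero (J t ω), ← h0, ← h1, ← Finset.sum_sub_distrib,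
      ← Finset.sum_neg_distrib]
    refine Finset.sum_congr rfl fun i _ => ?_
    simp only [R]
    ring
  rw [Set.mem_ofPred_eq, Set.mem_ofPred_eq, hsum, norm_neg, sub_zero]

end Ito

/-! ### Predictability of continuous adapted processes -/

section Predictable

variable {𝓕 : Filtration ℝ≥0 mΩ} {t₀ T : ℝ≥0}

lemma measurableSet_predictableOn_lt {r : ℝ≥0} (hr : t₀ ≤ r) {A : Set Ω}
    (hA : MeasurableSet[𝓕 r] A) : MeasurableSet[predictableOn 𝓕 t₀ T]
      {p : Set.Icc t₀ T × Ω | r < (p.1 : ℝ≥0) ∧ p.2 ∈ A} :=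
  MeasurableSpace.measurableSet_generateFrom (.inr ⟨r, A, hr, hA, rfl⟩)

lemma measurableSet_predictableOn_eq {A : Set Ω} (hA : MeasurableSet[𝓕 t₀] A) :
    MeasurableSet[predictableOn 𝓕 t₀ T] {p : Set.Icc t₀ T × Ω | (p.1 : ℝ≥0) = t₀ ∧ p.2 ∈ A} :=
  MeasurableSpace.measurableSet_generateFrom (.inl ⟨A, hA, rfl⟩)

/-- A function which vanishes outside a set is measurable as soon as its level sets within that
set are measurable. -/
lemma measurable_indicator_of_inter {α : Type*} {m : MeasurableSpace α} {D : Set α}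
    (hD : MeasurableSet D) {f : α → ℝ}
    (hf : ∀ s, MeasurableSet s → MeasurableSet (D ∩ f ⁻¹' s)) : Measurable (D.indicator f) := by
  intro s hs
  rw [Set.indicator_preimage, Set.ite]
  refine MeasurableSet.union ?_ ((measurable_zero hs).diff hD)
  rw [Set.inter_comm]
  exact hf s hs

/-- A simple integrand whose times are not before `t₀` is predictable. -/
lemma SimpleIntegrand.measurable_predictableOn_eval (S : SimpleIntegrand 𝓕)
    (hS : ∀ i, t₀ ≤ S.time i) :
    Measurable[predictableOn 𝓕 t₀ T] fun p : Set.Icc t₀ T × Ω => S.eval p.1 p.2 := by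
  have hlt : ∀ {r : ℝ≥0}, t₀ ≤ r → MeasurableSet[predictableOn 𝓕 t₀ T]
      {p : Set.Icc t₀ T × Ω | r < (p.1 : ℝ≥0)} := fun {r} hr => by
    simpa using measurableSet_predictableOn_lt (T := T) hr (A := Set.univ)
      (@MeasurableSet.univ _ (𝓕 r))
  refine Finset.measurable_sum _ fun i _ => ?_
  let D : Set (Set.Icc t₀ T × Ω) := {p | S.time i < (p.1 : ℝ≥0)}
  let D' : Set (Set.Icc t₀ T × Ω) := {p | S.time (i + 1) < (p.1 : ℝ≥0)}
  have hD : MeasurableSet[predictableOn 𝓕 t₀ T] D := hlt (hS i)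
  have hD' : MeasurableSet[predictableOn 𝓕 t₀ T] D' := hlt (hS (i + 1))
  have h1 : Measurable[predictableOn 𝓕 t₀ T] (D.indicator fun p => S.coef i p.2) :=
    measurable_indicator_of_inter hD fun s hs =>
      measurableSet_predictableOn_lt (hS i) (S.meas i hs)
  have h2 := h1.indicator (@MeasurableSet.compl _ _ (predictableOn 𝓕 t₀ T) hD')
  convert h2 using 1
  funext p
  by_cases h3 : S.time i < (p.1 : ℝ≥0) <;> by_cases h4 : S.time (i + 1) < (p.1 : ℝ≥0) <;>
    simp [Set.indicator, D, D', h3, h4]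

/-- Continuous bounded adapted processes are predictable, as limits of simple integrands. -/
lemma measurable_predictableOn_of_continuousOn (h : t₀ ≤ T) {U : ℝ≥0 → Ω → ℝ}
    (hU : ∀ t ∈ Set.Icc t₀ T, Measurable[𝓕 t] (U t)) {C : ℝ}
    (hC : ∀ t ∈ Set.Icc t₀ T, ∀ ω, |U t ω| ≤ C)
    (hc : ∀ ω, ContinuousOn (fun t => U t ω) (Set.Icc t₀ T)) :
    Measurable[predictableOn 𝓕 t₀ T] fun p : Set.Icc t₀ T × Ω => U p.1 p.2 := by
  let D : Set (Set.Icc t₀ T × Ω) := {p | (p.1 : ℝ≥0) = t₀}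
  have hD : MeasurableSet[predictableOn 𝓕 t₀ T] D := by
    have h1 := measurableSet_predictableOn_eq (𝓕 := 𝓕) (T := T) (A := Set.univ)
      (@MeasurableSet.univ _ (𝓕 t₀))
    simp only [Set.mem_univ, and_true] at h1
    exact h1
  have h0 : Measurable[predictableOn 𝓕 t₀ T] (D.indicator fun p => U t₀ p.2) :=
    measurable_indicator_of_inter hD fun s hs =>
      measurableSet_predictableOn_eq (hU t₀ ⟨le_rfl, h⟩ hs)
  let S := gridIntegrand h hU hC
  have hSm : ∀ n, Measurable[predictableOn 𝓕 t₀ T]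
      (Dᶜ.indicator fun p : Set.Icc t₀ T × Ω => (S n).eval p.1 p.2) := fun n =>
    ((S n).measurable_predictableOn_eval fun i => le_grid _ _ _ _).indicator
      (@MeasurableSet.compl _ _ (predictableOn 𝓕 t₀ T) hD)
  refine @measurable_of_tendsto_metrizable _ _ (predictableOn 𝓕 t₀ T) _ _ _ _
    (fun n => D.indicator (fun p => U t₀ p.2) +
      Dᶜ.indicator fun p : Set.Icc t₀ T × Ω => (S n).eval p.1 p.2) _
    (fun n => h0.add (hSm n)) (tendsto_pi_nhds.2 fun p => ?_)
  by_cases hp : (p.1 : ℝ≥0) = t₀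
  · have h1 : p ∈ D := hp
    simp [h1, hp]
  · have h1 : p ∉ D := hp
    simp only [Pi.add_apply, Set.indicator_of_notMem h1, zero_add,
      Set.indicator_of_mem (Set.mem_compl h1)]
    exact tendsto_gridIntegrand_eval h hU hC (hc p.2)
      ⟨lt_of_le_of_ne p.1.2.1 (Ne.symm hp), p.1.2.2⟩

end Predictable

/-! ### The stochastic fundamental solution -/

section FundSol

variable {𝓕 : Filtration ℝ≥0 mΩ} {P : Measure Ω} [IsProbabilityMeasure P] {W : ℝ≥0 → Ω → ℝ}
  {I : ℝ≥0 → Ω → Plane} {a σ : ℝ} {T : ℝ≥0}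

lemma abs_Gam0_le (h : 0 < a - σ ^ 2) {t₀ t : ℝ} (ht₀ : 0 < t₀) (ht : t₀ ≤ t) (y : Plane) :
    |Gam0 a σ t y| ≤ √3 / (Real.pi * t₀ ^ 2 * (a - σ ^ 2)) := by
  have ht' : 0 < t := ht₀.trans_le ht
  have hQ := nonneg_of_mul_nonneg_right ((sq_nonneg _).trans (slope_sq_le ht' y).1)
    (by positivity)
  rw [abs_of_nonneg (Gam0_nonneg h.le y), Gam0]
  refine (mul_le_of_le_one_right (by positivity) (Real.exp_le_one_iff.2 ?_)).trans ?_
  · rw [neg_mul]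
    exact neg_nonpos.2 (mul_nonneg (by positivity) hQ)
  · gcongr

omit [IsProbabilityMeasure P] in
lemma IsFlowIntegral.continuous_condMean (hI : IsFlowIntegral 𝓕 P W I) (σ : ℝ) (ζ : Plane)
    (ω : Ω) : Continuous fun t : ℝ≥0 => condMean σ I ζ t ω :=
  continuous_flow NNReal.continuous_coe (continuous_const.sub ((hI.continuous ω).const_smul σ))

omit [IsProbabilityMeasure P] in
lemma IsFlowIntegral.adapted_condMean (hI : IsFlowIntegral 𝓕 P W I) (σ : ℝ) (ζ : Plane)
    (t : ℝ≥0) : Measurable[𝓕 t] (condMean σ I ζ t) := by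
  have h1 : Measurable[𝓕 t] fun ω => σ • I t ω := (hI.adapted t).fun_const_smul σ
  exact (measurable_flow t).comp (h1.const_sub ζ)

omit [IsProbabilityMeasure P] in
lemma IsFlowIntegral.continuous_sub_condMean (hI : IsFlowIntegral 𝓕 P W I) (σ : ℝ) (ζ : Plane)
    (ω : Ω) : Continuous fun p : ℝ≥0 × Plane => p.2 - condMean σ I ζ p.1 ω :=
  continuous_snd.sub ((hI.continuous_condMean σ ζ ω).comp continuous_fst)

lemma contDiff_Gam0 (a σ t x : ℝ) (m : Plane) :
    ContDiff ℝ 2 fun v : ℝ => Gam0 a σ t (!₂[x, v] - m) := by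
  simp only [Gam0, PiLp.sub_apply, Matrix.cons_val_zero, Matrix.cons_val_one,
    Matrix.cons_val_fin_one]
  fun_prop

/-- Away from the critical noise level the random kernel is the stochastic fundamental solution. -/
lemma IsFlowIntegral.isStochFundSol (hnull : ∀ A : Set Ω, P A = 0 → MeasurableSet[𝓕 0] A)
    (hW : IsScaledBM 𝓕 P W 1) (hI : IsFlowIntegral 𝓕 P W I) (h : 0 < a - σ ^ 2) :
    IsStochFundSol 𝓕 P W a σ 0 T (Gam a σ I) where
  predictable ζ z t₀ ht₀ hT := by
    have hpos : ∀ t ∈ Set.Icc t₀ T, 0 < t := fun t ht => ht₀.trans_le ht.1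
    have hc : ∀ ω, Continuous fun t : ℝ≥0 => z - condMean σ I ζ t ω := fun ω =>
      continuous_const.sub (hI.continuous_condMean σ ζ ω)
    refine measurable_predictableOn_of_continuousOn hT (U := fun t ω => Gam a σ I t z ζ ω)
      (fun t ht => ?_) (C := √3 / (Real.pi * t₀ ^ 2 * (a - σ ^ 2))) (fun t ht ω => ?_) fun ω => ?_
    · have h1 : Measurable[𝓕 t] fun ω => z - condMean σ I ζ t ω :=
        (hI.adapted_condMean σ ζ t).const_sub z
      simp only [Gam_eq_Gam0 h I (hpos t ht)]
      exact (measurable_Gam0 a σ t).comp h1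
    · rw [Gam_eq_Gam0 h I (hpos t ht)]
      exact abs_Gam0_le h (NNReal.coe_pos.2 ht₀) (NNReal.coe_le_coe.2 ht.1) _
    · exact (continuousOn_Gam0_comp h NNReal.continuous_coe.continuousOn (hc ω).continuousOn
        fun t ht => NNReal.coe_pos.2 (hpos t ht)).congr fun t ht => Gam_eq_Gam0 h I (hpos t ht) _ _ _
  contDiff ζ ω t ht x := by
    simp only [Gam_eq_Gam0 h I ht.1]
    exact contDiff_Gam0 a σ t x _
  cont ζ ω :=
    (continuousOn_Gam0_comp h (NNReal.continuous_coe.comp continuous_fst).continuousOn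
      (hI.continuous_sub_condMean σ ζ ω).continuousOn
      fun p hp => NNReal.coe_pos.2 hp.1.1).congr fun p hp => Gam_eq_Gam0 h I hp.1.1 _ _ _
  cont_dv ζ ω :=
    (continuousOn_Gam0v_comp h (NNReal.continuous_coe.comp continuous_fst).continuousOn
      (hI.continuous_sub_condMean σ ζ ω).continuousOn
      fun p hp => NNReal.coe_pos.2 hp.1.1).congr fun p hp => dv_Gam h I hp.1.1 _ _ _
  cont_dvv ζ ω :=
    (continuousOn_Gam0vv_comp h (NNReal.continuous_coe.comp continuous_fst).continuousOn
      (hI.continuous_sub_condMean σ ζ ω).continuousOn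
      fun p hp => NNReal.coe_pos.2 hp.1.1).congr fun p hp => dv_dv_Gam h I hp.1.1 _ _ _
  eqn ζ := by
    refine ⟨spdeIntegral a σ I ζ, fun t₀ z ht₀ hT =>
      hI.isItoIntegral_spdeIntegral hnull hW h ht₀ hT ζ z, ae_of_all _ fun ω t₀ t z _ _ _ => ?_⟩
    rw [spdeIntegral]
    ring
  initial φ z₀ := by
    filter_upwards [hI.ae_eq hnull hW] with ω hω
    have h0 : I 0 ω = 0 := plane_ext (by simpa using (hω 0).1) (by simpa using (hω 0).2)
    exact tendsto_integral_Gam h I (hI.continuous ω) h0 φ z₀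

end FundSol

end Langevin

end

theorem mainTheorem7 {Ω : Type*} {mΩ : MeasurableSpace Ω} (P : Measure Ω) [IsProbabilityMeasure P]
    (𝓕 : Filtration ℝ≥0 mΩ) (hnull : ∀ A : Set Ω, P A = 0 → MeasurableSet[𝓕 0] A)
    (B W : ℝ≥0 → Ω → ℝ) (hBW : Langevin.IsBrownianPair 𝓕 P B W)
    (a σ : ℝ) (ha : 0 < a) (hσ₀ : 0 ≤ σ) (hσ : σ ≤ √a) :
    -- the stochastic integrals exist
    (∃ I, Langevin.IsFlowIntegral 𝓕 P (Langevin.noise a σ B W) I) ∧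
    (∃ I, Langevin.IsFlowIntegral 𝓕 P W I) ∧
    -- the solution of the Langevin equation exists, is unique and is given by the explicit formula
    (∀ I, Langevin.IsFlowIntegral 𝓕 P (Langevin.noise a σ B W) I → ∀ ζ : Langevin.Plane,
      Langevin.IsLangevinSolution 𝓕 P B W a σ ζ (fun t ω => Langevin.flow t (ζ + I t ω)) ∧
      ∀ Z, Langevin.IsLangevinSolution 𝓕 P B W a σ ζ Z →
        ∀ᵐ ω ∂P, ∀ t, Z t ω = Langevin.flow t (ζ + I t ω)) ∧
    -- explicit form of `Q_t`
    (∀ t : ℝ≥0, Langevin.Qmat t = !![(t : ℝ) ^ 3 / 3, (t : ℝ) ^ 2 / 2; (t : ℝ) ^ 2 / 2, (t : ℝ)]) ∧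
    -- here `I` is a version of the integral of `e^{-sB} e₂ dW_s`
    (∀ I, Langevin.IsFlowIntegral 𝓕 P W I →
      (∀ (ζ : Langevin.Plane) (Z : ℝ≥0 → Ω → Langevin.Plane),
        Langevin.IsLangevinSolution 𝓕 P B W a σ ζ Z → ∀ t : ℝ≥0,
        -- conditional mean
        MemLp (Z t) 2 P ∧
        P[Z t | Langevin.observed W t] =ᵐ[P] Langevin.condMean σ I ζ t ∧
        (∃ K, Langevin.IsItoIntegral 𝓕 P W (fun s _ => (t : ℝ) - s) 0 t K) ∧
        (∀ K, Langevin.IsItoIntegral 𝓕 P W (fun s _ => (t : ℝ) - s) 0 t K →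
          ∀ᵐ ω ∂P, Langevin.condMean σ I ζ t ω =
            !₂[ζ 0 + t * ζ 1 - σ * K t ω, ζ 1 - σ * W t ω]) ∧
        -- conditional covariance
        (∀ i j, Langevin.condCov P (Langevin.observed W t) (Z t) i j =ᵐ[P]
          fun _ => Langevin.Cmat a σ t i j) ∧
        -- conditional law
        (Langevin.Cmat a σ t).PosSemidef ∧
        Langevin.IsCondLaw P (Langevin.observed W t) (Z t)
          (fun ω => multivariateGaussian (Langevin.condMean σ I ζ t ω) (Langevin.Cmat a σ t)) ∧
        (σ = √a → Langevin.IsCondLaw P (Langevin.observed W t) (Z t)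
          (fun ω => Measure.dirac (Langevin.condMean σ I ζ t ω))) ∧
        (σ < √a → 0 < t → Langevin.IsCondLaw P (Langevin.observed W t) (Z t)
          (fun ω => volume.withDensity fun z => ENNReal.ofReal (Langevin.Gam a σ I t z ζ ω)))) ∧
      -- explicit form of the density
      (σ < √a → ∀ (t : ℝ≥0) (z ζ : Langevin.Plane) (ω : Ω), 0 < t →
        Langevin.Gam a σ I t z ζ ω =
          Langevin.Gam0 a σ t (z - Langevin.condMean σ I ζ t ω)) ∧
      -- the density is the stochastic fundamental solution
      (σ < √a → ∀ T : ℝ≥0, 0 < T →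
        Langevin.IsStochFundSol 𝓕 P W a σ 0 T (Langevin.Gam a σ I))) := by
  have h := Langevin.sub_sq_nonneg_of_le_sqrt ha hσ₀ hσ
  obtain ⟨c, hX⟩ := hBW.isScaledBM_noise a σ
  have hW := hBW.isScaledBM_right
  refine ⟨Langevin.exists_isFlowIntegral hnull hX, Langevin.exists_isFlowIntegral hnull hW,
    fun I hI ζ => ⟨Langevin.isLangevinSolution_flow hnull hBW hI ζ, fun Z hZ =>
      hZ.ae_eq_flow hnull hBW hI⟩, fun t => Langevin.Qmat_eq t, fun I hI =>
    ⟨fun ζ Z hZ t => ?_, fun hσ' t z ζ ω ht => Langevin.Gam_eq_Gam0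
      (Langevin.sub_sq_pos_of_lt_sqrt ha hσ₀ hσ') I ht z ζ ω, fun hσ' T _ =>
      hI.isStochFundSol hnull hW (Langevin.sub_sq_pos_of_lt_sqrt ha hσ₀ hσ')⟩⟩
  have hlaw := hZ.isCondLaw hnull hBW h hI t
  refine ⟨hZ.memLp hnull hBW h t, hZ.condExp_eq hnull hBW h hI t,
    Langevin.exists_isItoIntegral_sub hnull hW t, fun K hK =>
    Langevin.condMean_ae_eq hnull hBW hI ζ hK, hZ.condCov_eq hnull hBW h t,
    Langevin.Cmat_posSemidef h t.coe_nonneg, hlaw, fun hσ' => ?_, fun hσ' ht => ?_⟩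
  · have hC : Langevin.Cmat a σ t = 0 := by
      rw [Langevin.Cmat, hσ', Real.sq_sqrt ha.le, sub_self, zero_smul]
    simpa only [hC, Langevin.multivariateGaussian_zero_matrix] using hlaw
  · have h' := Langevin.sub_sq_pos_of_lt_sqrt ha hσ₀ hσ'
    simpa only [Langevin.multivariateGaussian_eq_withDensity h' (NNReal.coe_pos.2 ht),
      Langevin.Gam_eq_Gam0 h' I ht] using hlaw
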